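/- Let $A$ and $B$ be $C^*$-algebras, let $E$ be a Hilbert $C^*$-module over $B$, let $\mathcal L(E)$ be the $C^*$-algebra of bounded adjointable operators on $E$ and $\mathcal K(E)\subset\mathcal L(E)$ the compact operators (the closed linear span of the operators $z\mapsto x\langle y,z\rangle$, $x,y\in E$), and let $A\to\mathcal L(E)$ be a $*$-homomorphism. An operator $K\in\mathcal L(E)$ is called $A$-locally compact if $aK,\,Ka\in\mathcal K(E)$ for all $a\in A$. For self-adjoint $Q,R\in\mathcal L(E)$ one says that $Q\le R$ modulo $A$-locally compact operators if $Q\le R+K$ for some $A$-locally compact $K$. A self-adjoint operator $S$ in $E$ is called regular if $S+z$ and $S-z$ have dense range for one (equivalently, every) $z\in\mathbb C\setminus\mathbb R$. A pair $(S,T)$ of self-adjoint regular operators in $E$ is called weakly anticommuting if, with $$\mathcal F(S,T)=\{x\in\mathcal D(S)\cap\mathcal D(T):\ Sx\in\mathcal D(T),\ Tx\in\mathcal D(S)\},$$ 1. there are constants $C_0,C_1,C_2>0$ such that for all $x\in\mathcal F(S,T)$, with $[S,T]x=STx+TSx$, $$\langle [S,T]x,[S,T]x\rangle\le C_0\langle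 x,x\rangle+C_1\langle Sx,Sx\rangle+C_2\langle Tx,Tx\rangle\quad\text{in } B;$$ 2. there are a core $\mathcal E\subset\mathcal D(T)$ for $T$ and $\lambda_0>0$ such that $(S+\lambda)^{-1}(\mathcal E)\subset\mathcal F(S,T)$ for all $\lambda\in i\mathbb R$ with $|\lambda|\ge\lambda_0$. **Proposition.** Let $(S,T)$ be a weakly anticommuting pair in $E$ such that the resolvents $(D_\pm+i)^{-1}$ and $(D_\pm-i)^{-1}$ of the operators $D_\pm=S\pm T$ with domain $\mathcal D(S)\cap\mathcal D(T)$ are $A$-locally compact. Let $\chi(t)=\frac2\pi\arctan t$. Then for every $\kappa>0$ there is $r>0$ such that $(rS,rT)$ is a weakly anticommuting pair, $rD_+=rS+rT$ is self-adjoint and regular, and $$\chi(rS)\,\chi(rD_+)+\chi(rD_+)\,\chi(rS)\ \ge\ -\kappa$$ modulo $A$-locally compact operators, where $\chi(rS)$ and $\chi(rD_+)$ are given by the bounded continuous functional calculus of self-adjoint regular operators. -/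

import Mathlib

open scoped BoundedContinuousFunction

/-! Hilbert `B`-modules are Mathlib's `CStarModule B E` (with `E` complete).  Mathlib lets `B` act
from the left, with `⟪x, b • y⟫ = b * ⟪x, y⟫` and the inner product linear in the second variable.
A right Hilbert module over a C⋆-algebra is the same thing as such a module over the opposite
C⋆-algebra; as `B` is arbitrary throughout, this is only a matter of notation. -/

namespace HilbertMod

section Adjointable

variable (B E : Type*) [NonUnitalCStarAlgebra B] [PartialOrder B] [StarOrderedRing B]
  [NormedAddCommGroup E] [NormedSpace ℂ E] [SMul B E] [CStarModule B E]

/-- The algebra `𝓛(E)` of bounded adjointable operators, as a subalgebra of the bounded `ℂ`-linear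
operators with the operator norm.  (`B`-linearity follows from adjointability.) -/
def adjointable : Subalgebra ℂ (E →L[ℂ] E) where
  carrier := {T | ∃ T' : E →L[ℂ] E, ∀ x y : E, inner B (T x) y = inner B x (T' y)}
  mul_mem' := by
    rintro S T ⟨S', hS⟩ ⟨T', hT⟩
    exact ⟨T' * S', fun x y => by simp [hS, hT]⟩
  add_mem' := by
    rintro S T ⟨S', hS⟩ ⟨T', hT⟩
    exact ⟨S' + T', fun x y => by simp [hS, hT]⟩
  algebraMap_mem' := fun z => ⟨algebraMap ℂ _ (star z), fun x y => by
    simp [Algebra.algebraMap_eq_smul_one]⟩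

/-- The type of bounded adjointable operators on `E`. -/
abbrev Adj : Type _ := ↥(adjointable B E)

variable {B E}

/-- The adjoint of an adjointable operator. -/
noncomputable instance : Star (Adj B E) where
  star T := ⟨T.2.choose, T.1, fun x y => by
    rw [← CStarModule.star_inner, ← T.2.choose_spec, CStarModule.star_inner]⟩

theorem inner_star_right (T : Adj B E) (x y : E) :
    inner B (T.1 x) y = inner B x ((star T).1 y) :=
  T.2.choose_spec x y

/-- The C⋆-algebra `𝓚(E)` of compact operators in the sense of Hilbert C⋆-modules: the norm closed
linear span in `𝓛(E)` of the rank one operators `θ_{x,y} : z ↦ x⟨y,z⟩`. -/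
def compacts (B E : Type*) [NonUnitalCStarAlgebra B] [PartialOrder B] [StarOrderedRing B]
    [NormedAddCommGroup E] [NormedSpace ℂ E] [SMul B E] [CStarModule B E] : Set (Adj B E) :=
  closure (Submodule.span ℂ {K : Adj B E | ∃ x y : E, ∀ z : E, K.1 z = inner B y z • x} :
    Set (Adj B E))

/-- `K` is `A`-locally compact, for a representation `π` of `A` on `E`: both `aK` and `Ka` are
compact for every `a ∈ A`. -/
def IsLocallyCompact {A : Type*} [NonUnitalCStarAlgebra A] (π : A →⋆ₙₐ[ℂ] Adj B E)
    (K : Adj B E) : Prop :=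
  ∀ a : A, π a * K ∈ compacts B E ∧ K * π a ∈ compacts B E

/-- The order of self-adjoint operators in `𝓛(E)`, through quadratic forms. -/
def OpLE (Q R : Adj B E) : Prop :=
  ∀ x : E, inner B x (Q.1 x) ≤ inner B x (R.1 x)

/-- `Q ≤ R` modulo `A`-locally compact operators. -/
def OpLEModLocallyCompact {A : Type*} [NonUnitalCStarAlgebra A] (π : A →⋆ₙₐ[ℂ] Adj B E)
    (Q R : Adj B E) : Prop :=
  ∃ K : Adj B E, IsLocallyCompact π K ∧ OpLE Q (R + K)

end Adjointable

section Unbounded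

variable (B : Type*) {E : Type*} [NonUnitalCStarAlgebra B] [PartialOrder B] [StarOrderedRing B]
  [NormedAddCommGroup E] [NormedSpace ℂ E] [SMul B E] [CStarModule B E]

/-- A self-adjoint regular operator in `E`: it is densely defined, equals its adjoint
(with respect to the `B`-valued inner product; the domain is then a `B`-submodule and the operator
is `B`-linear), and `D + z`, `D - z` have dense range for some, equivalently for all, `z ∈ ℂ ∖ ℝ`. -/
structure IsSelfAdjointRegular (D : E →ₗ.[ℂ] E) : Prop where
  dense_domain : Dense (D.domain : Set E)
  symmetric : ∀ x y : D.domain, inner B (D x) (y : E) = inner B (x : E) (D y)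
  adjoint_le : ∀ y w : E, (∀ x : D.domain, inner B (D x) y = inner B (x : E) w) →
    ∃ hy : y ∈ D.domain, D ⟨y, hy⟩ = w
  regular : ∃ z : ℂ, z.im ≠ 0 ∧ Dense (Set.range fun x : D.domain => D x + z • (x : E)) ∧
    Dense (Set.range fun x : D.domain => D x - z • (x : E))

/-- `x` belongs to `𝓕(S,T) = {x ∈ 𝓓(S) ∩ 𝓓(T) : Sx ∈ 𝓓(T), Tx ∈ 𝓓(S)}`. -/
def MemF (S T : E →ₗ.[ℂ] E) (x : E) : Prop :=
  ∃ (hS : x ∈ S.domain) (hT : x ∈ T.domain), S ⟨x, hS⟩ ∈ T.domain ∧ T ⟨x, hT⟩ ∈ S.domain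

/-- A weakly anticommuting pair of self-adjoint regular operators.  In the last field
`(S + iμ)⁻¹(𝓔)` is the set of all `x ∈ 𝓓(S)` with `(S + iμ)x ∈ 𝓔`. -/
structure IsWeaklyAnticommuting (S T : E →ₗ.[ℂ] E) : Prop where
  left : IsSelfAdjointRegular B S
  right : IsSelfAdjointRegular B T
  form_estimate : ∃ C₀ C₁ C₂ : ℝ, 0 < C₀ ∧ 0 < C₁ ∧ 0 < C₂ ∧
    ∀ (x : E) (hS : x ∈ S.domain) (hT : x ∈ T.domain)
      (hST : S ⟨x, hS⟩ ∈ T.domain) (hTS : T ⟨x, hT⟩ ∈ S.domain),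
      inner B (S ⟨T ⟨x, hT⟩, hTS⟩ + T ⟨S ⟨x, hS⟩, hST⟩) (S ⟨T ⟨x, hT⟩, hTS⟩ + T ⟨S ⟨x, hS⟩, hST⟩)
        ≤ C₀ • inner B x x + C₁ • inner B (S ⟨x, hS⟩) (S ⟨x, hS⟩)
          + C₂ • inner B (T ⟨x, hT⟩) (T ⟨x, hT⟩)
  core : ∃ 𝓔 : Submodule ℂ E, T.HasCore 𝓔 ∧ ∃ l₀ : ℝ, 0 < l₀ ∧
    ∀ μ : ℝ, l₀ ≤ |μ| → ∀ x : S.domain,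
      S x + (μ * Complex.I) • (x : E) ∈ 𝓔 → MemF S T x

variable {B}

/-- `R ∈ 𝓛(E)` is the inverse `(D + z)⁻¹`. -/
def IsResolvent (D : E →ₗ.[ℂ] E) (z : ℂ) (R : Adj B E) : Prop :=
  (∀ y : E, ∃ h : R.1 y ∈ D.domain, D ⟨R.1 y, h⟩ + z • R.1 y = y) ∧
    ∀ x : D.domain, R.1 (D x + z • (x : E)) = x

/-- The resolvents `(D ± i)⁻¹` are `A`-locally compact.  For a self-adjoint regular `D` they exist
and are unique; existence is not made part of this condition. -/
def HasLocallyCompactResolvents {A : Type*} [NonUnitalCStarAlgebra A] (π : A →⋆ₙₐ[ℂ] Adj B E)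
    (D : E →ₗ.[ℂ] E) : Prop :=
  ∀ R : Adj B E, IsResolvent D Complex.I R ∨ IsResolvent D (-Complex.I) R → IsLocallyCompact π R

/-- `Φ` is the bounded continuous functional calculus of `D`: a unital `*`-homomorphism
`C_b(ℝ) → 𝓛(E)` sending `t ↦ (t + z)⁻¹` to `(D + z)⁻¹` for `z ∈ ℂ ∖ ℝ`.  If it exists, it is unique:
the resolvents determine `Φ` on `C₀(ℝ)`, hence on `C_b(ℝ)` because the range of `(D + z)⁻¹`
is dense. -/
def IsFunctionalCalculus (D : E →ₗ.[ℂ] E) (Φ : (ℝ →ᵇ ℂ) →⋆ₐ[ℂ] Adj B E) : Prop :=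
  ∀ z : ℂ, z.im ≠ 0 → ∀ f : ℝ →ᵇ ℂ, (∀ t : ℝ, f t = ((t : ℂ) + z)⁻¹) → IsResolvent D z (Φ f)

/-- `F = f(D)` in the sense of the bounded continuous functional calculus. -/
def IsFunctionOf (f : ℝ →ᵇ ℂ) (D : E →ₗ.[ℂ] E) (F : Adj B E) : Prop :=
  ∃ Φ : (ℝ →ᵇ ℂ) →⋆ₐ[ℂ] Adj B E, IsFunctionalCalculus D Φ ∧ Φ f = F

end Unbounded

/-- The normalizing function `χ(t) = (2/π) arctan t`. -/
noncomputable def chi : ℝ →ᵇ ℂ :=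
  BoundedContinuousFunction.ofNormedAddCommGroup
    (fun t : ℝ => ((2 / Real.pi * Real.arctan t : ℝ) : ℂ))
    (Complex.continuous_ofReal.comp (continuous_const.mul Real.continuous_arctan)) 1 (fun t => by
      rw [Complex.norm_real, Real.norm_eq_abs, abs_mul, abs_of_pos (by positivity)]
      have h : |Real.arctan t| ≤ Real.pi / 2 :=
        abs_le.2 ⟨(Real.neg_pi_div_two_lt_arctan t).le, (Real.arctan_lt_pi_div_two t).le⟩
      calc 2 / Real.pi * |Real.arctan t| ≤ 2 / Real.pi * (Real.pi / 2) := by gcongr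
        _ = 1 := by field_simp)

end HilbertMod

/-! Write D = S + T and X = S(s² + S²)⁻¹. If S and T anticommuted exactly, X would anticommute with
T, so XD + DX = 2S²(s² + S²)⁻¹ ≥ 0. Since χ(S) is (2/π)∫₁^∞ X ds in the strong sense, up to bounded
rescalings χ(S/M) that vanish as M → ∞, the form of Dχ(S) + χ(S)D would be nonnegative, and the same
integral for D would turn D into χ(D). The proof makes this quantitative. Passing to (rS, rT)
replaces the anticommutator constant C by r²C = γ², and every error is a multiple of γ. The
inequality then holds exactly for small r, with locally compact correction 0.

The errors are controlled as follows. The anticommutator of T with X has norm O(γ/s²) relative to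
the graph norms (`StronglyAnticommuting.idQuot_commutator`), and T is bounded relative to D with a
constant K that does not depend on r (`StronglyAnticommuting.norm_le_smul_add`). With P = (1 +
D²)^(-1/2) the error is PZ, where PZ is self-adjoint and ‖Z‖ = O(γ(1 + 2K)/s²). Operator
monotonicity of the square root gives PZ ≥ -‖Z‖P (`form_mul_ge`), which keeps one factor P.
Integrating in s shows that the real part of ⟨DPx, χ(S)Px⟩ is at least -c⟨x, Px⟩ (`form_idQuot_ge`,
`le_form_chi`); in form language, Dχ(S) + χ(S)D ≥ -2c√(1 + D²). Inserting this in D(s² + D²)⁻¹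
leaves the error c√(1 + D²)/(s² + D²), whose integral over s ≥ 1 is bounded uniformly on the
spectrum of D (`integral_sqrtQuot_le`, `form_chi_mul_chi_ge`). The factor P retained above is what
makes this second integral converge.

Self-adjointness and regularity of D come from solving Su + Tu - imu = v for large |m|. One replaces
S by the bounded operator S(1 + itS)⁻¹, solves by contraction (`exists_regularized`), and obtains
bounds uniform in t (`FTuple.apriori`). Mollifying with (1 + iτS)⁻¹ and (1 - iτS)⁻¹ turns the
solutions into elements of 𝓕(S,T) that solve the true equation approximately (`mollify`). The form
estimate bounds Su and Tu separately, so exact solutions follow in the limit (`exists_solution`).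

Throughout, inequalities in B are tested by positive real functionals f that are invariant under the
involution. Then f⟨x, y⟩ is a real, symmetric, positive semidefinite bilinear form, and the
estimates become scalar ones. -/

set_option linter.unusedSectionVars false

namespace HilbertMod

/-! ### Testing inequalities in B by real bilinear forms. -/

section Forms

variable {B E : Type*} [NonUnitalCStarAlgebra B] [PartialOrder B] [StarOrderedRing B]
  [NormedAddCommGroup E] [NormedSpace ℂ E] [SMul B E] [CStarModule B E]

/-- A positive real-linear functional on a C⋆-algebra that depends only on the self-adjoint part
of its argument. -/
structure IsPosFunctional (f : B →L[ℝ] ℝ) : Prop where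
  nonneg : ∀ b, 0 ≤ b → 0 ≤ f b
  map_star : ∀ b, f (star b) = f b

/-- Hahn–Banach separation from the closed positive cone. Symmetrizing the separating functional to
f + f ∘ star doubles its value at the self-adjoint element c, so it still separates. -/
theorem nonneg_of_posFunctional {c : B} (hc : IsSelfAdjoint c)
    (h : ∀ f : B →L[ℝ] ℝ, IsPosFunctional f → 0 ≤ f c) : 0 ≤ c := by
  by_contra hcon
  obtain ⟨f, hf, hfc⟩ := ProperCone.hyperplane_separation_point (ProperCone.positive ℝ B)
    (x₀ := c) (by simpa using hcon)
  let s : B →L[ℝ] B := (starL' ℝ (A := B) : B →L[ℝ] B)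
  let f' : B →L[ℝ] ℝ := (f + f.comp s)
  have hf' : IsPosFunctional f' := by
    refine ⟨fun b hb => ?_, fun b => ?_⟩
    · have h1 : 0 ≤ f b := hf b (by simpa using hb)
      have h2 : star b = b := (IsSelfAdjoint.of_nonneg hb).star_eq
      simp [f', s, h2, h1]
    · simp [f', s, add_comm]
  have := h f' hf'
  simp [f', s, hc.star_eq] at this
  linarith

theorem le_of_posFunctional {a b : B} (hc : IsSelfAdjoint (b - a))
    (h : ∀ f : B →L[ℝ] ℝ, IsPosFunctional f → f a ≤ f b) : a ≤ b := by
  rw [← sub_nonneg]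
  exact nonneg_of_posFunctional hc fun f hf => by simpa using h f hf

/-- The real bilinear form on a Hilbert module induced by a functional on the coefficients. -/
noncomputable def form (f : B →L[ℝ] ℝ) (x y : E) : ℝ := f (inner B x y)

variable (f : B →L[ℝ] ℝ)

@[simp] theorem form_add_left (x y z : E) : form f (x + y) z = form f x z + form f y z := by
  simp [form]

@[simp] theorem form_add_right (x y z : E) : form f x (y + z) = form f x y + form f x z := by
  simp [form]

@[simp] theorem form_sub_left (x y z : E) : form f (x - y) z = form f x z - form f y z := by
  simp [form]

@[simp] theorem form_sub_right (x y z : E) : form f x (y - z) = form f x y - form f x z := by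
  simp [form]

@[simp] theorem form_neg_left (x z : E) : form f (-x) z = -form f x z := by
  simp [form]

@[simp] theorem form_neg_right (x z : E) : form f x (-z) = -form f x z := by
  simp [form]

@[simp] theorem form_zero_right (x : E) : form f x 0 = 0 := by
  simp [form]

@[simp] theorem form_smul_left (r : ℝ) (x z : E) : form f (r • x) z = r * form f x z := by
  simp [form]

@[simp] theorem form_smul_right (r : ℝ) (x z : E) : form f x (r • z) = r * form f x z := by
  simp [form]

@[simp] theorem form_I_left (x z : E) :
    form f (Complex.I • x) z = -form f x (Complex.I • z) := by
  simp only [form, CStarModule.inner_smul_left_complex, CStarModule.inner_smul_right_complex]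
  rw [Complex.star_def, Complex.conj_I, neg_smul, map_neg]

theorem form_I_I (x z : E) : form f (Complex.I • x) (Complex.I • z) = form f x z := by
  simp [smul_smul]

variable {f}

theorem IsPosFunctional.form_comm (hf : IsPosFunctional f) (x y : E) :
    form f x y = form f y x := by
  rw [form, ← hf.map_star, CStarModule.star_inner, form]

theorem IsPosFunctional.form_self_nonneg (hf : IsPosFunctional f) (x : E) :
    0 ≤ form f x x := hf.nonneg _ CStarModule.inner_self_nonneg

/-- If b = ⟨x, y⟩ is self-adjoint, then (ib)* = -ib, so an invariant functional vanishes on ib. With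
y = Dx for a symmetric D, this removes the cross terms in all the estimates with imaginary shifts.
-/
theorem IsPosFunctional.form_I_self (hf : IsPosFunctional f) {x y : E}
    (h : inner B y x = inner B x y) : form f x (Complex.I • y) = 0 := by
  have h1 : form f x (Complex.I • y) = -form f y (Complex.I • x) := by
    rw [hf.form_comm, form_I_left]
  have h2 : form f y (Complex.I • x) = form f x (Complex.I • y) := by
    simp only [form, CStarModule.inner_smul_right_complex, h]
  linarith

theorem IsPosFunctional.two_form_le (hf : IsPosFunctional f) (x y : E) :
    2 * form f x y ≤ form f x x + form f y y := by
  have := hf.form_self_nonneg (x - y)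
  have h := hf.form_comm x y
  simp at this
  linarith

theorem IsPosFunctional.neg_two_form_le (hf : IsPosFunctional f) (x y : E) :
    -(form f x x + form f y y) ≤ 2 * form f x y := by
  have := hf.form_self_nonneg (x + y)
  have h := hf.form_comm x y
  simp at this
  linarith

theorem IsPosFunctional.form_add_self_le (hf : IsPosFunctional f) (x y : E) :
    form f (x + y) (x + y) ≤ 2 * form f x x + 2 * form f y y := by
  have := hf.two_form_le x y
  have h := hf.form_comm x y
  simp
  linarith

variable (f) in
theorem abs_form_le (x y : E) : |form f x y| ≤ ‖f‖ * (‖x‖ * ‖y‖) :=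
  (f.le_opNorm _).trans (by gcongr; exact CStarModule.norm_inner_le E)

variable (f) in
@[fun_prop]
theorem continuous_form {X : Type*} [TopologicalSpace X] {u v : X → E}
    (hu : Continuous u) (hv : Continuous v) : Continuous fun s => form f (u s) (v s) :=
  f.continuous.comp (CStarModule.continuous_inner.comp (hu.prodMk hv))

-- The way back from scalar estimates to norms: the tested inequalities give an inequality between
-- positive elements of B, on which the norm is monotone.
variable (B) in
theorem norm_sq_le_of_form {x y z w : E} {c₁ c₂ c₃ : ℝ} (h₁ : 0 ≤ c₁) (h₂ : 0 ≤ c₂) (h₃ : 0 ≤ c₃)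
    (h : ∀ f : B →L[ℝ] ℝ, IsPosFunctional f →
      form f x x ≤ c₁ * form f y y + c₂ * form f z z + c₃ * form f w w) :
    ‖x‖ ^ 2 ≤ c₁ * ‖y‖ ^ 2 + c₂ * ‖z‖ ^ 2 + c₃ * ‖w‖ ^ 2 := by
  have sa (c : ℝ) (y : E) : IsSelfAdjoint (c • inner B y y) :=
    (IsSelfAdjoint.all c).smul CStarModule.isSelfAdjoint_inner_self
  have key : inner B x x ≤ c₁ • inner B y y + c₂ • inner B z z + c₃ • inner B w w := by
    refine le_of_posFunctional (((sa _ _).add (sa _ _)).add (sa _ _) |>.sub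
      CStarModule.isSelfAdjoint_inner_self) fun f hf => ?_
    simpa [form] using h f hf
  simp only [CStarModule.norm_sq_eq (A := B) (E := E)]
  refine (CStarAlgebra.norm_le_norm_of_nonneg_of_le CStarModule.inner_self_nonneg key).trans ?_
  refine (norm_add₃_le).trans ?_
  simp [norm_smul, abs_of_nonneg, *]

variable (B) in
theorem norm_le_of_form {x y : E} {c : ℝ} (hc : 0 ≤ c)
    (h : ∀ f : B →L[ℝ] ℝ, IsPosFunctional f → form f x x ≤ c ^ 2 * form f y y) :
    ‖x‖ ≤ c * ‖y‖ := by
  have := norm_sq_le_of_form B (x := x) (y := y) (z := (0 : E)) (w := (0 : E)) (sq_nonneg c)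
    le_rfl le_rfl (fun f hf => by simpa using h f hf)
  refine le_of_sq_le_sq ?_ (by positivity)
  simpa [mul_pow] using this

variable (B) in
theorem ext_inner_left {y z : E} (h : ∀ x : E, inner B x y = inner B x z) : y = z := by
  rw [← sub_eq_zero, ← CStarModule.inner_self (A := B)]
  simp [h]

end Forms

/-! ### The adjointable operators as a C⋆-algebra. -/

section CStar

variable {B E : Type*} [NonUnitalCStarAlgebra B] [PartialOrder B] [StarOrderedRing B]
  [NormedAddCommGroup E] [NormedSpace ℂ E] [SMul B E] [CStarModule B E]

theorem Adj.ext {S T : Adj B E} (h : ∀ x : E, S.1 x = T.1 x) : S = T :=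
  Subtype.ext (ContinuousLinearMap.ext h)

theorem star_eq_of_inner {S T : Adj B E}
    (h : ∀ x y : E, inner B (S.1 x) y = inner B x (T.1 y)) : star S = T :=
  Adj.ext fun y => ext_inner_left B fun x => by rw [← inner_star_right, h]

theorem inner_star_left (T : Adj B E) (x y : E) :
    inner B ((star T).1 x) y = inner B x (T.1 y) := by
  rw [← CStarModule.star_inner, ← inner_star_right, CStarModule.star_inner]

@[simp] theorem Adj.mul_apply (S T : Adj B E) (x : E) : (S * T).1 x = S.1 (T.1 x) := rfl
@[simp] theorem Adj.add_apply (S T : Adj B E) (x : E) : (S + T).1 x = S.1 x + T.1 x := rfl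
@[simp] theorem Adj.sub_apply (S T : Adj B E) (x : E) : (S - T).1 x = S.1 x - T.1 x := rfl
@[simp] theorem Adj.one_apply (x : E) : (1 : Adj B E).1 x = x := rfl
@[simp] theorem Adj.smul_apply (c : ℂ) (S : Adj B E) (x : E) : (c • S).1 x = c • S.1 x := rfl

@[simp] theorem Adj.real_smul_apply (c : ℝ) (S : Adj B E) (x : E) : (c • S).1 x = c • S.1 x := rfl

theorem Adj.norm_def (S : Adj B E) : ‖S‖ = ‖S.1‖ := rfl

noncomputable instance : StarRing (Adj B E) where
  star_involutive T := star_eq_of_inner fun x y => inner_star_left T x y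
  star_mul S T := star_eq_of_inner fun x y => by simp [inner_star_right]
  star_add S T := star_eq_of_inner fun x y => by simp [inner_star_right]

instance : StarModule ℂ (Adj B E) where
  star_smul c T := star_eq_of_inner fun x y => by simp [inner_star_right]

instance : CStarRing (Adj B E) where
  norm_mul_self_le T := by
    simp only [Adj.norm_def]
    have h : ‖T.1‖ ≤ Real.sqrt ‖(star T * T).1‖ := by
      refine T.1.opNorm_le_bound (Real.sqrt_nonneg _) fun x => ?_
      rw [← Real.sqrt_sq (norm_nonneg x), ← Real.sqrt_mul (norm_nonneg _)]
      refine Real.le_sqrt_of_sq_le ?_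
      rw [CStarModule.norm_sq_eq B, inner_star_right, ← Adj.mul_apply]
      refine (CStarModule.norm_inner_le E).trans ?_
      calc ‖x‖ * ‖(star T * T).1 x‖ ≤ ‖x‖ * (‖(star T * T).1‖ * ‖x‖) := by
            gcongr; exact (star T * T).1.le_opNorm x
        _ = _ := by ring
    calc ‖T.1‖ * ‖T.1‖ ≤ Real.sqrt ‖(star T * T).1‖ * Real.sqrt ‖(star T * T).1‖ := by gcongr
      _ = _ := Real.mul_self_sqrt (norm_nonneg _)

theorem Adj.norm_star_coe (T : Adj B E) : ‖(star T).1‖ = ‖T.1‖ := by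
  have h : NormedStarGroup (Adj B E) := CStarRing.to_normedStarGroup
  exact le_antisymm (h.norm_star_le T) (by have := h.norm_star_le (star T); rwa [star_star] at this)

/-- The involution is isometric, so the adjoints of a Cauchy sequence converge too, and their limit
is an adjoint of the limit. -/
instance [CompleteSpace E] : CompleteSpace (Adj B E) := by
  refine Metric.complete_of_cauchySeq_tendsto fun u hu => ?_
  have hu1 : CauchySeq fun n => (u n).1 := by
    rw [Metric.cauchySeq_iff] at hu ⊢; exact hu
  have hu2 : CauchySeq fun n => (star (u n)).1 := by
    rw [Metric.cauchySeq_iff] at hu1 ⊢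
    intro ε hε
    obtain ⟨N, hN⟩ := hu1 ε hε
    refine ⟨N, fun m hm n hn => ?_⟩
    have := hN m hm n hn
    rw [dist_eq_norm] at this ⊢
    rw [show (star (u m)).1 - (star (u n)).1 = (star (u m - u n)).1 by rw [star_sub]; rfl,
      Adj.norm_star_coe]
    exact this
  obtain ⟨a, ha⟩ := cauchySeq_tendsto_of_complete hu1
  obtain ⟨b, hb⟩ := cauchySeq_tendsto_of_complete hu2
  have hab : ∀ x y : E, inner B (a x) y = inner B x (b y) := fun x y => by
    have h1 : Filter.Tendsto (fun n => inner B ((u n).1 x) y) Filter.atTop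
        (nhds (inner B (a x) y)) :=
      (CStarModule.continuous_inner.tendsto (a x, y)).comp
        (((ContinuousLinearMap.apply ℂ E x).continuous.tendsto a |>.comp ha).prodMk_nhds
          tendsto_const_nhds)
    have h2 : Filter.Tendsto (fun n => inner B x ((star (u n)).1 y)) Filter.atTop
        (nhds (inner B x (b y))) :=
      (CStarModule.continuous_inner.tendsto (x, b y)).comp
        (tendsto_const_nhds.prodMk_nhds
          ((ContinuousLinearMap.apply ℂ E y).continuous.tendsto b |>.comp hb))
    refine tendsto_nhds_unique h1 ?_
    simpa only [inner_star_right] using h2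
  refine ⟨⟨a, b, hab⟩, ?_⟩
  rw [tendsto_subtype_rng]
  exact ha

noncomputable instance [CompleteSpace E] : CStarAlgebra (Adj B E) where

theorem form_star_right (f : B →L[ℝ] ℝ) (T : Adj B E) (x y : E) :
    form f x ((star T).1 y) = form f (T.1 x) y := by
  simp [form, inner_star_right]

/-- The bilinear form of an operator, as a continuous functional of the operator. -/
noncomputable def formCLM (f : B →L[ℝ] ℝ) (x y : E) : Adj B E →L[ℝ] ℝ :=
  LinearMap.mkContinuous
    { toFun := fun T => form f x (T.1 y)
      map_add' := fun S T => by simp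
      map_smul' := fun c T => by
        rw [show (c • T).1 y = c • T.1 y from rfl]; simp }
    (‖f‖ * (‖x‖ * ‖y‖)) fun T => by
      refine (abs_form_le f _ _).trans ?_
      calc ‖f‖ * (‖x‖ * ‖T.1 y‖) ≤ ‖f‖ * (‖x‖ * (‖T.1‖ * ‖y‖)) := by
            gcongr; exact T.1.le_opNorm y
        _ = ‖f‖ * (‖x‖ * ‖y‖) * ‖T.1‖ := by ring

end CStar

end HilbertMod

namespace HilbertMod

/-! ### Graphs and resolvents of self-adjoint regular operators. -/

section Resolvents

variable {B E : Type*} [NonUnitalCStarAlgebra B] [PartialOrder B] [StarOrderedRing B]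
  [NormedAddCommGroup E] [NormedSpace ℂ E] [SMul B E] [CStarModule B E]

theorem complex_smul_eq (z : ℂ) (x : E) : z • x = z.re • x + z.im • (Complex.I • x) := by
  conv_lhs => rw [← Complex.re_add_im z]
  rw [add_smul, mul_smul]
  simp only [Complex.coe_smul]

theorem mem_graph_of_domain {D : E →ₗ.[ℂ] E} {x : E} (hx : x ∈ D.domain) :
    (x, D ⟨x, hx⟩) ∈ D.graph := D.mem_graph ⟨x, hx⟩

theorem exists_domain_of_graph {D : E →ₗ.[ℂ] E} {x y : E} (h : (x, y) ∈ D.graph) :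
    ∃ hx : x ∈ D.domain, D ⟨x, hx⟩ = y := by
  obtain ⟨u, rfl, hu⟩ := D.mem_graph_iff.1 h
  exact ⟨u.2, hu⟩

theorem graph_add {D : E →ₗ.[ℂ] E} {x y x' y' : E} (h : (x, y) ∈ D.graph)
    (h' : (x', y') ∈ D.graph) : (x + x', y + y') ∈ D.graph := D.graph.add_mem h h'

theorem graph_sub {D : E →ₗ.[ℂ] E} {x y x' y' : E} (h : (x, y) ∈ D.graph)
    (h' : (x', y') ∈ D.graph) : (x - x', y - y') ∈ D.graph := D.graph.sub_mem h h'

theorem graph_smul {D : E →ₗ.[ℂ] E} {x y : E} (c : ℂ) (h : (x, y) ∈ D.graph) :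
    (c • x, c • y) ∈ D.graph := D.graph.smul_mem c h

theorem graph_unique {D : E →ₗ.[ℂ] E} {x y y' : E} (h : (x, y) ∈ D.graph)
    (h' : (x, y') ∈ D.graph) : y = y' := D.mem_graph_snd_inj h h' rfl

variable {D : E →ₗ.[ℂ] E}

theorem IsSelfAdjointRegular.inner_graph (hD : IsSelfAdjointRegular B D) {x y x' y' : E}
    (h : (x, y) ∈ D.graph) (h' : (x', y') ∈ D.graph) : inner B y x' = inner B x y' := by
  obtain ⟨hx, rfl⟩ := exists_domain_of_graph h
  obtain ⟨hx', rfl⟩ := exists_domain_of_graph h'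
  exact hD.symmetric ⟨x, hx⟩ ⟨x', hx'⟩

theorem IsSelfAdjointRegular.form_graph (hD : IsSelfAdjointRegular B D) (f : B →L[ℝ] ℝ)
    {x y x' y' : E} (h : (x, y) ∈ D.graph) (h' : (x', y') ∈ D.graph) :
    form f y x' = form f x y' := by rw [form, hD.inner_graph h h', form]

theorem IsSelfAdjointRegular.form_I_graph (hD : IsSelfAdjointRegular B D) {f : B →L[ℝ] ℝ}
    (hf : IsPosFunctional f) {x y : E} (h : (x, y) ∈ D.graph) :
    form f x (Complex.I • y) = 0 := hf.form_I_self (hD.inner_graph h h)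

theorem IsSelfAdjointRegular.mem_graph_of_inner (hD : IsSelfAdjointRegular B D) {u w : E}
    (h : ∀ x y, (x, y) ∈ D.graph → inner B y u = inner B x w) : (u, w) ∈ D.graph := by
  obtain ⟨hu, rfl⟩ := hD.adjoint_le u w fun x => h _ _ (D.mem_graph x)
  exact mem_graph_of_domain hu

theorem IsSelfAdjointRegular.isClosed_graph (hD : IsSelfAdjointRegular B D) :
    IsClosed (D.graph : Set (E × E)) := by
  have : (D.graph : Set (E × E)) = ⋂ p : D.graph, {q | inner B p.1.2 q.1 = inner B p.1.1 q.2} := by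
    ext ⟨u, w⟩
    simp only [Set.mem_iInter, Set.mem_ofPred_eq, SetLike.mem_coe]
    exact ⟨fun h p => hD.inner_graph p.2 h,
      fun h => hD.mem_graph_of_inner fun x y hxy => h ⟨(x, y), hxy⟩⟩
  rw [this]
  refine isClosed_iInter fun p => isClosed_eq ?_ ?_
  · exact CStarModule.continuous_inner.comp (continuous_const.prodMk continuous_fst)
  · exact CStarModule.continuous_inner.comp (continuous_const.prodMk continuous_snd)

/-- The cross term vanishes, so the form of (D + z)x at itself is that of (D + Re z)x plus (Im z)²
times that of x. -/
theorem IsSelfAdjointRegular.norm_le (hD : IsSelfAdjointRegular B D) (z : ℂ) {x y : E}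
    (h : (x, y) ∈ D.graph) : |z.im| * ‖x‖ ≤ ‖y + z • x‖ := by
  have key : ‖z.im • x‖ ≤ 1 * ‖y + z • x‖ := by
    refine norm_le_of_form B zero_le_one fun f hf => ?_
    have h1 : form f (y + z.re • x) (Complex.I • x) = 0 := by
      refine hf.form_I_self ?_
      simp [hD.inner_graph h h]
    have h2 := hf.form_comm (Complex.I • x) (y + z.re • x)
    have h3 := hf.form_self_nonneg (y + z.re • x)
    have h4 := form_I_I f x x
    rw [complex_smul_eq, ← add_assoc]
    generalize y + z.re • x = p at *
    rw [form_add_left, form_add_right, form_add_right, form_smul_left, form_smul_right,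
      form_smul_right, form_smul_left, form_smul_left, form_smul_right, h2, h1, h4]
    linarith
  simpa [norm_smul] using key

/-- Lipschitz perturbations of a surjective linear relation that is bounded below. -/
theorem exists_of_lipschitz_perturbation [CompleteSpace E] (G : Submodule ℂ (E × E)) (z : ℂ)
    {c k : ℝ} (hk : 0 ≤ k) (hkc : k < c) (hb : ∀ x y, (x, y) ∈ G → c * ‖x‖ ≤ ‖y + z • x‖)
    (hs : ∀ v, ∃ x y, (x, y) ∈ G ∧ y + z • x = v) (A : E → E)
    (hA : ∀ x x', ‖A x - A x'‖ ≤ k * ‖x - x'‖) (v : E) :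
    ∃ x y, (x, y) ∈ G ∧ y + z • x + A x = v := by
  choose ρ η hG hρ using hs
  have hc : 0 < c := hk.trans_lt hkc
  have hlip : ∀ a b, ‖ρ a - ρ b‖ ≤ c⁻¹ * ‖a - b‖ := fun a b => by
    -- The lower bound makes the solution map `ρ` Lipschitz with constant 1/c, so x ↦ ρ(v - Ax)
    -- contracts with factor k/c < 1.
    have := hb _ _ (G.sub_mem (hG a) (hG b))
    rw [smul_sub, sub_add_sub_comm, hρ, hρ] at this
    rwa [inv_mul_eq_div, le_div_iff₀' hc]
  let F : E → E := fun x => ρ (v - A x)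
  have hF : ContractingWith (c⁻¹ * k).toNNReal F := by
    refine ⟨?_, LipschitzWith.of_dist_le_mul fun a b => ?_⟩
    · rw [← NNReal.coe_lt_coe, Real.coe_toNNReal _ (by positivity), NNReal.coe_one,
        inv_mul_eq_div, div_lt_one hc]
      exact hkc
    · rw [Real.coe_toNNReal _ (by positivity), dist_eq_norm, dist_eq_norm]
      refine (hlip _ _).trans ?_
      rw [sub_sub_sub_cancel_left, mul_assoc, norm_sub_rev (A b)]
      gcongr
      exact hA a b
  have hfix : ρ (v - A (ContractingWith.fixedPoint F hF)) = ContractingWith.fixedPoint F hF :=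
    hF.fixedPoint_isFixedPt
  set x := ContractingWith.fixedPoint F hF
  refine ⟨x, η (v - A x), ?_, ?_⟩
  · simpa [hfix] using hG (v - A x)
  · have := hρ (v - A x)
    rw [hfix] at this
    rw [this, sub_add_cancel]

/-- D + z is bounded below and has closed graph, so its range is closed. -/
theorem IsSelfAdjointRegular.exists_of_dense [CompleteSpace E] (hD : IsSelfAdjointRegular B D)
    {z : ℂ} (hz : z.im ≠ 0) (hd : Dense (Set.range fun x : D.domain => D x + z • (x : E))) (v : E) :
    ∃ x y, (x, y) ∈ D.graph ∧ y + z • x = v := by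
  obtain ⟨s, hs, hlim⟩ := mem_closure_iff_seq_limit.1 (hd v)
  choose x hx using hs
  simp only at hx
  have hpos : 0 < |z.im| := abs_pos.2 hz
  have hcx : CauchySeq fun n => (x n : E) := by
    have h1 := hlim.cauchySeq
    rw [Metric.cauchySeq_iff] at h1 ⊢
    intro ε hε
    obtain ⟨N, hN⟩ := h1 (|z.im| * ε) (by positivity)
    refine ⟨N, fun m hm n hn => ?_⟩
    have h2 := hN m hm n hn
    rw [dist_eq_norm] at h2 ⊢
    have h3 := hD.norm_le z (graph_sub (D.mem_graph (x m)) (D.mem_graph (x n)))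
    rw [smul_sub, sub_add_sub_comm, hx, hx] at h3
    exact lt_of_mul_lt_mul_left (h3.trans_lt h2) hpos.le
  obtain ⟨u, hu⟩ := cauchySeq_tendsto_of_complete hcx
  have hy : Filter.Tendsto (fun n => D (x n)) Filter.atTop (nhds (v - z • u)) := by
    have := hlim.sub (hu.const_smul z)
    refine this.congr fun n => ?_
    rw [← hx, add_sub_cancel_right]
  refine ⟨u, v - z • u, ?_, sub_add_cancel _ _⟩
  exact hD.isClosed_graph.mem_of_tendsto (hu.prodMk_nhds hy)
    (Filter.Eventually.of_forall fun n => D.mem_graph (x n))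

theorem IsSelfAdjointRegular.surjective_of_norm_lt [CompleteSpace E]
    (hD : IsSelfAdjointRegular B D) {z w : ℂ}
    (hs : ∀ v : E, ∃ x y, (x, y) ∈ D.graph ∧ y + z • x = v) (hw : ‖w - z‖ < |z.im|) (v : E) :
    ∃ x y, (x, y) ∈ D.graph ∧ y + w • x = v := by
  obtain ⟨x, y, h, hv⟩ := exists_of_lipschitz_perturbation D.graph z (norm_nonneg _) hw
    (fun x y h => hD.norm_le z h) hs (fun x => (w - z) • x)
    (fun x x' => by rw [← smul_sub, norm_smul]) v
  refine ⟨x, y, h, ?_⟩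
  rw [← hv]
  module

theorem IsSelfAdjointRegular.surjective_of_pos_mul [CompleteSpace E]
    (hD : IsSelfAdjointRegular B D) {z w : ℂ} (hzw : 0 < z.im * w.im)
    (hs : ∀ v : E, ∃ x y, (x, y) ∈ D.graph ∧ y + z • x = v) (v : E) :
    ∃ x y, (x, y) ∈ D.graph ∧ y + w • x = v := by
  have hz : z.im ≠ 0 := by rintro h; simp [h] at hzw
  -- Surjectivity spreads from z to the disc of radius |Im z|. Moving up by half the imaginary part
  -- stays inside that disc, and the discs about these points exhaust the half-plane of z.
  have up (n : ℕ) : ∀ v : E, ∃ x y, (x, y) ∈ D.graph ∧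
      y + (⟨z.re, (3 / 2) ^ n * z.im⟩ : ℂ) • x = v := by
    induction n with
    | zero => simpa using hs
    | succ n ih =>
      refine hD.surjective_of_norm_lt ih ?_
      have : ((⟨z.re, (3 / 2) ^ (n + 1) * z.im⟩ : ℂ) - ⟨z.re, (3 / 2) ^ n * z.im⟩) =
          (((3 / 2) ^ n * z.im / 2 : ℝ) : ℂ) * Complex.I := by
        apply Complex.ext
        · simp only [Complex.sub_re, Complex.mul_re, Complex.ofReal_re, Complex.ofReal_im,
            Complex.I_re, Complex.I_im]; ring
        · simp only [Complex.sub_im, Complex.mul_im, Complex.ofReal_re, Complex.ofReal_im,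
            Complex.I_re, Complex.I_im]; ring
      rw [this, norm_mul, Complex.norm_I, mul_one, Complex.norm_real, Real.norm_eq_abs, abs_div]
      have h0 : 0 < |(3 / 2 : ℝ) ^ n * z.im| := by positivity
      simp only [Nat.abs_ofNat]
      linarith
  obtain ⟨n, hn⟩ := pow_unbounded_of_one_lt
    (((w.re - z.re) ^ 2 + w.im ^ 2) / (2 * (z.im * w.im))) (by norm_num : (1 : ℝ) < 3 / 2)
  refine hD.surjective_of_norm_lt (up n) ?_ v
  rw [div_lt_iff₀ (by positivity)] at hn
  rw [← sq_lt_sq₀ (norm_nonneg _) (abs_nonneg _), sq_abs, ← Complex.normSq_eq_norm_sq,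
    Complex.normSq_apply]
  simp only [Complex.sub_re, Complex.sub_im]
  nlinarith

theorem IsSelfAdjointRegular.surjective [CompleteSpace E]
    (hD : IsSelfAdjointRegular B D) {w : ℂ} (hw : w.im ≠ 0) (v : E) :
    ∃ x y, (x, y) ∈ D.graph ∧ y + w • x = v := by
  obtain ⟨z, hz, h1, h2⟩ := hD.regular
  have h2' : Dense (Set.range fun x : D.domain => D x + (-z) • (x : E)) := by
    simpa [sub_eq_add_neg] using h2
  rcases lt_or_gt_of_ne (mul_ne_zero hz hw) with h | h
  · exact hD.surjective_of_pos_mul (z := -z) (by simpa using h)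
      (hD.exists_of_dense (by simpa using hz) h2') v
  · exact hD.surjective_of_pos_mul h (hD.exists_of_dense hz h1) v

theorem isResolvent_iff {z : ℂ} {R : Adj B E} : IsResolvent D z R ↔
    (∀ y : E, (R.1 y, y - z • R.1 y) ∈ D.graph) ∧
      ∀ x y, (x, y) ∈ D.graph → R.1 (y + z • x) = x := by
  refine and_congr (forall_congr' fun y => ⟨?_, ?_⟩) ⟨?_, ?_⟩
  · rintro ⟨h, h'⟩
    convert mem_graph_of_domain h using 2
    exact sub_eq_of_eq_add h'.symm
  · intro h
    obtain ⟨h1, h2⟩ := exists_domain_of_graph h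
    exact ⟨h1, by rw [h2, sub_add_cancel]⟩
  · intro h x y hxy
    obtain ⟨hx, rfl⟩ := exists_domain_of_graph hxy
    exact h ⟨x, hx⟩
  · intro h x
    exact h _ _ (D.mem_graph x)

theorem IsResolvent.graph {z : ℂ} {R : Adj B E} (h : IsResolvent D z R) (y : E) :
    (R.1 y, y - z • R.1 y) ∈ D.graph := (isResolvent_iff.1 h).1 y

theorem IsResolvent.apply_graph {z : ℂ} {R : Adj B E} (h : IsResolvent D z R) {x y : E}
    (hxy : (x, y) ∈ D.graph) : R.1 (y + z • x) = x := (isResolvent_iff.1 h).2 _ _ hxy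

theorem IsResolvent.star_eq (hD : IsSelfAdjointRegular B D) {z : ℂ} {R R' : Adj B E}
    (h : IsResolvent D z R) (h' : IsResolvent D (star z) R') : star R = R' := by
  refine star_eq_of_inner fun x y => ?_
  have h1 := h.graph x
  have h2 := h'.graph y
  have h3 := hD.inner_graph h1 h2
  simp only [CStarModule.inner_sub_left, CStarModule.inner_sub_right,
    CStarModule.inner_smul_left_complex, CStarModule.inner_smul_right_complex] at h3
  exact (sub_left_inj.1 h3).symm

/-- The resolvent identity. -/
theorem IsResolvent.sub_eq {z w : ℂ} {R R' : Adj B E}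
    (h : IsResolvent D z R) (h' : IsResolvent D w R') : R' + (w - z) • (R' * R) = R := by
  refine Adj.ext fun y => ?_
  have := h'.apply_graph (h.graph y)
  rw [show y - z • R.1 y + w • R.1 y = y + (w - z) • R.1 y by module, map_add, map_smul] at this
  exact this

theorem IsSelfAdjointRegular.exists_resolvent [CompleteSpace E]
    (hD : IsSelfAdjointRegular B D) {z : ℂ} (hz : z.im ≠ 0) :
    ∃ R : Adj B E, IsResolvent D z R := by
  have main : ∀ z : ℂ, z.im ≠ 0 → ∃ R : E →L[ℂ] E, (∀ y : E, (R y, y - z • R y) ∈ D.graph) ∧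
      ∀ x y, (x, y) ∈ D.graph → R (y + z • x) = x := by
    intro z hz
    have hpos : 0 < |z.im| := abs_pos.2 hz
    choose ρ η hG hρ using fun v => hD.surjective hz v
    have huniq : ∀ x y, (x, y) ∈ D.graph → ρ (y + z • x) = x := fun x y hxy => by
      have := hD.norm_le z (graph_sub (hG (y + z • x)) hxy)
      rw [smul_sub, sub_add_sub_comm, hρ, sub_self, norm_zero] at this
      have h0 : ‖ρ (y + z • x) - x‖ = 0 :=
        le_antisymm (nonpos_of_mul_nonpos_right this hpos) (norm_nonneg _)
      exact sub_eq_zero.1 (norm_eq_zero.1 h0)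
    let L : E →ₗ[ℂ] E :=
      { toFun := ρ
        map_add' := fun a b => by
          have := huniq _ _ (graph_add (hG a) (hG b))
          rwa [smul_add, add_add_add_comm, hρ, hρ] at this
        map_smul' := fun c a => by
          have := huniq _ _ (graph_smul c (hG a))
          rwa [smul_comm z c, ← smul_add, hρ] at this }
    refine ⟨L.mkContinuous |z.im|⁻¹ fun v => ?_, fun y => ?_, huniq⟩
    · have := hD.norm_le z (hG v)
      rw [hρ] at this
      rwa [inv_mul_eq_div, le_div_iff₀' hpos]
    · change (ρ y, y - z • ρ y) ∈ D.graph
      rw [← eq_sub_of_add_eq (hρ y)]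
      exact hG y
  obtain ⟨R, hR, hR'⟩ := main z hz
  -- The adjoint of the resolvent at z is the resolvent at the conjugate point.
  obtain ⟨R₂, hR₂, -⟩ := main (star z) (by simpa using hz)
  refine ⟨⟨R, R₂, fun x y => ?_⟩, isResolvent_iff.2 ⟨hR, hR'⟩⟩
  have h3 := hD.inner_graph (hR x) (hR₂ y)
  simp only [CStarModule.inner_sub_left, CStarModule.inner_sub_right,
    CStarModule.inner_smul_left_complex, CStarModule.inner_smul_right_complex] at h3
  exact (sub_left_inj.1 h3).symm

end Resolvents

end HilbertMod

namespace HilbertMod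

/-! ### Construction of the bounded continuous functional calculus from the normal operator (D +
i)⁻¹. -/

section Calculus

variable {B E : Type*} [NonUnitalCStarAlgebra B] [PartialOrder B] [StarOrderedRing B]
  [NormedAddCommGroup E] [NormedSpace ℂ E] [CompleteSpace E] [SMul B E] [CStarModule B E]
  {D : E →ₗ.[ℂ] E}

/-- In the coordinate `w = (t + i)⁻¹`, the function `t ↦ f t * (t + i)⁻¹`. -/
noncomputable def resolventCoord (f : ℝ → ℂ) (w : ℂ) : ℂ := f (w⁻¹).re * w

theorem continuous_resolventCoord {f : ℝ → ℂ} (hf : Continuous f) {C : ℝ} (hC : ∀ t, ‖f t‖ ≤ C) :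
    Continuous (resolventCoord f) := by
  rw [continuous_iff_continuousAt]
  intro w
  by_cases hw : w = 0
  · subst hw
    have h0 : resolventCoord f 0 = 0 := by simp [resolventCoord]
    rw [ContinuousAt, h0]
    refine squeeze_zero_norm (a := fun w => C * ‖w‖) (fun w => ?_) ?_
    · rw [resolventCoord, norm_mul]
      gcongr
      exact hC _
    · have : Continuous fun w : ℂ => C * ‖w‖ := by fun_prop
      simpa using this.tendsto 0
  · unfold resolventCoord
    refine ContinuousAt.mul ?_ continuousAt_id
    exact hf.continuousAt.comp (Complex.continuous_re.continuousAt.comp (continuousAt_inv₀ hw))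

@[fun_prop]
theorem continuous_resolventCoord_bcf (f : ℝ →ᵇ ℂ) : Continuous (resolventCoord f) :=
  continuous_resolventCoord f.continuous f.norm_coe_le_norm

/-- The operator `f(D)(D + i)⁻¹` as a function of the resolvent `R = (D + i)⁻¹`. -/
noncomputable def calcMulResolvent (R : Adj B E) (f : ℝ →ᵇ ℂ) : Adj B E :=
  cfc (resolventCoord f) R

theorem IsResolvent.star_I (hD : IsSelfAdjointRegular B D) {R : Adj B E}
    (h : IsResolvent D Complex.I R) : IsResolvent D (-Complex.I) (star R) := by
  obtain ⟨R', hR'⟩ := hD.exists_resolvent (z := -Complex.I) (by simp)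
  rwa [h.star_eq hD (R' := R') (by simpa using hR')]

theorem IsResolvent.sub_star (hD : IsSelfAdjointRegular B D) {R : Adj B E}
    (h : IsResolvent D Complex.I R) :
    R - star R + (2 * Complex.I) • (star R * R) = 0 := by
  have := h.sub_eq (h.star_I hD)
  rw [← sub_eq_zero] at this
  rw [← neg_eq_zero, ← this]
  module

theorem IsResolvent.isStarNormal (hD : IsSelfAdjointRegular B D) {R : Adj B E}
    (h : IsResolvent D Complex.I R) : IsStarNormal R := by
  refine ⟨?_⟩
  have h1 := h.sub_star hD
  have h2 := (h.star_I hD).sub_eq h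
  have h3 : (2 * Complex.I) • (star R * R) = (2 * Complex.I) • (R * star R) := by
    have h2' : R - star R + (2 * Complex.I) • (R * star R) = 0 := by
      have := sub_eq_zero.2 h2
      rw [← this]
      module
    rw [← h2'] at h1
    exact add_left_cancel h1
  exact smul_right_injective _ (by simp : (2 * Complex.I) ≠ 0) h3

/-- The relation R - R* + 2iR*R = 0 passes to the spectrum and places it on the circle through 0
that inversion maps to the line Im = 1. Hence w⁻¹ = t + i with t real at every nonzero spectral
point. -/
theorem IsResolvent.spectrum_coord (hD : IsSelfAdjointRegular B D) {R : Adj B E}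
    (h : IsResolvent D Complex.I R) {w : ℂ} (hw : w ∈ spectrum ℂ R) :
    w = 0 ∨ ((w⁻¹).re : ℂ) + Complex.I = w⁻¹ := by
  have := h.isStarNormal hD
  have key : cfc (fun w : ℂ => w - star w + (2 * Complex.I) * (star w * w)) R = cfc (0 : ℂ → ℂ) R := by
    rw [cfc_add (fun w : ℂ => w - star w) (fun w : ℂ => (2 * Complex.I) * (star w * w)) (a := R),
      cfc_sub (fun w : ℂ => w) (fun w : ℂ => star w) (a := R),
      cfc_const_mul (2 * Complex.I) (fun w : ℂ => star w * w) R,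
      cfc_mul (fun w : ℂ => star w) (fun w : ℂ => w) R, cfc_star_id (a := R), cfc_id' ℂ R,
      h.sub_star hD, cfc_zero]
  rw [cfc_eq_cfc_iff_eqOn] at key
  have hw2 := key hw
  simp only [Pi.zero_apply] at hw2
  by_cases h0 : w = 0
  · exact Or.inl h0
  · right
    have h0' : star w ≠ 0 := by simpa using h0
    have h3 : w⁻¹ - (star w)⁻¹ = 2 * Complex.I := by
      field_simp
      linear_combination -hw2
    apply Complex.ext
    · simp
    · have := congrArg Complex.im h3
      rw [← star_inv₀] at this
      simp only [Complex.sub_im, Complex.star_def, Complex.conj_im, Complex.mul_im,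
        Complex.I_im, Complex.I_re, Complex.re_ofNat, Complex.im_ofNat] at this
      simp only [Complex.add_im, Complex.ofReal_im, Complex.I_im]
      linarith

theorem calcMulResolvent_add (R : Adj B E) (f g : ℝ →ᵇ ℂ) :
    calcMulResolvent R (f + g) = calcMulResolvent R f + calcMulResolvent R g := by
  rw [calcMulResolvent, calcMulResolvent, calcMulResolvent, ← cfc_add ..]
  congr 1
  ext w
  simp [resolventCoord, add_mul]

theorem calcMulResolvent_smul (R : Adj B E) (c : ℂ) (f : ℝ →ᵇ ℂ) :
    calcMulResolvent R (c • f) = c • calcMulResolvent R f := by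
  rw [calcMulResolvent, calcMulResolvent, ← cfc_smul ..]
  congr 1
  ext w
  simp [resolventCoord, mul_assoc]

theorem calcMulResolvent_one {R : Adj B E} (hR : IsStarNormal R) : calcMulResolvent R 1 = R := by
  rw [calcMulResolvent]
  conv_rhs => rw [← cfc_id' ℂ R]
  congr 1
  ext w
  simp [resolventCoord]

/-- A bounded f need not have limits at ±∞, so in the coordinate w only f·w is continuous at 0.
Multiplicativity therefore has to be stated with one factor of the resolvent attached to each
function. -/
theorem calcMulResolvent_mul_mul (R : Adj B E) (f g f' g' : ℝ →ᵇ ℂ) (h : f * g = f' * g') :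
    calcMulResolvent R f * calcMulResolvent R g =
      calcMulResolvent R f' * calcMulResolvent R g' := by
  simp only [calcMulResolvent]
  rw [← cfc_mul .., ← cfc_mul ..]
  congr 1
  ext w
  have := DFunLike.congr_fun h (w⁻¹).re
  simp only [BoundedContinuousFunction.mul_apply] at this
  simp only [resolventCoord]
  linear_combination w * w * this

theorem star_calcMulResolvent_mul (R : Adj B E) (f g f' g' : ℝ →ᵇ ℂ)
    (h : star f * g = star f' * g') :
    star (calcMulResolvent R f) * calcMulResolvent R g =
      star (calcMulResolvent R f') * calcMulResolvent R g' := by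
  simp only [calcMulResolvent]
  rw [← cfc_star, ← cfc_star, ← cfc_mul .., ← cfc_mul ..]
  congr 1
  ext w
  have := DFunLike.congr_fun h (w⁻¹).re
  simp only [BoundedContinuousFunction.mul_apply, BoundedContinuousFunction.star_apply] at this
  simp only [resolventCoord, star_mul']
  linear_combination star w * w * this

theorem norm_calcMulResolvent_le {R : Adj B E} (hR : IsStarNormal R) (f : ℝ →ᵇ ℂ) (y : E) :
    ‖(calcMulResolvent R f).1 y‖ ≤ ‖f‖ * ‖R.1 y‖ := by
  -- The complementary function with |f|² + |f'|² = ‖f‖². Positivity of its square gives the sharp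
  -- bound relative to the resolvent.
  let f' : ℝ →ᵇ ℂ := BoundedContinuousFunction.ofNormedAddCommGroup
    (fun t => ((Real.sqrt (‖f‖ ^ 2 - ‖f t‖ ^ 2) : ℝ) : ℂ))
    (by fun_prop) ‖f‖ fun t => by
      rw [Complex.norm_real, Real.norm_eq_abs, abs_of_nonneg (Real.sqrt_nonneg _)]
      refine Real.sqrt_le_iff.2 ⟨norm_nonneg _, ?_⟩
      nlinarith [sq_nonneg ‖f t‖]
  have hf' : star f' * f' + star f * f = ((‖f‖ ^ 2 : ℝ) : ℂ) • (1 : ℝ →ᵇ ℂ) := by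
    ext t
    have h1 : (0 : ℝ) ≤ ‖f‖ ^ 2 - ‖f t‖ ^ 2 := by
      have := f.norm_coe_le_norm t
      have h0 := norm_nonneg (f t)
      nlinarith
    have h2 : star (f t) * f t = ((‖f t‖ ^ 2 : ℝ) : ℂ) := by
      rw [Complex.star_def, mul_comm, Complex.mul_conj, Complex.normSq_eq_norm_sq]
    simp only [BoundedContinuousFunction.add_apply, BoundedContinuousFunction.mul_apply,
      BoundedContinuousFunction.star_apply, h2, BoundedContinuousFunction.smul_apply,
      BoundedContinuousFunction.coe_one, Pi.one_apply, f',
      BoundedContinuousFunction.coe_ofNormedAddCommGroup]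
    rw [Complex.star_def, Complex.conj_ofReal, ← Complex.ofReal_mul, Real.mul_self_sqrt h1,
      ← Complex.ofReal_add, smul_eq_mul, mul_one]
    congr 1
    ring
  have key : star (calcMulResolvent R f') * calcMulResolvent R f' +
      star (calcMulResolvent R f) * calcMulResolvent R f =
      ((‖f‖ ^ 2 : ℝ) : ℂ) • (star R * R) := by
    have h1 : star (calcMulResolvent R f') * calcMulResolvent R f' =
        star (calcMulResolvent R 1) * calcMulResolvent R (star f' * f') :=
      star_calcMulResolvent_mul R _ _ _ _ (by simp)
    have h2 : star (calcMulResolvent R f) * calcMulResolvent R f =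
        star (calcMulResolvent R 1) * calcMulResolvent R (star f * f) :=
      star_calcMulResolvent_mul R _ _ _ _ (by simp)
    rw [h1, h2, ← mul_add, ← calcMulResolvent_add, hf', calcMulResolvent_smul,
      calcMulResolvent_one hR, mul_smul_comm]
  refine norm_le_of_form B (norm_nonneg _) fun φ hφ => ?_
  have h3 := congrArg (fun T : Adj B E => form φ y (T.1 y)) key
  simp only [Adj.add_apply, Adj.mul_apply, form_add_right, form_star_right, Complex.coe_smul,
    Adj.real_smul_apply, form_smul_right] at h3
  have h4 := hφ.form_self_nonneg ((calcMulResolvent R f').1 y)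
  linarith

theorem IsResolvent.denseRange (hD : IsSelfAdjointRegular B D) {z : ℂ} {R : Adj B E}
    (h : IsResolvent D z R) : DenseRange R.1 := by
  refine hD.dense_domain.mono fun x hx => ?_
  exact ⟨D ⟨x, hx⟩ + z • x, h.apply_graph (mem_graph_of_domain hx)⟩

theorem Adj.ext_of_mul {R : Adj B E} (hR : DenseRange R.1) {S T : Adj B E} (h : S * R = T * R) :
    S = T := by
  refine Subtype.ext (DFunLike.coe_injective ?_)
  exact hR.equalizer S.1.continuous T.1.continuous
    (funext fun y => congrArg (fun T : Adj B E => T.1 y) h)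

/-- The operator `f(D)`, extended by continuity from the range of `R = (D + i)⁻¹`. -/
noncomputable def calcCLM (R : Adj B E) (f : ℝ →ᵇ ℂ) : E →L[ℂ] E :=
  (calcMulResolvent R f).1.toLinearMap.extendOfNorm R.1.toLinearMap

theorem calcCLM_apply {R : Adj B E} (hR : IsStarNormal R) (hd : DenseRange R.1) (f : ℝ →ᵇ ℂ)
    (y : E) : calcCLM R f (R.1 y) = (calcMulResolvent R f).1 y :=
  LinearMap.extendOfNorm_eq (f := (calcMulResolvent R f).1.toLinearMap) (e := R.1.toLinearMap) hd
    ⟨‖f‖, fun y => norm_calcMulResolvent_le hR f y⟩ y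

theorem inner_calcCLM {R : Adj B E} (hR : IsStarNormal R) (hd : DenseRange R.1) (f : ℝ →ᵇ ℂ)
    (x y : E) : inner B (calcCLM R f x) y = inner B x (calcCLM R (star f) y) := by
  revert y
  refine hd.induction (fun y hy => ?_) (isClosed_eq ?_ ?_)
  · obtain ⟨y, rfl⟩ := hy
    revert x
    refine hd.induction (fun x hx => ?_) (isClosed_eq ?_ ?_)
    · obtain ⟨x, rfl⟩ := hx
      rw [calcCLM_apply hR hd, calcCLM_apply hR hd, ← inner_star_left, ← Adj.mul_apply]
      have h : star R * calcMulResolvent R f =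
          star (calcMulResolvent R (star f)) * R := by
        have := star_calcMulResolvent_mul R 1 f (star f) 1 (by simp)
        rwa [calcMulResolvent_one hR] at this
      rw [h, Adj.mul_apply, inner_star_left]
    · exact CStarModule.continuous_inner.comp
        ((calcCLM R f).continuous.prodMk continuous_const)
    · exact CStarModule.continuous_inner.comp (continuous_id.prodMk continuous_const)
  · exact CStarModule.continuous_inner.comp (continuous_const.prodMk continuous_id)
  · exact CStarModule.continuous_inner.comp
      (continuous_const.prodMk (calcCLM R (star f)).continuous)

/-- The operator `f(D)` as an adjointable operator. -/
noncomputable def calcAdj {R : Adj B E} (hR : IsStarNormal R) (hd : DenseRange R.1)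
    (f : ℝ →ᵇ ℂ) : Adj B E :=
  ⟨calcCLM R f, calcCLM R (star f), inner_calcCLM hR hd f⟩

theorem calcAdj_mul {R : Adj B E} (hR : IsStarNormal R) (hd : DenseRange R.1) (f : ℝ →ᵇ ℂ) :
    calcAdj hR hd f * R = calcMulResolvent R f :=
  Adj.ext fun y => calcCLM_apply hR hd f y

/-- The bounded continuous functional calculus built from the resolvent. -/
noncomputable def calculus {R : Adj B E} (hR : IsStarNormal R) (hd : DenseRange R.1) :
    (ℝ →ᵇ ℂ) →⋆ₐ[ℂ] Adj B E :=
  have hone : calcAdj hR hd 1 = 1 := Adj.ext_of_mul hd <| by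
    rw [calcAdj_mul, calcMulResolvent_one hR, one_mul]
  have hadd (f g) : calcAdj hR hd (f + g) = calcAdj hR hd f + calcAdj hR hd g :=
    Adj.ext_of_mul hd <| by
      rw [add_mul, calcAdj_mul, calcAdj_mul, calcAdj_mul, calcMulResolvent_add]
  have hsmul (c : ℂ) (f) : calcAdj hR hd (c • f) = c • calcAdj hR hd f :=
    Adj.ext_of_mul hd <| by
      rw [smul_mul_assoc, calcAdj_mul, calcAdj_mul, calcMulResolvent_smul]
  have hmul (f g) : calcAdj hR hd (f * g) = calcAdj hR hd f * calcAdj hR hd g := by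
    -- Two factors of `R` are cancelled, one for each of f and g.
    refine Adj.ext_of_mul hd (Adj.ext_of_mul hd ?_)
    have h1 : calcMulResolvent R g * R = R * calcMulResolvent R g := by
      have := calcMulResolvent_mul_mul R g 1 1 g (by simp)
      rwa [calcMulResolvent_one hR] at this
    have h2 : calcMulResolvent R (f * g) * R = calcMulResolvent R f * calcMulResolvent R g := by
      have := calcMulResolvent_mul_mul R (f * g) 1 f g (by simp)
      rwa [calcMulResolvent_one hR] at this
    rw [calcAdj_mul, h2, mul_assoc (calcAdj hR hd f), calcAdj_mul, mul_assoc, h1, ← mul_assoc,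
      calcAdj_mul]
  { toFun := calcAdj hR hd
    map_one' := hone
    map_mul' := hmul
    map_zero' := by simpa using hsmul 0 0
    map_add' := hadd
    commutes' := fun c => by
      rw [Algebra.algebraMap_eq_smul_one, Algebra.algebraMap_eq_smul_one, hsmul, hone]
    map_star' := fun f =>
      (star_eq_of_inner fun x y => inner_calcCLM hR hd f x y).symm }

theorem calculus_mul {R : Adj B E} (hR : IsStarNormal R) (hd : DenseRange R.1) (f : ℝ →ᵇ ℂ) :
    calculus hR hd f * R = calcMulResolvent R f := calcAdj_mul hR hd f

theorem IsResolvent.isFunctionalCalculus (hD : IsSelfAdjointRegular B D) {R : Adj B E}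
    (h : IsResolvent D Complex.I R) :
    IsFunctionalCalculus D (calculus (h.isStarNormal hD) (h.denseRange hD)) := by
  intro z hz f hf
  have hn := h.isStarNormal hD
  have hd := h.denseRange hD
  set Φ := calculus hn hd
  obtain ⟨R', hR'⟩ := hD.exists_resolvent hz
  -- `Y` is (D + z)(D + i)⁻¹ and `W` is (D + i)(D + z)⁻¹. It suffices to see Φ(f)Y = R, which is an
  -- identity of functions on the spectrum of `R`.
  let Y : Adj B E := 1 + (z - Complex.I) • R
  let W : Adj B E := 1 + (Complex.I - z) • R'
  have hYW : Y * W = 1 := by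
    have h1 := hR'.sub_eq h
    have h2 : Y * W - 1 = (z - Complex.I) • (R + (Complex.I - z) • (R * R') - R') := by
      simp only [Y, W, mul_add, add_mul, mul_one, one_mul, smul_mul_smul_comm]
      module
    rw [← sub_eq_zero, h2, h1, sub_self, smul_zero]
  have hfY : Φ f * Y = R := by
    refine Adj.ext_of_mul hd ?_
    have h1 : Φ f * Y * R = calcMulResolvent R f * Y := by
      rw [← calculus_mul hn hd, mul_assoc, mul_assoc]
      congr 1
      simp only [Y, mul_add, add_mul, mul_one, one_mul, mul_smul_comm, smul_mul_assoc]
    rw [h1]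
    have h2 : Y = cfc (fun w : ℂ => 1 + (z - Complex.I) * w) R := by
      rw [cfc_add (fun _ : ℂ => (1 : ℂ)) (fun w : ℂ => (z - Complex.I) * w) (a := R),
        cfc_const_mul (z - Complex.I) (fun w : ℂ => w) R, cfc_id' ℂ R, cfc_const_one ℂ R]
    have h3 : R * R = cfc (fun w : ℂ => w * w) R := by
      rw [cfc_mul (fun w : ℂ => w) (fun w : ℂ => w) R, cfc_id' ℂ R]
    rw [h2, h3, calcMulResolvent, ← cfc_mul ..]
    refine cfc_congr fun w hw => ?_
    simp only [resolventCoord, hf]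
    rcases h.spectrum_coord hD hw with h0 | h0
    · simp [h0]
    · by_cases hw0 : w = 0
      · simp [hw0]
      · have hne : (((w⁻¹).re : ℝ) : ℂ) + z ≠ 0 := by
          intro hcon
          have := congrArg Complex.im hcon
          simp at this
          exact hz this
        have h4 : 1 + (z - Complex.I) * w = (((w⁻¹).re : ℝ) + z) * w := by
          have h5 : ((((w⁻¹).re : ℝ) : ℂ) + Complex.I) * w = 1 := by
            rw [h0, inv_mul_cancel₀ hw0]
          linear_combination -h5
        rw [h4, mul_mul_mul_comm, inv_mul_cancel₀ hne, one_mul]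
  have : Φ f = R' := by
    calc Φ f = Φ f * Y * W := by rw [mul_assoc, hYW, mul_one]
      _ = R * W := by rw [hfY]
      _ = R' := by
        have h1 := hR'.sub_eq h
        simp only [W, mul_add, mul_one, mul_smul_comm]
        exact h1
  rwa [this]

theorem IsSelfAdjointRegular.exists_calculus (hD : IsSelfAdjointRegular B D) :
    ∃ Φ : (ℝ →ᵇ ℂ) →⋆ₐ[ℂ] Adj B E, IsFunctionalCalculus D Φ := by
  obtain ⟨R, hR⟩ := hD.exists_resolvent (z := Complex.I) (by simp)
  exact ⟨_, hR.isFunctionalCalculus hD⟩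

end Calculus

end HilbertMod

namespace HilbertMod

/-! ### Rules for computing with the functional calculus. -/

section BoundedFunctions

/-- A bounded continuous function, bundled. -/
noncomputable def bddFun (f : ℝ → ℂ) (hf : Continuous f) {C : ℝ} (h : ∀ t, ‖f t‖ ≤ C) : ℝ →ᵇ ℂ :=
  BoundedContinuousFunction.ofNormedAddCommGroup f hf C h

@[simp] theorem bddFun_apply (f : ℝ → ℂ) (hf : Continuous f) {C : ℝ} (h : ∀ t, ‖f t‖ ≤ C) (t : ℝ) :
    bddFun f hf h t = f t := rfl

theorem ofReal_add_ne_zero {z : ℂ} (hz : z.im ≠ 0) (t : ℝ) : (t : ℂ) + z ≠ 0 := fun h => by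
  have := congrArg Complex.im h
  simp at this
  exact hz this

/-- The function `t ↦ (t + z)⁻¹`. -/
noncomputable def resFun (z : ℂ) (hz : z.im ≠ 0) : ℝ →ᵇ ℂ :=
  bddFun (fun t : ℝ => ((t : ℂ) + z)⁻¹)
    (Continuous.inv₀ (by fun_prop) (ofReal_add_ne_zero hz)) (C := |z.im|⁻¹) fun t => by
      rw [norm_inv]
      refine inv_anti₀ (abs_pos.2 hz) ?_
      simpa using Complex.abs_im_le_norm ((t : ℂ) + z)

@[simp] theorem resFun_apply (z : ℂ) (hz : z.im ≠ 0) (t : ℝ) :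
    resFun z hz t = ((t : ℂ) + z)⁻¹ := rfl

theorem I_im_ne_zero : Complex.I.im ≠ 0 := by simp

end BoundedFunctions

section Calculus

variable {B E : Type*} [NonUnitalCStarAlgebra B] [PartialOrder B] [StarOrderedRing B]
  [NormedAddCommGroup E] [NormedSpace ℂ E] [CompleteSpace E] [SMul B E] [CStarModule B E]
  {D : E →ₗ.[ℂ] E} {Φ : (ℝ →ᵇ ℂ) →⋆ₐ[ℂ] Adj B E}

theorem IsFunctionalCalculus.isResolvent (hΦ : IsFunctionalCalculus D Φ) {z : ℂ} (hz : z.im ≠ 0) :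
    IsResolvent D z (Φ (resFun z hz)) := hΦ z hz _ fun _ => rfl

/-- Since f = (t + i)⁻¹(h + if), the operator f(D) factors through the resolvent and so maps into
the domain. -/
theorem IsFunctionalCalculus.mem_graph (hΦ : IsFunctionalCalculus D Φ) {f h : ℝ →ᵇ ℂ}
    (hfh : ∀ t : ℝ, (t : ℂ) * f t = h t) (x : E) : ((Φ f).1 x, (Φ h).1 x) ∈ D.graph := by
  have hr := hΦ.isResolvent I_im_ne_zero
  have h1 := hr.graph ((Φ (h + Complex.I • f)).1 x)
  have h2 : (Φ (resFun Complex.I I_im_ne_zero)).1 ((Φ (h + Complex.I • f)).1 x) = (Φ f).1 x := by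
    rw [← Adj.mul_apply, ← map_mul]
    congr 3
    ext t
    have h0 := ofReal_add_ne_zero I_im_ne_zero t
    simp only [BoundedContinuousFunction.mul_apply, BoundedContinuousFunction.add_apply,
      BoundedContinuousFunction.smul_apply, resFun_apply, ← hfh, smul_eq_mul]
    rw [← add_mul, inv_mul_cancel_left₀ h0]
  rw [h2, map_add, map_smul, Adj.add_apply, Adj.smul_apply, add_sub_cancel_right] at h1
  exact h1

theorem IsFunctionalCalculus.apply_graph (hΦ : IsFunctionalCalculus D Φ) {f h : ℝ →ᵇ ℂ}
    (hfh : ∀ t : ℝ, (t : ℂ) * f t = h t) {x y : E} (hxy : (x, y) ∈ D.graph) :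
    (Φ h).1 x = (Φ f).1 y := by
  have hr := hΦ.isResolvent I_im_ne_zero
  have h1 := hr.apply_graph hxy
  set u := y + Complex.I • x
  have hy : y = u - Complex.I • (Φ (resFun Complex.I I_im_ne_zero)).1 u := by
    rw [h1]; simp [u]
  rw [← h1, hy, map_sub, map_smul, ← Adj.mul_apply, ← Adj.mul_apply, ← map_mul, ← map_mul,
    ← Adj.smul_apply, ← Adj.sub_apply, ← map_smul, ← map_sub]
  congr 3
  ext t
  have h0 := ofReal_add_ne_zero I_im_ne_zero t
  simp only [BoundedContinuousFunction.mul_apply, BoundedContinuousFunction.sub_apply,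
      BoundedContinuousFunction.smul_apply, resFun_apply, ← hfh, smul_eq_mul]
  field_simp
  ring

variable (Φ)

theorem norm_calc_le {f : ℝ →ᵇ ℂ} {C : ℝ} (hC : ∀ t, ‖f t‖ ≤ C) (x : E) :
    ‖(Φ f).1 x‖ ≤ C * ‖x‖ := by
  have h0 : 0 ≤ C := (norm_nonneg _).trans (hC 0)
  refine ((Φ f).1.le_opNorm x).trans ?_
  gcongr
  exact (NonUnitalStarAlgHom.norm_apply_le Φ f).trans
    ((BoundedContinuousFunction.norm_le h0).2 hC)

theorem calc_mul_apply (f g : ℝ →ᵇ ℂ) (x : E) : (Φ f).1 ((Φ g).1 x) = (Φ (f * g)).1 x := by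
  rw [map_mul, Adj.mul_apply]

theorem form_calc_symm (φ : B →L[ℝ] ℝ) {f : ℝ →ᵇ ℂ} (hf : star f = f) (x y : E) :
    form φ ((Φ f).1 x) y = form φ x ((Φ f).1 y) := by
  conv_rhs => rw [← hf, map_star, form_star_right]

theorem exists_calc_eq_star_mul_self {f : ℝ →ᵇ ℂ} {p : ℝ → ℝ}
    (hp : ∀ t, f t = (p t : ℂ)) (h0 : ∀ t, 0 ≤ p t) : ∃ Q, Φ f = star Q * Q := by
  have hcont : Continuous p := by
    have : p = fun t => (f t).re := funext fun t => by rw [hp, Complex.ofReal_re]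
    rw [this]
    fun_prop
  let q : ℝ →ᵇ ℂ := bddFun (fun t => ((Real.sqrt (p t) : ℝ) : ℂ)) (by fun_prop)
    (C := Real.sqrt ‖f‖) fun t => by
      rw [Complex.norm_real, Real.norm_eq_abs, abs_of_nonneg (Real.sqrt_nonneg _)]
      refine Real.sqrt_le_sqrt ?_
      have := f.norm_coe_le_norm t
      rw [hp, Complex.norm_real, Real.norm_eq_abs] at this
      exact (le_abs_self _).trans this
  have hq : f = star q * q := by
    ext t
    simp only [BoundedContinuousFunction.mul_apply, BoundedContinuousFunction.star_apply, q,
      bddFun_apply, Complex.star_def, Complex.conj_ofReal, ← Complex.ofReal_mul,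
      Real.mul_self_sqrt (h0 t), hp]
  exact ⟨Φ q, by rw [hq, map_mul, map_star]⟩

theorem form_calc_nonneg {φ : B →L[ℝ] ℝ} (hφ : IsPosFunctional φ) {f : ℝ →ᵇ ℂ} {p : ℝ → ℝ}
    (hp : ∀ t, f t = (p t : ℂ)) (h0 : ∀ t, 0 ≤ p t) (x : E) : 0 ≤ form φ x ((Φ f).1 x) := by
  obtain ⟨Q, hQ⟩ := exists_calc_eq_star_mul_self Φ hp h0
  rw [hQ, Adj.mul_apply, form_star_right]
  exact hφ.form_self_nonneg _

variable {Φ}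

/-- Strong convergence: the second bound gives convergence on the dense range of the resolvent, and
the uniform bound extends it to all vectors. -/
theorem IsFunctionalCalculus.tendsto_zero (hD : IsSelfAdjointRegular B D)
    (hΦ : IsFunctionalCalculus D Φ) {ι : Type*} {l : Filter ι} {F : ι → ℝ →ᵇ ℂ} {C : ℝ} {ε : ι → ℝ}
    (hC : ∀ᶠ i in l, ∀ t, ‖F i t‖ ≤ C) (hF : ∀ᶠ i in l, ∀ t : ℝ, ‖F i t‖ ≤ ε i * ‖(t : ℂ) + Complex.I‖)
    (hε : Filter.Tendsto ε l (nhds 0)) (x : E) :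
    Filter.Tendsto (fun i => (Φ (F i)).1 x) l (nhds 0) := by
  set R := Φ (resFun Complex.I I_im_ne_zero)
  have hr : IsResolvent D Complex.I R := hΦ.isResolvent I_im_ne_zero
  rw [Metric.tendsto_nhds]
  intro δ hδ
  obtain ⟨u, hu⟩ := (hr.denseRange hD).exists_dist_lt x
    (show 0 < δ / (2 * (|C| + 1)) by positivity)
  have hlim : Filter.Tendsto (fun i => ε i * ‖u‖) l (nhds 0) := by
    simpa using hε.mul_const ‖u‖
  filter_upwards [hC, hF, hlim.eventually (gt_mem_nhds (half_pos hδ))] with i hCi hFi hi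
  rw [dist_zero_right]
  have h1 : ‖(Φ (F i)).1 (R.1 u)‖ ≤ ε i * ‖u‖ := by
    rw [calc_mul_apply]
    refine norm_calc_le Φ (fun t => ?_) u
    rw [BoundedContinuousFunction.mul_apply, norm_mul, resFun_apply, norm_inv]
    rw [← div_eq_mul_inv, div_le_iff₀ (norm_pos_iff.2 (ofReal_add_ne_zero I_im_ne_zero t))]
    exact hFi t
  have h2 : ‖(Φ (F i)).1 (x - R.1 u)‖ ≤ (|C| + 1) * ‖x - R.1 u‖ :=
    norm_calc_le Φ (fun t => ((hCi t).trans (le_abs_self C)).trans (by linarith)) _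
  have h3 : (|C| + 1) * ‖x - R.1 u‖ < δ / 2 := by
    rw [dist_eq_norm, lt_div_iff₀ (by positivity)] at hu
    linarith
  calc ‖(Φ (F i)).1 x‖ = ‖(Φ (F i)).1 (x - R.1 u) + (Φ (F i)).1 (R.1 u)‖ := by
        rw [← map_add, sub_add_cancel]
    _ ≤ _ := norm_add_le _ _
    _ < δ := by linarith

end Calculus

/-! ### The integral representation of χ and the elementary integrals. -/

section Families

/-- The function `t ↦ h t / (s ^ 2 + t ^ 2)`, with the parameter `s` truncated below at `1`. -/
noncomputable def quotFun (h : ℝ → ℝ) (hc : Continuous h) (hb : ∀ t, |h t| ≤ 1 + t ^ 2) (s : ℝ) :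
    ℝ →ᵇ ℂ :=
  bddFun (fun t => ((h t / (max s 1 ^ 2 + t ^ 2) : ℝ) : ℂ))
    (Complex.continuous_ofReal.comp (hc.div (by fun_prop) fun t => by positivity)) (C := 1)
    fun t => by
      have : 1 ≤ max s 1 := le_max_right _ _
      rw [Complex.norm_real, Real.norm_eq_abs, abs_div, abs_of_pos (a := max s 1 ^ 2 + t ^ 2)
        (by positivity), div_le_one (by positivity)]
      nlinarith [hb t]

theorem quotFun_apply (h : ℝ → ℝ) (hc : Continuous h) (hb : ∀ t, |h t| ≤ 1 + t ^ 2) {s : ℝ}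
    (hs : 1 ≤ s) (t : ℝ) : quotFun h hc hb s t = ((h t / (s ^ 2 + t ^ 2) : ℝ) : ℂ) := by
  rw [quotFun, bddFun_apply, max_eq_left hs]

/-- Continuity in the supremum norm on the whole line, which the truncation makes possible, lets the
family be integrated inside the Banach space of bounded continuous functions. -/
theorem continuous_quotFun (h : ℝ → ℝ) (hc : Continuous h) (hb : ∀ t, |h t| ≤ 1 + t ^ 2) :
    Continuous (quotFun h hc hb) := by
  have key (s s' : ℝ) : dist (quotFun h hc hb s) (quotFun h hc hb s') ≤
      |max s' 1 ^ 2 - max s 1 ^ 2| := by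
    refine (BoundedContinuousFunction.dist_le (abs_nonneg _)).2 fun t => ?_
    have h1 : 1 ≤ max s 1 := le_max_right _ _
    have h2 : 1 ≤ max s' 1 := le_max_right _ _
    rw [dist_eq_norm]
    simp only [quotFun, bddFun_apply]
    rw [← Complex.ofReal_sub, Complex.norm_real, Real.norm_eq_abs,
      div_sub_div _ _ (by positivity) (by positivity), abs_div,
      abs_of_pos (a := (max s 1 ^ 2 + t ^ 2) * (max s' 1 ^ 2 + t ^ 2)) (by positivity),
      div_le_iff₀ (by positivity)]
    rw [show h t * (max s' 1 ^ 2 + t ^ 2) - (max s 1 ^ 2 + t ^ 2) * h t =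
      (max s' 1 ^ 2 - max s 1 ^ 2) * h t by ring, abs_mul]
    gcongr
    refine (hb t).trans ?_
    have h3 : 1 + t ^ 2 ≤ max s 1 ^ 2 + t ^ 2 := by nlinarith
    have h4 : 1 ≤ max s' 1 ^ 2 + t ^ 2 := by nlinarith [sq_nonneg t]
    nlinarith [sq_nonneg t]
  rw [continuous_iff_continuousAt]
  intro s
  rw [ContinuousAt, tendsto_iff_dist_tendsto_zero]
  refine squeeze_zero (fun _ => dist_nonneg) (fun s' => key s' s) ?_
  have : Continuous fun s' => |max s 1 ^ 2 - max s' 1 ^ 2| := by fun_prop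
  simpa using this.tendsto s

theorem abs_le_one_add_sq (t : ℝ) : |t| ≤ 1 + t ^ 2 := by
  rw [← sq_abs]; nlinarith [sq_nonneg (|t| - 1), abs_nonneg t]

theorem abs_sqrt_le_one_add_sq (t : ℝ) : |Real.sqrt (1 + t ^ 2)| ≤ 1 + t ^ 2 := by
  rw [abs_of_nonneg (Real.sqrt_nonneg _), Real.sqrt_le_left (by positivity)]
  nlinarith [sq_nonneg t]

/-- The function `t ↦ t / (s ^ 2 + t ^ 2)` for `1 ≤ s`. -/
noncomputable def idQuot : ℝ → ℝ →ᵇ ℂ := quotFun (fun t => t) continuous_id abs_le_one_add_sq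

/-- The function `t ↦ √(1 + t ^ 2) / (s ^ 2 + t ^ 2)` for `1 ≤ s`. -/
noncomputable def sqrtQuot : ℝ → ℝ →ᵇ ℂ :=
  quotFun (fun t => Real.sqrt (1 + t ^ 2)) (by fun_prop) abs_sqrt_le_one_add_sq

theorem idQuot_apply {s : ℝ} (hs : 1 ≤ s) (t : ℝ) :
    idQuot s t = ((t / (s ^ 2 + t ^ 2) : ℝ) : ℂ) := quotFun_apply _ _ _ hs t

theorem sqrtQuot_apply {s : ℝ} (hs : 1 ≤ s) (t : ℝ) :
    sqrtQuot s t = ((Real.sqrt (1 + t ^ 2) / (s ^ 2 + t ^ 2) : ℝ) : ℂ) := quotFun_apply _ _ _ hs t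

@[fun_prop] theorem continuous_idQuot : Continuous idQuot := continuous_quotFun ..

@[fun_prop] theorem continuous_sqrtQuot : Continuous sqrtQuot := continuous_quotFun ..

/-- The rescaled normalizing function `t ↦ χ(t / M)`. -/
noncomputable def chiScaled (M : ℝ) : ℝ →ᵇ ℂ :=
  chi.compContinuous ⟨fun t => t / M, by fun_prop⟩

theorem chi_apply (t : ℝ) : chi t = ((2 / Real.pi * Real.arctan t : ℝ) : ℂ) := rfl

theorem star_chi : star chi = chi := by
  ext t
  rw [BoundedContinuousFunction.star_apply, chi_apply, Complex.star_def, Complex.conj_ofReal]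

theorem chiScaled_apply (M t : ℝ) : chiScaled M t = ((2 / Real.pi * Real.arctan (t / M) : ℝ) : ℂ) :=
  rfl

theorem norm_chi_le (t : ℝ) : ‖chi t‖ ≤ 1 := by
  rw [chi_apply, Complex.norm_real, Real.norm_eq_abs, abs_mul, abs_of_pos (by positivity)]
  have h : |Real.arctan t| ≤ Real.pi / 2 :=
    abs_le.2 ⟨(Real.neg_pi_div_two_lt_arctan t).le, (Real.arctan_lt_pi_div_two t).le⟩
  calc 2 / Real.pi * |Real.arctan t| ≤ 2 / Real.pi * (Real.pi / 2) := by gcongr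
    _ = 1 := by field_simp

theorem abs_arctan_le (t : ℝ) : |Real.arctan t| ≤ |t| := by
  have h : ∀ s : ℝ, 0 ≤ s → Real.arctan s ≤ s := fun s hs => by
    have h1 := Real.le_tan (Real.arctan_nonneg.2 hs) (Real.arctan_lt_pi_div_two s)
    rwa [Real.tan_arctan] at h1
  rcases le_total 0 t with ht | ht
  · rw [abs_of_nonneg ht, abs_of_nonneg (Real.arctan_nonneg.2 ht)]; exact h t ht
  · rw [abs_of_nonpos ht, ← abs_neg, ← Real.arctan_neg,
      abs_of_nonneg (Real.arctan_nonneg.2 (by linarith))]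
    exact h _ (by linarith)

theorem norm_chiScaled_le {M : ℝ} (hM : 0 < M) (t : ℝ) :
    ‖chiScaled M t‖ ≤ M⁻¹ * ‖(t : ℂ) + Complex.I‖ := by
  have h1 : |t| ≤ ‖(t : ℂ) + Complex.I‖ := by
    simpa using Complex.abs_re_le_norm ((t : ℂ) + Complex.I)
  have h2 : 2 / Real.pi ≤ 1 := by
    rw [div_le_one Real.pi_pos]; linarith [Real.pi_gt_three]
  rw [chiScaled_apply, Complex.norm_real, Real.norm_eq_abs, abs_mul, abs_of_pos (by positivity)]
  calc 2 / Real.pi * |Real.arctan (t / M)| ≤ 1 * |t / M| :=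
        mul_le_mul h2 (abs_arctan_le _) (abs_nonneg _) zero_le_one
    _ = M⁻¹ * |t| := by rw [abs_div, abs_of_pos hM]; ring
    _ ≤ _ := by gcongr

/-- The s-derivative of -arctan(t/s) is t/(s² + t²). The integral stops at M because only finite
pieces are taken in norm; the remainder χ(t/M) tends to 0 strongly. -/
theorem chi_sub_chiScaled {M : ℝ} (hM : 1 ≤ M) :
    chi - chiScaled M = (2 / Real.pi) • ∫ s in (1 : ℝ)..M, idQuot s := by
  ext t
  have hint : IntervalIntegrable idQuot MeasureTheory.volume 1 M :=
    continuous_idQuot.intervalIntegrable _ _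
  have h1 : (∫ s in (1 : ℝ)..M, idQuot s) t = ∫ s in (1 : ℝ)..M, idQuot s t :=
    ((BoundedContinuousFunction.evalCLM ℝ t : (ℝ →ᵇ ℂ) →L[ℝ] ℂ).intervalIntegral_comp_comm
      hint).symm
  have h2 : ∫ s in (1 : ℝ)..M, idQuot s t =
      ∫ s in (1 : ℝ)..M, ((t / (s ^ 2 + t ^ 2) : ℝ) : ℂ) := by
    refine intervalIntegral.integral_congr fun s hs => ?_
    rw [Set.uIcc_of_le hM] at hs
    exact idQuot_apply hs.1 t
  have h3 : ∫ s in (1 : ℝ)..M, t / (s ^ 2 + t ^ 2) = -Real.arctan (t / M) - -Real.arctan (t / 1) := by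
    refine intervalIntegral.integral_eq_sub_of_hasDerivAt (f := fun s => -Real.arctan (t / s))
      (fun s hs => ?_) ?_
    · rw [Set.uIcc_of_le hM] at hs
      have hs0 : s ≠ 0 := by linarith [hs.1]
      have := (((hasDerivAt_inv hs0).const_mul t).arctan).neg
      refine (this.congr_deriv ?_).congr_of_eventuallyEq (Filter.Eventually.of_forall fun s => rfl)
      field_simp
    · refine ContinuousOn.intervalIntegrable fun s hs => ContinuousAt.continuousWithinAt ?_
      rw [Set.uIcc_of_le hM] at hs
      have : s ^ 2 + t ^ 2 ≠ 0 := by nlinarith [hs.1, sq_nonneg t]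
      fun_prop (disch := assumption)
  rw [BoundedContinuousFunction.sub_apply, BoundedContinuousFunction.smul_apply, h1, h2,
    intervalIntegral.integral_ofReal, h3, chi_apply, chiScaled_apply, Complex.real_smul,
    ← Complex.ofReal_sub, ← Complex.ofReal_mul]
  congr 1
  rw [div_one]
  ring

theorem integral_inv_sq_le {M : ℝ} (hM : 1 ≤ M) : ∫ s in (1 : ℝ)..M, (s ^ 2)⁻¹ ≤ 1 := by
  have h : ∫ s in (1 : ℝ)..M, (s ^ 2)⁻¹ = -M⁻¹ - -1⁻¹ := by
    refine intervalIntegral.integral_eq_sub_of_hasDerivAt (f := fun s => -s⁻¹)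
      (fun s hs => ?_) ?_
    · rw [Set.uIcc_of_le hM] at hs
      have hs0 : s ≠ 0 := by linarith [hs.1]
      exact ((hasDerivAt_inv hs0).neg.congr_deriv (neg_neg _)).congr_of_eventuallyEq
        (Filter.Eventually.of_forall fun s => rfl)
    · refine ContinuousOn.intervalIntegrable fun s hs => ContinuousAt.continuousWithinAt ?_
      rw [Set.uIcc_of_le hM] at hs
      have : s ^ 2 ≠ 0 := by nlinarith [hs.1]
      fun_prop (disch := assumption)
  rw [h]
  have : 0 < M⁻¹ := by positivity
  norm_num
  linarith

/-- The bound does not depend on t or M. With q = √(1 + t²) and s ≥ 1 one has (s + q)² ≤ 4(s² + t²),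
so the integrand is at most 4q/(s + q)², whose integral over s ≥ 1 is 4q/(1 + q) ≤ 4. -/
theorem integral_sqrtQuot_le {M : ℝ} (hM : 1 ≤ M) (t : ℝ) :
    ∃ p : ℝ, p ≤ 4 ∧ (∫ s in (1 : ℝ)..M, sqrtQuot s) t = (p : ℂ) := by
  have hint : IntervalIntegrable sqrtQuot MeasureTheory.volume 1 M :=
    continuous_sqrtQuot.intervalIntegrable _ _
  have h1 : (∫ s in (1 : ℝ)..M, sqrtQuot s) t = ∫ s in (1 : ℝ)..M, sqrtQuot s t :=
    ((BoundedContinuousFunction.evalCLM ℝ t : (ℝ →ᵇ ℂ) →L[ℝ] ℂ).intervalIntegral_comp_comm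
      hint).symm
  have h2 : ∫ s in (1 : ℝ)..M, sqrtQuot s t =
      ∫ s in (1 : ℝ)..M, ((Real.sqrt (1 + t ^ 2) / (s ^ 2 + t ^ 2) : ℝ) : ℂ) := by
    refine intervalIntegral.integral_congr fun s hs => ?_
    rw [Set.uIcc_of_le hM] at hs
    exact sqrtQuot_apply hs.1 t
  refine ⟨_, ?_, by rw [h1, h2, intervalIntegral.integral_ofReal]⟩
  set q := Real.sqrt (1 + t ^ 2)
  have hq : 0 ≤ q := Real.sqrt_nonneg _
  have hq2 : q ^ 2 = 1 + t ^ 2 := Real.sq_sqrt (by positivity)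
  have h3 : ∫ s in (1 : ℝ)..M, 4 * q / (s + q) ^ 2 = -(4 * q / (M + q)) - -(4 * q / (1 + q)) := by
    refine intervalIntegral.integral_eq_sub_of_hasDerivAt (f := fun s => -(4 * q / (s + q)))
      (fun s hs => ?_) ?_
    · rw [Set.uIcc_of_le hM] at hs
      have hs0 : s + q ≠ 0 := by linarith [hs.1]
      have := ((((hasDerivAt_id s).add_const q).inv hs0).const_mul (4 * q)).neg
      refine (this.congr_deriv ?_).congr_of_eventuallyEq (Filter.Eventually.of_forall fun s => rfl)
      simp only [id]
      field_simp
    · refine ContinuousOn.intervalIntegrable fun s hs => ContinuousAt.continuousWithinAt ?_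
      rw [Set.uIcc_of_le hM] at hs
      have : (s + q) ^ 2 ≠ 0 := by nlinarith [hs.1]
      fun_prop (disch := assumption)
  have h4 : ∫ s in (1 : ℝ)..M, q / (s ^ 2 + t ^ 2) ≤ ∫ s in (1 : ℝ)..M, 4 * q / (s + q) ^ 2 := by
    refine intervalIntegral.integral_mono_on hM ?_ ?_ fun s hs => ?_
    · refine ContinuousOn.intervalIntegrable fun s hs => ContinuousAt.continuousWithinAt ?_
      rw [Set.uIcc_of_le hM] at hs
      have : s ^ 2 + t ^ 2 ≠ 0 := by nlinarith [hs.1, sq_nonneg t]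
      fun_prop (disch := assumption)
    · refine ContinuousOn.intervalIntegrable fun s hs => ContinuousAt.continuousWithinAt ?_
      rw [Set.uIcc_of_le hM] at hs
      have : (s + q) ^ 2 ≠ 0 := by nlinarith [hs.1]
      fun_prop (disch := assumption)
    · have h5 := hs.1
      have h6 : 0 < s ^ 2 + t ^ 2 := by nlinarith [sq_nonneg t]
      have h7 : 0 < s + q := by linarith
      rw [div_le_div_iff₀ h6 (by positivity)]
      have h8 : (s + q) ^ 2 ≤ 4 * (s ^ 2 + t ^ 2) := by nlinarith [sq_nonneg (s - q), sq_nonneg t]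
      nlinarith
  refine h4.trans ?_
  rw [h3]
  have h5 : 0 ≤ 4 * q / (M + q) := by positivity
  have h6 : 4 * q / (1 + q) ≤ 4 := by rw [div_le_iff₀ (by positivity)]; linarith
  linarith

end Families

/-! ### Integrating lower bounds from the quotients to χ. -/

section ChiBounds

variable {B E : Type*} [NonUnitalCStarAlgebra B] [PartialOrder B] [StarOrderedRing B]
  [NormedAddCommGroup E] [NormedSpace ℂ E] [CompleteSpace E] [SMul B E] [CStarModule B E]
  {D : E →ₗ.[ℂ] E} {Φ : (ℝ →ᵇ ℂ) →⋆ₐ[ℂ] Adj B E}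

variable (Φ) in
/-- The continuous functional `f ↦ ⟨v, f(D) u⟩` on bounded continuous functions. -/
noncomputable def calcForm (φ : B →L[ℝ] ℝ) (v u : E) : (ℝ →ᵇ ℂ) →L[ℝ] ℝ :=
  (formCLM φ v u).comp
    (LinearMap.mkContinuous (Φ.toLinearMap.restrictScalars ℝ) 1 fun f => by
      rw [one_mul]; exact NonUnitalStarAlgHom.norm_apply_le Φ f)

theorem calcForm_apply (φ : B →L[ℝ] ℝ) (v u : E) (f : ℝ →ᵇ ℂ) :
    calcForm Φ φ v u f = form φ v ((Φ f).1 u) := rfl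

theorem form_chi_sub (φ : B →L[ℝ] ℝ) (v u : E) {M : ℝ} (hM : 1 ≤ M) :
    form φ v ((Φ chi).1 u) - form φ v ((Φ (chiScaled M)).1 u) =
      2 / Real.pi * ∫ s in (1 : ℝ)..M, form φ v ((Φ (idQuot s)).1 u) := by
  rw [← calcForm_apply, ← calcForm_apply, ← map_sub, chi_sub_chiScaled hM, map_smul, smul_eq_mul,
    ← ContinuousLinearMap.intervalIntegral_comp_comm _ (continuous_idQuot.intervalIntegrable _ _)]
  rfl

theorem IsFunctionalCalculus.tendsto_form_chiScaled (hD : IsSelfAdjointRegular B D)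
    (hΦ : IsFunctionalCalculus D Φ) (φ : B →L[ℝ] ℝ) (v u : E) :
    Filter.Tendsto (fun M => form φ v ((Φ (chiScaled M)).1 u)) Filter.atTop (nhds 0) := by
  have h := hΦ.tendsto_zero hD (F := chiScaled) (C := 1) (ε := fun M => M⁻¹) (l := Filter.atTop)
    (Filter.Eventually.of_forall fun M t => norm_chi_le (t / M))
    ((Filter.eventually_gt_atTop 0).mono fun M hM => norm_chiScaled_le hM)
    tendsto_inv_atTop_zero u
  have hc : Continuous fun w : E => form φ v w := by fun_prop
  have h2 := (hc.tendsto 0).comp h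
  rwa [form_zero_right] at h2

theorem two_div_pi_le_one : 2 / Real.pi ≤ 1 := by
  rw [div_le_one Real.pi_pos]; linarith [Real.pi_gt_three]

/-- For errors of order s⁻²: the integral of s⁻² over s ≥ 1 and the factor 2/π are both at most 1.
-/
theorem IsFunctionalCalculus.le_form_chi (hD : IsSelfAdjointRegular B D)
    (hΦ : IsFunctionalCalculus D Φ) {φ : B →L[ℝ] ℝ} {u v : E} {c : ℝ} (hc : 0 ≤ c)
    (h : ∀ s, 1 ≤ s → -(c * (s ^ 2)⁻¹) ≤ form φ v ((Φ (idQuot s)).1 u)) :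
    -c ≤ form φ v ((Φ chi).1 u) := by
  have hlim : Filter.Tendsto (fun M => form φ v ((Φ chi).1 u) - form φ v ((Φ (chiScaled M)).1 u))
      Filter.atTop (nhds (form φ v ((Φ chi).1 u) - 0)) :=
    tendsto_const_nhds.sub (hΦ.tendsto_form_chiScaled hD φ v u)
  rw [sub_zero] at hlim
  refine ge_of_tendsto hlim ((Filter.eventually_ge_atTop 1).mono fun M hM => ?_)
  rw [form_chi_sub φ v u hM]
  have h1 : ∫ s in (1 : ℝ)..M, -(c * (s ^ 2)⁻¹) ≤
      ∫ s in (1 : ℝ)..M, form φ v ((Φ (idQuot s)).1 u) := by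
    refine intervalIntegral.integral_mono_on hM ?_ ?_ fun s hs => h s hs.1
    · refine ContinuousOn.intervalIntegrable fun s hs => ContinuousAt.continuousWithinAt ?_
      rw [Set.uIcc_of_le hM] at hs
      have : s ^ 2 ≠ 0 := by nlinarith [hs.1]
      fun_prop (disch := assumption)
    · exact ((calcForm Φ φ v u).continuous.comp continuous_idQuot).intervalIntegrable _ _
  rw [intervalIntegral.integral_neg, intervalIntegral.integral_const_mul] at h1
  have h2 : c * ∫ s in (1 : ℝ)..M, (s ^ 2)⁻¹ ≤ c * 1 := by gcongr; exact integral_inv_sq_le hM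
  have h3 : 0 < 2 / Real.pi := by positivity
  have h4 := two_div_pi_le_one
  nlinarith

/-- For an error that is itself a function of the operator: it is integrated inside the calculus,
where the scalar bound 4 becomes an operator bound. -/
theorem IsFunctionalCalculus.le_form_chi_of_sqrtQuot (hD : IsSelfAdjointRegular B D)
    (hΦ : IsFunctionalCalculus D Φ) {φ : B →L[ℝ] ℝ} (hφ : IsPosFunctional φ) {v z : E} {c : ℝ}
    (hc : 0 ≤ c)
    (h : ∀ s, 1 ≤ s →
      -(c * form φ z ((Φ (sqrtQuot s)).1 z)) ≤ form φ v ((Φ (idQuot s)).1 z)) :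
    -(4 * c * form φ z z) ≤ form φ v ((Φ chi).1 z) := by
  have hlim : Filter.Tendsto (fun M => form φ v ((Φ chi).1 z) - form φ v ((Φ (chiScaled M)).1 z))
      Filter.atTop (nhds (form φ v ((Φ chi).1 z) - 0)) :=
    tendsto_const_nhds.sub (hΦ.tendsto_form_chiScaled hD φ v z)
  rw [sub_zero] at hlim
  refine ge_of_tendsto hlim ((Filter.eventually_ge_atTop 1).mono fun M hM => ?_)
  rw [form_chi_sub φ v z hM]
  have h1 : ∫ s in (1 : ℝ)..M, -(c * form φ z ((Φ (sqrtQuot s)).1 z)) ≤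
      ∫ s in (1 : ℝ)..M, form φ v ((Φ (idQuot s)).1 z) := by
    refine intervalIntegral.integral_mono_on hM ?_ ?_ fun s hs => h s hs.1
    · exact (((calcForm Φ φ z z).continuous.comp
        continuous_sqrtQuot).const_mul c).neg.intervalIntegrable _ _
    · exact ((calcForm Φ φ v z).continuous.comp continuous_idQuot).intervalIntegrable _ _
  rw [intervalIntegral.integral_neg, intervalIntegral.integral_const_mul] at h1
  have h5 : ∫ s in (1 : ℝ)..M, form φ z ((Φ (sqrtQuot s)).1 z) =
      calcForm Φ φ z z (∫ s in (1 : ℝ)..M, sqrtQuot s) :=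
    (calcForm Φ φ z z).intervalIntegral_comp_comm (continuous_sqrtQuot.intervalIntegrable _ _)
  choose p hp hp' using integral_sqrtQuot_le hM
  have h6 : 0 ≤ form φ z ((Φ ((4 : ℂ) • 1 - ∫ s in (1 : ℝ)..M, sqrtQuot s)).1 z) := by
    refine form_calc_nonneg Φ hφ (p := fun t => 4 - p t) (fun t => ?_)
      (fun t => sub_nonneg.2 (hp t)) z
    rw [BoundedContinuousFunction.sub_apply, hp']
    simp
  have h7 : ((4 : ℂ) • z) = (4 : ℝ) • z := by
    rw [← Complex.coe_smul]; norm_num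
  rw [map_sub, map_smul, map_one, Adj.sub_apply, Adj.smul_apply, Adj.one_apply, h7,
    form_sub_right, form_smul_right] at h6
  rw [h5, calcForm_apply] at h1
  have h2 : c * form φ z ((Φ (∫ s in (1 : ℝ)..M, sqrtQuot s)).1 z) ≤ c * (4 * form φ z z) := by
    gcongr; linarith
  have h3 : 0 < 2 / Real.pi := by positivity
  have h4 := two_div_pi_le_one
  have h8 : 0 ≤ c * (4 * form φ z z) := mul_nonneg hc (by linarith [hφ.form_self_nonneg z])
  nlinarith

end ChiBounds

end HilbertMod

namespace HilbertMod

/-! ### From a core of T to the whole domain of T. -/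

section Lift

/-- A bounded linear relation with values in a complete space extends to the closure of its
domain. -/
theorem exists_mem_closure_of_bounded {X Z : Type*} [NormedAddCommGroup X] [NormedSpace ℂ X]
    [NormedAddCommGroup Z] [NormedSpace ℂ Z] [CompleteSpace Z] (M : Submodule ℂ (X × Z)) {C : ℝ}
    (hC : 0 ≤ C) (hM : ∀ q ∈ M, ‖q.2‖ ≤ C * ‖q.1‖) {x : X}
    (hx : x ∈ closure (Prod.fst '' (M : Set (X × Z)))) :
    ∃ z, (x, z) ∈ closure (M : Set (X × Z)) ∧ ‖z‖ ≤ C * ‖x‖ := by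
  obtain ⟨s, hs, hlim⟩ := mem_closure_iff_seq_limit.1 hx
  choose q hq hqs using hs
  have hcq : CauchySeq fun n => (q n).2 := by
    have h1 := hlim.cauchySeq
    rw [Metric.cauchySeq_iff] at h1 ⊢
    intro ε hε
    obtain ⟨N, hN⟩ := h1 (ε / (C + 1)) (by positivity)
    refine ⟨N, fun m hm n hn => ?_⟩
    have h2 := hN m hm n hn
    have h3 := hM _ (M.sub_mem (hq m) (hq n))
    rw [Prod.fst_sub, Prod.snd_sub, hqs, hqs, ← dist_eq_norm, ← dist_eq_norm] at h3
    rw [lt_div_iff₀ (by positivity)] at h2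
    nlinarith [dist_nonneg (x := s m) (y := s n)]
  obtain ⟨z, hz⟩ := cauchySeq_tendsto_of_complete hcq
  refine ⟨z, ?_, ?_⟩
  · refine mem_closure_of_tendsto (hlim.prodMk_nhds hz) (Filter.Eventually.of_forall fun n => ?_)
    rw [← hqs]
    exact hq n
  · refine le_of_tendsto_of_tendsto hz.norm (hlim.norm.const_mul C)
      (Filter.Eventually.of_forall fun n => ?_)
    simp only [← hqs]
    exact hM _ (hq n)

end Lift

section Pairs

variable {B E : Type*} [NonUnitalCStarAlgebra B] [PartialOrder B] [StarOrderedRing B]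
  [NormedAddCommGroup E] [NormedSpace ℂ E] [SMul B E] [CStarModule B E]

theorem I_smul_I_smul (x : E) : Complex.I • Complex.I • x = -x := by
  rw [smul_smul, Complex.I_mul_I, neg_one_smul]

/-- `u ∈ 𝓕(S,T)` with `Su = a`, `Tu = b`, `TSu = p` and `STu = q`. -/
structure FTuple (S T : E →ₗ.[ℂ] E) (u a b p q : E) : Prop where
  hS : (u, a) ∈ S.graph
  hT : (u, b) ∈ T.graph
  hTS : (a, p) ∈ T.graph
  hST : (b, q) ∈ S.graph

theorem FTuple.smul {S T : E →ₗ.[ℂ] E} {u a b p q : E} (h : FTuple S T u a b p q) (c : ℂ) :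
    FTuple S T (c • u) (c • a) (c • b) (c • p) (c • q) :=
  ⟨graph_smul c h.hS, graph_smul c h.hT, graph_smul c h.hTS, graph_smul c h.hST⟩

theorem FTuple.add {S T : E →ₗ.[ℂ] E} {u a b p q u' a' b' p' q' : E} (h : FTuple S T u a b p q)
    (h' : FTuple S T u' a' b' p' q') :
    FTuple S T (u + u') (a + a') (b + b') (p + p') (q + q') :=
  ⟨graph_add h.hS h'.hS, graph_add h.hT h'.hT, graph_add h.hTS h'.hTS, graph_add h.hST h'.hST⟩

variable (B) in
/-- The form estimate for the anticommutator, with one constant. -/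
def FormEstimate (S T : E →ₗ.[ℂ] E) (C : ℝ) : Prop :=
  ∀ u a b p q : E, FTuple S T u a b p q → ∀ f : B →L[ℝ] ℝ, IsPosFunctional f →
    form f (p + q) (p + q) ≤ C * (form f u u + form f a a + form f b b)

variable (B) in
/-- A weakly anticommuting pair for which the resolvents of `S` map all of `𝓓(T)` into
`𝓕(S,T)`. -/
structure StronglyAnticommuting (S T : E →ₗ.[ℂ] E) (C l : ℝ) : Prop where
  left : IsSelfAdjointRegular B S
  right : IsSelfAdjointRegular B T
  estimate : FormEstimate B S T C
  resolvent : ∀ m : ℝ, l ≤ |m| → ∀ x y, (x, y) ∈ T.graph →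
    ∃ u a b p q, FTuple S T u a b p q ∧ x = a + m • Complex.I • u ∧ y = p + m • Complex.I • b

variable {S T : E →ₗ.[ℂ] E}

theorem IsSelfAdjointRegular.form_shift {D : E →ₗ.[ℂ] E} (hD : IsSelfAdjointRegular B D)
    {f : B →L[ℝ] ℝ} (hf : IsPosFunctional f) {x y : E} (h : (x, y) ∈ D.graph) (m : ℝ) :
    form f (y + m • Complex.I • x) (y + m • Complex.I • x) =
      form f y y + m ^ 2 * form f x x := by
  have h1 := hD.form_I_graph hf h
  have h2 := hf.form_comm y (Complex.I • x)
  rw [form_I_left, h1] at h2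
  simp only [form_add_left, form_add_right, form_smul_left, form_smul_right, form_I_left, h2,
    I_smul_I_smul, form_neg_right, h1]
  ring

theorem IsWeaklyAnticommuting.exists_estimate (h : IsWeaklyAnticommuting B S T) :
    ∃ C, 0 < C ∧ FormEstimate B S T C := by
  obtain ⟨C₀, C₁, C₂, h0, h1, h2, hC⟩ := h.form_estimate
  refine ⟨C₀ + C₁ + C₂, by positivity, fun u a b p q hF f hf => ?_⟩
  obtain ⟨hu, rfl⟩ := exists_domain_of_graph hF.hS
  obtain ⟨hu', rfl⟩ := exists_domain_of_graph hF.hT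
  obtain ⟨hTS, rfl⟩ := exists_domain_of_graph hF.hTS
  obtain ⟨hST, rfl⟩ := exists_domain_of_graph hF.hST
  have key := hf.nonneg _ (sub_nonneg.2 (hC u hu hu' hTS hST))
  simp only [map_sub, map_add, map_smul, smul_eq_mul] at key
  have e1 := hf.form_self_nonneg u
  have e2 := hf.form_self_nonneg (S ⟨u, hu⟩)
  have e3 := hf.form_self_nonneg (T ⟨u, hu'⟩)
  rw [add_comm (T _)]
  simp only [form] at *
  nlinarith [mul_nonneg h0.le e2, mul_nonneg h0.le e3, mul_nonneg h1.le e1, mul_nonneg h1.le e3,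
    mul_nonneg h2.le e1, mul_nonneg h2.le e2]

/-- For x in the core, u = (S + im)⁻¹x and b = Tu satisfy (S - im)b = [S,T]u - Tx. The form of the
left side at itself is that of Sb plus m² times that of b. For large |m| this absorbs the
contribution of b to the form estimate, so b and Sb are bounded by the graph norm of x. The closed
graphs then carry the conclusion from the core to all of 𝓓(T). -/
theorem IsWeaklyAnticommuting.exists_stronglyAnticommuting [CompleteSpace E]
    (h : IsWeaklyAnticommuting B S T) :
    ∃ C l, 0 < C ∧ 0 < l ∧ StronglyAnticommuting B S T C l := by
  obtain ⟨C, hC, hest⟩ := h.exists_estimate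
  obtain ⟨𝓔, hcore, l₀, hl₀, hl⟩ := h.core
  have hS := h.left
  have hT := h.right
  -- The threshold 4C + 1 gives m² ≥ 4C + 1, enough to absorb the term 2C⟨b, b⟩ that comes from the
  -- anticommutator.
  refine ⟨C, max l₀ (4 * C + 1), hC, by positivity, hS, hT, hest, fun m hm x y hxy => ?_⟩
  have hm0 : l₀ ≤ |m| := (le_max_left _ _).trans hm
  have hm1 : 4 * C + 1 ≤ |m| := (le_max_right _ _).trans hm
  have hm2 : 4 * C + 1 ≤ m ^ 2 := by rw [← sq_abs]; nlinarith
  have hmne : m ≠ 0 := by rintro rfl; simp at hm0; linarith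
  obtain ⟨R, hR⟩ := hS.exists_resolvent (z := m * Complex.I) (by simpa using hmne)
  have hR' (x : E) : (R.1 x, x - m • Complex.I • R.1 x) ∈ S.graph := by
    have := hR.graph x
    rwa [mul_smul, Complex.coe_smul] at this
  -- The relation (x, Tx) ↦ (TRx, STRx) over the core.
  let M : Submodule ℂ ((E × E) × (E × E)) :=
    { carrier := {q | q.1.1 ∈ 𝓔 ∧ q.1 ∈ T.graph ∧ (R.1 q.1.1, q.2.1) ∈ T.graph ∧ q.2 ∈ S.graph}
      add_mem' := fun {q q'} hq hq' => ⟨𝓔.add_mem hq.1 hq'.1, T.graph.add_mem hq.2.1 hq'.2.1, by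
        rw [Prod.fst_add, Prod.fst_add, map_add]
        exact graph_add hq.2.2.1 hq'.2.2.1, S.graph.add_mem hq.2.2.2 hq'.2.2.2⟩
      zero_mem' := ⟨𝓔.zero_mem, T.graph.zero_mem, by
        simp, S.graph.zero_mem⟩
      smul_mem' := fun c q hq => ⟨𝓔.smul_mem c hq.1, T.graph.smul_mem c hq.2.1, by
        rw [Prod.smul_fst, Prod.smul_fst, map_smul]
        exact graph_smul c hq.2.2.1, S.graph.smul_mem c hq.2.2.2⟩ }
  have hexF : ∀ x y, x ∈ 𝓔 → (x, y) ∈ T.graph →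
      ∃ b q, FTuple S T (R.1 x) (x - m • Complex.I • R.1 x) b (y - m • Complex.I • b) q := by
    intro x y hx hxy
    obtain ⟨hu, hu'⟩ := exists_domain_of_graph (hR' x)
    obtain ⟨hSu, hTu, hTS, hST⟩ := hl m hm0 ⟨R.1 x, hu⟩ (by
      rw [hu', mul_smul, Complex.coe_smul, sub_add_cancel]; exact hx)
    have e1 := mem_graph_of_domain hTu
    have e2 := mem_graph_of_domain hTS
    have e3 := mem_graph_of_domain hST
    simp only [hu'] at e2
    refine ⟨_, _, hR' x, e1, ?_, e3⟩
    have h4 := graph_sub hxy (graph_smul (m * Complex.I) e1)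
    rwa [mul_smul, mul_smul, Complex.coe_smul, Complex.coe_smul] at h4
  have hbound : ∀ x y b q, x ∈ 𝓔 → (x, y) ∈ T.graph → (R.1 x, b) ∈ T.graph → (b, q) ∈ S.graph →
      ∀ f : B →L[ℝ] ℝ, IsPosFunctional f →
      form f b b + form f q q ≤ (4 * C + 4) * (form f x x + form f y y) := by
    intro x y b q hx hxy hb hq f hf
    obtain ⟨b', q', hF⟩ := hexF x y hx hxy
    obtain rfl := graph_unique hb hF.hT
    obtain rfl := graph_unique hq hF.hST
    have h1 := hest _ _ _ _ _ hF f hf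
    have h2 := hS.form_shift hf hF.hS m
    rw [sub_add_cancel] at h2
    have h3 := hS.form_shift hf hq (-m)
    have h4 := hf.form_add_self_le (y - m • Complex.I • b + q) (-y)
    rw [show y - m • Complex.I • b + q + -y = q + -m • Complex.I • b by module, h3, form_neg_left,
      form_neg_right, neg_neg, neg_sq] at h4
    have n1 := hf.form_self_nonneg (R.1 x)
    have n2 := hf.form_self_nonneg (x - m • Complex.I • R.1 x)
    have n3 := hf.form_self_nonneg b
    have n4 := hf.form_self_nonneg q
    have n5 := hf.form_self_nonneg x
    have n6 := hf.form_self_nonneg y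
    have h5 : form f (R.1 x) (R.1 x) + form f (x - m • Complex.I • R.1 x)
        (x - m • Complex.I • R.1 x) ≤ form f x x := by nlinarith
    have h6 : (4 * C + 1) * form f b b ≤ m ^ 2 * form f b b := by gcongr
    have h7 := mul_le_mul_of_nonneg_left h5 hC.le
    nlinarith
  have hMb : ∀ q ∈ M, ‖q.2‖ ≤ (8 * C + 8) * ‖q.1‖ := by
    rintro ⟨⟨x, y⟩, ⟨b, q⟩⟩ ⟨hx, hxy, hb, hq⟩
    have hX : ‖x‖ ≤ ‖(x, y)‖ := norm_fst_le (x, y)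
    have hY : ‖y‖ ≤ ‖(x, y)‖ := norm_snd_le (x, y)
    have hfin (c : E) (hc : ∀ f : B →L[ℝ] ℝ, IsPosFunctional f →
        form f c c ≤ (4 * C + 4) * (form f x x + form f y y)) : ‖c‖ ≤ (8 * C + 8) * ‖(x, y)‖ := by
      have h1 := norm_sq_le_of_form B (x := c) (y := x) (z := y) (w := (0 : E))
        (c₁ := 4 * C + 4) (c₂ := 4 * C + 4) (c₃ := 0) (by positivity) (by positivity) le_rfl
        (fun f hf => by linarith [hc f hf])
      refine le_of_sq_le_sq (h1.trans ?_) (by positivity)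
      have e1 : ‖x‖ ^ 2 ≤ ‖(x, y)‖ ^ 2 := by gcongr
      have e2 : ‖y‖ ^ 2 ≤ ‖(x, y)‖ ^ 2 := by gcongr
      have e3 : 0 ≤ (8 * C + 8) * (8 * C + 7) * ‖(x, y)‖ ^ 2 := by positivity
      have e4 := mul_le_mul_of_nonneg_left e1 (show 0 ≤ 4 * C + 4 by positivity)
      have e5 := mul_le_mul_of_nonneg_left e2 (show 0 ≤ 4 * C + 4 by positivity)
      linarith
    refine max_le (hfin b fun f hf => ?_) (hfin q fun f hf => ?_)
    · linarith [hbound x y b q hx hxy hb hq f hf, hf.form_self_nonneg q]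
    · linarith [hbound x y b q hx hxy hb hq f hf, hf.form_self_nonneg b]
  have hcl : (x, y) ∈ closure (Prod.fst '' (M : Set ((E × E) × (E × E)))) := by
    have hclosable : (T.domRestrict 𝓔).IsClosable :=
      LinearPMap.IsClosable.leIsClosable
        (LinearPMap.IsClosed.isClosable hT.isClosed_graph) LinearPMap.domRestrict_le
    have h1 := hclosable.graph_closure_eq_closure_graph
    rw [hcore.closure_eq] at h1
    have h2 : (x, y) ∈ closure ((T.domRestrict 𝓔).graph : Set (E × E)) := by
      have : (x, y) ∈ (T.domRestrict 𝓔).graph.topologicalClosure := by rw [h1]; exact hxy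
      exact this
    refine closure_mono ?_ h2
    rintro ⟨x', y'⟩ hx'
    have hx'T : (x', y') ∈ T.graph := LinearPMap.le_graph_of_le LinearPMap.domRestrict_le hx'
    obtain ⟨hd, -⟩ := exists_domain_of_graph hx'
    have hx'E : x' ∈ 𝓔 := hd.1
    obtain ⟨b, q, hF⟩ := hexF x' y' hx'E hx'T
    exact ⟨((x', y'), (b, q)), ⟨hx'E, hx'T, hF.hT, hF.hST⟩, rfl⟩
  obtain ⟨⟨b, q⟩, hbq, -⟩ := exists_mem_closure_of_bounded M (by positivity) hMb hcl
  have hclosed : IsClosed {q : (E × E) × (E × E) |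
      (R.1 q.1.1, q.2.1) ∈ (T.graph : Set (E × E)) ∧ q.2 ∈ (S.graph : Set (E × E))} :=
    (hT.isClosed_graph.preimage (by fun_prop)).inter (hS.isClosed_graph.preimage continuous_snd)
  have h5 : (R.1 x, b) ∈ T.graph ∧ (b, q) ∈ S.graph :=
    closure_minimal (s := (M : Set ((E × E) × (E × E)))) (fun q hq => And.intro hq.2.2.1 hq.2.2.2)
      hclosed hbq
  refine ⟨R.1 x, x - m • Complex.I • R.1 x, b, y - m • Complex.I • b, q,
    ⟨hR' x, h5.1, ?_, h5.2⟩, by module, by module⟩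
  have h4 := graph_sub hxy (graph_smul (m * Complex.I) h5.1)
  rwa [mul_smul, mul_smul, Complex.coe_smul, Complex.coe_smul] at h4

end Pairs

end HilbertMod

namespace HilbertMod

/-! ### The mollifiers (1 + itS)⁻¹. -/

section Yosida

theorem one_le_norm_yosida (t s : ℝ) : 1 ≤ ‖(1 : ℂ) + t * s * Complex.I‖ := by
  have := Complex.abs_re_le_norm ((1 : ℂ) + t * s * Complex.I)
  simpa using this

theorem abs_le_norm_yosida (t s : ℝ) : |t| * |s| ≤ ‖(1 : ℂ) + t * s * Complex.I‖ := by
  have := Complex.abs_im_le_norm ((1 : ℂ) + t * s * Complex.I)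
  simpa [abs_mul] using this

theorem yosida_ne_zero (t s : ℝ) : (1 : ℂ) + t * s * Complex.I ≠ 0 :=
  norm_pos_iff.1 (zero_lt_one.trans_le (one_le_norm_yosida t s))

/-- The function `s ↦ (1 + its)⁻¹`. -/
noncomputable def yosFun (t : ℝ) : ℝ →ᵇ ℂ :=
  bddFun (fun s : ℝ => ((1 : ℂ) + t * s * Complex.I)⁻¹)
    (Continuous.inv₀ (by fun_prop) (yosida_ne_zero t)) (C := 1) fun s => by
      rw [norm_inv]; exact inv_le_one_of_one_le₀ (one_le_norm_yosida t s)

/-- The function `s ↦ s(1 + its)⁻¹`. -/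
noncomputable def yosMul (t : ℝ) (ht : t ≠ 0) : ℝ →ᵇ ℂ :=
  bddFun (fun s : ℝ => s * ((1 : ℂ) + t * s * Complex.I)⁻¹)
    (Continuous.mul (by fun_prop) (Continuous.inv₀ (by fun_prop) (yosida_ne_zero t)))
    (C := |t|⁻¹) fun s => by
      have h0 : 0 < |t| := abs_pos.2 ht
      rw [norm_mul, norm_inv, Complex.norm_real, Real.norm_eq_abs, ← div_eq_mul_inv,
        div_le_iff₀ (zero_lt_one.trans_le (one_le_norm_yosida t s)), inv_mul_eq_div,
        le_div_iff₀' h0]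
      exact abs_le_norm_yosida t s

theorem norm_yosFun_le (t s : ℝ) : ‖yosFun t s‖ ≤ 1 := by
  rw [yosFun, bddFun_apply, norm_inv]; exact inv_le_one_of_one_le₀ (one_le_norm_yosida t s)

theorem norm_yosMul_le {t : ℝ} (ht : t ≠ 0) (s : ℝ) : ‖yosMul t ht s‖ ≤ |t|⁻¹ := by
  have h0 : 0 < |t| := abs_pos.2 ht
  rw [yosMul, bddFun_apply, norm_mul, norm_inv, Complex.norm_real, Real.norm_eq_abs,
    ← div_eq_mul_inv, div_le_iff₀ (zero_lt_one.trans_le (one_le_norm_yosida t s)), inv_mul_eq_div,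
    le_div_iff₀' h0]
  exact abs_le_norm_yosida t s

theorem yosFun_add (t s : ℝ) :
    yosFun t s + t * Complex.I * (s * yosFun t s) = 1 := by
  have := yosida_ne_zero t s
  rw [yosFun, bddFun_apply]
  field_simp

variable {B E : Type*} [NonUnitalCStarAlgebra B] [PartialOrder B] [StarOrderedRing B]
  [NormedAddCommGroup E] [NormedSpace ℂ E] [CompleteSpace E] [SMul B E] [CStarModule B E]
  {S : E →ₗ.[ℂ] E} {Φ : (ℝ →ᵇ ℂ) →⋆ₐ[ℂ] Adj B E}

theorem IsFunctionalCalculus.yosida_graph (hΦ : IsFunctionalCalculus S Φ) {t : ℝ} (ht : t ≠ 0)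
    (x : E) : ((Φ (yosFun t)).1 x, (Φ (yosMul t ht)).1 x) ∈ S.graph :=
  hΦ.mem_graph (fun _ => rfl) x

theorem yosida_add (Φ : (ℝ →ᵇ ℂ) →⋆ₐ[ℂ] Adj B E) {t : ℝ} (ht : t ≠ 0) (x : E) :
    (Φ (yosFun t)).1 x + t • Complex.I • (Φ (yosMul t ht)).1 x = x := by
  rw [← Complex.coe_smul, smul_smul, ← Adj.smul_apply, ← map_smul, ← Adj.add_apply, ← map_add]
  conv_rhs => rw [← Adj.one_apply (B := B) x, ← map_one Φ]
  congr 3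
  ext s
  exact yosFun_add t s

theorem IsFunctionalCalculus.yosida_apply (hΦ : IsFunctionalCalculus S Φ) {t : ℝ} (ht : t ≠ 0)
    {w a : E} (h : (w, a) ∈ S.graph) : (Φ (yosFun t)).1 (w + t • Complex.I • a) = w := by
  have h1 := hΦ.apply_graph (f := yosFun t) (h := yosMul t ht) (fun _ => rfl) h
  rw [← Complex.coe_smul, map_add, map_smul, map_smul, ← h1, Complex.coe_smul, yosida_add]

theorem IsFunctionalCalculus.yosida_apply_right (hΦ : IsFunctionalCalculus S Φ) {t : ℝ}
    (ht : t ≠ 0) {w a a₁ w₁ : E} (h : (w, a) ∈ S.graph) (h₁ : (w₁, a₁) ∈ S.graph)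
    (hw : w = w₁ + t • Complex.I • a₁) : (Φ (yosFun t)).1 a = a₁ := by
  have h1 := hΦ.apply_graph (f := yosFun t) (h := yosMul t ht) (fun _ => rfl) h
  have h2 := hΦ.yosida_apply ht h₁
  rw [← hw] at h2
  have h3 := hΦ.yosida_graph ht w
  rw [h2] at h3
  rw [← h1, graph_unique h3 h₁]

theorem norm_yosida_le (Φ : (ℝ →ᵇ ℂ) →⋆ₐ[ℂ] Adj B E) (t : ℝ) (x : E) :
    ‖(Φ (yosFun t)).1 x‖ ≤ ‖x‖ := by
  simpa using norm_calc_le Φ (norm_yosFun_le t) x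

theorem yosida_comm (Φ : (ℝ →ᵇ ℂ) →⋆ₐ[ℂ] Adj B E) (t t' : ℝ) (x : E) :
    (Φ (yosFun t)).1 ((Φ (yosFun t')).1 x) = (Φ (yosFun t')).1 ((Φ (yosFun t)).1 x) := by
  rw [calc_mul_apply, calc_mul_apply, mul_comm]

theorem IsFunctionalCalculus.tendsto_yosida (hS : IsSelfAdjointRegular B S)
    (hΦ : IsFunctionalCalculus S Φ) (x : E) :
    Filter.Tendsto (fun t => (Φ (yosFun t)).1 x) (nhds 0) (nhds x) := by
  have h := hΦ.tendsto_zero hS (F := fun t => 1 - yosFun t) (C := 2) (ε := fun t => |t|)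
    (l := nhds 0) (Filter.Eventually.of_forall fun t s => ?_)
    (Filter.Eventually.of_forall fun t s => ?_) (by simpa using (continuous_abs.tendsto (0 : ℝ))) x
  · have h2 := (tendsto_const_nhds (x := x)).sub h
    simpa using h2
  · refine (norm_sub_le _ _).trans ?_
    have h1 := norm_yosFun_le t s
    have h2 : ‖(1 : ℝ →ᵇ ℂ) s‖ = 1 := by simp
    linarith
  · have h1 : (1 - yosFun t) s = t * Complex.I * (s * yosFun t s) := by
      rw [BoundedContinuousFunction.sub_apply, BoundedContinuousFunction.coe_one, Pi.one_apply,
        sub_eq_iff_eq_add', yosFun_add]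
    have h2 : |s| ≤ ‖(s : ℂ) + Complex.I‖ := by
      simpa using Complex.abs_re_le_norm ((s : ℂ) + Complex.I)
    rw [h1, norm_mul, norm_mul, norm_mul, Complex.norm_I, mul_one, Complex.norm_real,
      Complex.norm_real, Real.norm_eq_abs, Real.norm_eq_abs]
    gcongr
    have h3 := norm_yosFun_le t s
    nlinarith [abs_nonneg s, norm_nonneg (yosFun t s)]

end Yosida

/-! ### Form estimates for elements of 𝓕(S,T). -/

section Estimates

variable {B E : Type*} [NonUnitalCStarAlgebra B] [PartialOrder B] [StarOrderedRing B]
  [NormedAddCommGroup E] [NormedSpace ℂ E] [SMul B E] [CStarModule B E]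
  {S T : E →ₗ.[ℂ] E}

theorem IsSelfAdjointRegular.form_shift' {D : E →ₗ.[ℂ] E} (hD : IsSelfAdjointRegular B D)
    {f : B →L[ℝ] ℝ} (hf : IsPosFunctional f) {w a : E} (h : (w, a) ∈ D.graph) (t : ℝ) :
    form f (w + t • Complex.I • a) (w + t • Complex.I • a) =
      form f w w + t ^ 2 * form f a a := by
  have h1 := hD.form_I_graph hf h
  have h2 := hf.form_comm w (Complex.I • a)
  rw [form_I_left, h1] at h2
  have h3 : form f a (Complex.I • w) = 0 := by linarith
  simp only [form_add_left, form_add_right, form_smul_left, form_smul_right, form_I_left, h1,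
    I_smul_I_smul, form_neg_right, h3]
  ring

theorem IsPosFunctional.neg_form_le {f : B →L[ℝ] ℝ} (hf : IsPosFunctional f) {δ : ℝ} (hδ : 0 < δ)
    (x y : E) : -(δ⁻¹ * form f x x + δ * form f y y) ≤ 2 * form f x y := by
  have h := hf.neg_two_form_le (δ⁻¹ • x) y
  simp only [form_smul_left, form_smul_right] at h
  have h2 := mul_le_mul_of_nonneg_left h hδ.le
  field_simp at h2 ⊢
  linarith

theorem FTuple.two_form (hS : IsSelfAdjointRegular B S) (hT : IsSelfAdjointRegular B T)
    {f : B →L[ℝ] ℝ} (hf : IsPosFunctional f) {u a b p q : E} (h : FTuple S T u a b p q) :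
    2 * form f a b = form f u (p + q) := by
  have h1 := hS.form_graph f h.hS h.hST
  have h2 := hT.form_graph f h.hT h.hTS
  have h3 := hf.form_comm a b
  rw [form_add_right]
  linarith

/-- The mixed term 2⟨Su, Tu⟩ equals ⟨u, [S,T]u⟩. Young's inequality with weight 1/C costs one of the
two copies of ⟨Su, Su⟩ + ⟨Tu, Tu⟩ contained in 2⟨(S + T)u, (S + T)u⟩. -/
theorem FTuple.sum_estimate (hS : IsSelfAdjointRegular B S) (hT : IsSelfAdjointRegular B T)
    {C : ℝ} (hC : 0 < C) (hest : FormEstimate B S T C)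
    {f : B →L[ℝ] ℝ} (hf : IsPosFunctional f) {u a b p q : E} (h : FTuple S T u a b p q) :
    form f a a + form f b b ≤ 2 * form f (a + b) (a + b) + (C + 1) * form f u u := by
  have h1 := h.two_form hS hT hf
  have h2 := hest _ _ _ _ _ h f hf
  have h3 := hf.neg_form_le (inv_pos.2 hC) u (p + q)
  rw [inv_inv] at h3
  have h4 := mul_le_mul_of_nonneg_left h2 (inv_nonneg.2 hC.le)
  rw [inv_mul_cancel_left₀ hC.ne'] at h4
  have h5 := hf.form_comm a b
  simp only [form_add_left, form_add_right]
  linarith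

/-- Here y = T(1 + itS)w is the controlled quantity, and b = Tw is recovered from (1 - itS)b = y -
it[S,T]w. Smallness of t absorbs the b-term of the form estimate. -/
theorem FTuple.commutator_estimate (hS : IsSelfAdjointRegular B S)
    {C : ℝ} (hC : 0 < C) (hest : FormEstimate B S T C)
    {f : B →L[ℝ] ℝ} (hf : IsPosFunctional f) {w a b p q y : E} (h : FTuple S T w a b p q)
    {t : ℝ} (ht : 4 * C * t ^ 2 ≤ 1) (hy : y = b + t • Complex.I • p) :
    form f b b ≤ 2 * t ^ 2 * form f (p + q) (p + q) + 2 * form f y y ∧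
    form f (p + q) (p + q) ≤ 2 * C * (form f w w + form f a a) + 4 * C * form f y y := by
  have h1 := hS.form_shift' hf h.hST (-t)
  have h2 : b + -t • Complex.I • q = y + -t • Complex.I • (p + q) := by rw [hy]; module
  have h3 := hf.form_add_self_le y (-t • Complex.I • (p + q))
  rw [← h2, h1, form_smul_left, form_smul_right, form_I_I] at h3
  have h4 := hest _ _ _ _ _ h f hf
  have n1 := hf.form_self_nonneg q
  have n2 := hf.form_self_nonneg (p + q)
  have h5 : form f b b ≤ 2 * t ^ 2 * form f (p + q) (p + q) + 2 * form f y y := by nlinarith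
  refine ⟨h5, ?_⟩
  have h6 := mul_le_mul_of_nonneg_left h5 hC.le
  have h7 := mul_le_mul_of_nonneg_right ht n2
  linarith

/-- The a priori estimate for the regularized equation `Tx + S(1 + itS)⁻¹x - imx = v`. -/
theorem FTuple.apriori (hS : IsSelfAdjointRegular B S) (hT : IsSelfAdjointRegular B T)
    {C : ℝ} (hC : 0 < C) (hest : FormEstimate B S T C)
    {f : B →L[ℝ] ℝ} (hf : IsPosFunctional f) {w a b p q x y v : E} (h : FTuple S T w a b p q)
    {t m : ℝ} (htm : 0 ≤ t * m) (ht : 4 * C * t ^ 2 ≤ 1) (hm : 8 * C + 1 ≤ m ^ 2)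
    (hx : x = w + t • Complex.I • a) (hy : y = b + t • Complex.I • p)
    (hv : v = y + a - m • Complex.I • x) :
    form f y y + form f a a + m ^ 2 * form f x x ≤ 2 * form f v v := by
  obtain ⟨-, hk⟩ := h.commutator_estimate hS hC hest hf ht hy
  have hxT : (x, y) ∈ T.graph := by
    rw [hx, hy]
    have := graph_add h.hT (graph_smul (t * Complex.I) h.hTS)
    rwa [mul_smul, mul_smul, Complex.coe_smul, Complex.coe_smul] at this
  have hxx := hS.form_shift' hf h.hS t
  rw [← hx] at hxx
  have z1 := hT.form_I_graph hf hxT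
  have z2 := hT.form_I_graph hf h.hTS
  have z3 := hS.form_I_graph hf h.hS
  have c1 := hf.form_comm (Complex.I • x) y
  have c2 := hf.form_comm (Complex.I • x) a
  have c3 := hf.form_comm y a
  have c4 := hf.form_comm a b
  have e1 : form f a y = form f a b := by
    rw [hy, form_add_right, form_smul_right, z2]; ring
  have e2 : form f x (Complex.I • a) = t * form f a a := by
    rw [hx, form_add_left, form_smul_left, form_I_left, I_smul_I_smul, form_neg_right, z3]; ring
  rw [form_I_left, z1] at c1
  rw [form_I_left, e2] at c2
  have e3 := h.two_form hS hT hf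
  have e4 := hf.neg_form_le (inv_pos.2 (show 0 < 8 * C by positivity)) w (p + q)
  rw [inv_inv] at e4
  have e5 := mul_le_mul_of_nonneg_left hk (inv_nonneg.2 (show 0 ≤ 8 * C by positivity))
  have e6 : (8 * C)⁻¹ * (2 * C * (form f w w + form f a a) + 4 * C * form f y y) =
      4⁻¹ * (form f w w + form f a a) + 2⁻¹ * form f y y := by field_simp; ring
  -- The regularized operator is not symmetric. Its skew part contributes 2tm⟨a, a⟩, which has the
  -- right sign because t and m agree in sign. The mixed term ⟨a, y⟩ reduces to ⟨a, b⟩ and hence to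
  -- the anticommutator.
  have e7 : form f v v = form f y y + form f a a + m ^ 2 * form f x x + 2 * form f a y +
      2 * (t * m) * form f a a := by
    rw [hv]
    simp only [form_add_left, form_add_right, form_sub_left, form_sub_right, form_smul_left,
      form_smul_right, form_I_left, I_smul_I_smul, form_neg_right]
    simp only [z1, e2, c3, ← c1, ← c2]
    ring
  have n1 := hf.form_self_nonneg a
  have n2 := hf.form_self_nonneg x
  have n3 := hf.form_self_nonneg w
  have n4 := mul_nonneg (sq_nonneg t) n1
  have n5 := mul_nonneg htm n1
  have n6 := mul_le_mul_of_nonneg_right hm n2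
  have n7 := mul_nonneg hC.le n2
  have n8 : form f w w ≤ form f x x := by linarith
  have n9 := mul_le_mul_of_nonneg_left n8 hC.le
  have n10 := hf.form_self_nonneg y
  rw [e6] at e5
  linarith

/-- Pairing with ix removes the T-term, and the S-term contributes t⟨a, a⟩, of the same sign as m⟨x,
x⟩. No anticommutator enters, so the bound needs no largeness of m. -/
theorem norm_add_smul_ge (hS : IsSelfAdjointRegular B S) (hT : IsSelfAdjointRegular B T)
    {w a x y : E} (hwa : (w, a) ∈ S.graph) (hxy : (x, y) ∈ T.graph) {t m : ℝ} (htm : 0 ≤ t * m)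
    (hx : x = w + t • Complex.I • a) : |m| * ‖x‖ ≤ ‖y + a - m • Complex.I • x‖ := by
  have key : ‖m • x‖ ≤ 1 * ‖y + a - m • Complex.I • x‖ := by
    refine norm_le_of_form B zero_le_one fun f hf => ?_
    set v := y + a - m • Complex.I • x with hv
    have z1 := hT.form_I_graph hf hxy
    have z3 := hS.form_I_graph hf hwa
    have e2 : form f x (Complex.I • a) = t * form f a a := by
      rw [hx, form_add_left, form_smul_left, form_I_left, I_smul_I_smul, form_neg_right, z3]; ring
    have e3 : form f (Complex.I • x) v = -(t * form f a a) - m * form f x x := by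
      rw [hv, form_sub_right, form_add_right, form_smul_right, form_I_I, form_I_left, form_I_left,
        e2, z1]
      ring
    have e4 := hf.form_comm (Complex.I • x) v
    have e5 := hf.form_self_nonneg (v + m • Complex.I • x)
    simp only [form_add_left, form_add_right, form_smul_left, form_smul_right, ← e4, e3,
      form_I_I] at e5
    rw [form_smul_left, form_smul_right]
    have n1 := mul_nonneg htm (hf.form_self_nonneg a)
    linarith
  simpa [norm_smul] using key

end Estimates

end HilbertMod

namespace HilbertMod

/-! ### Solving Su + Tu - imu = v. -/

section Sum

variable {B E : Type*} [NonUnitalCStarAlgebra B] [PartialOrder B] [StarOrderedRing B]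
  [NormedAddCommGroup E] [NormedSpace ℂ E] [SMul B E] [CStarModule B E]
  {S T : E →ₗ.[ℂ] E} {C l : ℝ}

theorem StronglyAnticommuting.yosida_tuple (h : StronglyAnticommuting B S T C l) {t : ℝ}
    (ht : t ≠ 0) (htl : l * |t| ≤ 1) {x y : E} (hxy : (x, y) ∈ T.graph) :
    ∃ w a b p q, FTuple S T w a b p q ∧ x = w + t • Complex.I • a ∧ y = b + t • Complex.I • p := by
  have h0 : 0 < |t| := abs_pos.2 ht
  -- (1 + itS)⁻¹ is -i/t times the resolvent (S - i/t)⁻¹, which explains both the parameter -1/t and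
  -- the scalar used below.
  obtain ⟨u, a, b, p, q, hF, hx, hy⟩ := h.resolvent (-t⁻¹) (by
    rw [abs_neg, abs_inv, ← one_div, le_div_iff₀ h0]; exact htl) x y hxy
  have key (z : E) : t • Complex.I • ((-t⁻¹ : ℝ) * Complex.I : ℂ) • z = z := by
    rw [← Complex.coe_smul, smul_smul, smul_smul]
    have : (t : ℂ) * Complex.I * ((-t⁻¹ : ℝ) * Complex.I) = 1 := by
      have : (t : ℂ) ≠ 0 := by exact_mod_cast ht
      push_cast
      linear_combination (-(t : ℂ) * (t : ℂ)⁻¹) * Complex.I_mul_I + mul_inv_cancel₀ this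
    rw [this, one_smul]
  refine ⟨_, _, _, _, _, hF.smul ((-t⁻¹ : ℝ) * Complex.I), ?_, ?_⟩
  · rw [key, mul_smul, Complex.coe_smul, hx]; abel
  · rw [key, mul_smul, Complex.coe_smul, hy]; abel

/-- The operator A = S(1 + itS)⁻¹ has norm at most 1/|t|. For |m₁| = |m| + 1/|t| it is a small
perturbation of T - im₁. The bound `norm_add_smul_ge` for T + A - im₁ then allows a second
perturbation from m₁ back to m. -/
theorem StronglyAnticommuting.exists_regularized [CompleteSpace E]
    (hS : IsSelfAdjointRegular B S) (hT : IsSelfAdjointRegular B T) {t m : ℝ} (htm : 0 < t * m)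
    (v : E) : ∃ x y w a, (x, y) ∈ T.graph ∧ (w, a) ∈ S.graph ∧ x = w + t • Complex.I • a ∧
      v = y + a - m • Complex.I • x := by
  have ht : t ≠ 0 := by rintro rfl; simp at htm
  have hm : m ≠ 0 := by rintro rfl; simp at htm
  have ht0 : 0 < |t| := abs_pos.2 ht
  have hm0 : 0 < |m| := abs_pos.2 hm
  obtain ⟨Φ, hΦ⟩ := hS.exists_calculus
  set A := (Φ (yosMul t ht)).1
  have hA (x x' : E) : ‖A x - A x'‖ ≤ |t|⁻¹ * ‖x - x'‖ := by
    rw [← map_sub]; exact norm_calc_le Φ (norm_yosMul_le ht) _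
  set m₁ := m * (1 + |t|⁻¹ / |m|) with hm₁
  have hm₁a : |m₁| = |m| + |t|⁻¹ := by
    rw [hm₁, abs_mul, abs_of_pos (a := 1 + |t|⁻¹ / |m|) (by positivity)]
    field_simp
  have htm₁ : 0 ≤ t * m₁ := by
    rw [hm₁, ← mul_assoc]; positivity
  have htinv : 0 < |t|⁻¹ := inv_pos.2 ht0
  have him : (-(m₁ : ℂ) * Complex.I).im = -m₁ := by simp
  have hbig (v : E) : ∃ x y, (x, y) ∈ T.graph ∧ y + (-(m₁ : ℂ) * Complex.I) • x + A x = v := by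
    refine exists_of_lipschitz_perturbation T.graph _ (c := |m₁|) htinv.le
      (by rw [hm₁a]; linarith) (fun x y hxy => ?_) (fun v => hT.surjective ?_ v) A hA v
    · have := hT.norm_le (-(m₁ : ℂ) * Complex.I) hxy
      rwa [him, abs_neg] at this
    · rw [him, neg_ne_zero, ← abs_pos, hm₁a]; positivity
  -- The preimage of the graph of T under `L` is the graph of T + A.
  let L : (E × E) →ₗ[ℂ] (E × E) :=
    LinearMap.prod (LinearMap.fst ℂ E E)
      (LinearMap.snd ℂ E E - A.toLinearMap.comp (LinearMap.fst ℂ E E))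
  have hL (x y : E) : (x, y) ∈ T.graph.comap L ↔ (x, y - A x) ∈ T.graph := Iff.rfl
  obtain ⟨x, y, hxy, hv⟩ := exists_of_lipschitz_perturbation (T.graph.comap L)
    (-(m₁ : ℂ) * Complex.I) (c := |m₁|) (k := |m₁| - |m|) (by rw [hm₁a]; linarith) (by linarith)
    (fun x y hxy => by
      rw [hL] at hxy
      have := norm_add_smul_ge hS hT (hΦ.yosida_graph ht x) hxy htm₁ (yosida_add Φ ht x).symm
      rw [sub_add_cancel] at this
      rwa [mul_smul, neg_smul, Complex.coe_smul, ← sub_eq_add_neg])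
    (fun v => by
      obtain ⟨x, y, hxy, hv⟩ := hbig v
      refine ⟨x, y + A x, ?_, ?_⟩
      · rw [hL, add_sub_cancel_right]; exact hxy
      · rw [← hv]; abel)
    (fun x => (m₁ - m) • Complex.I • x)
    (fun x x' => by
      rw [← smul_sub, ← smul_sub, norm_smul, norm_smul, Complex.norm_I, one_mul, Real.norm_eq_abs]
      refine le_of_eq ?_
      congr 1
      have e : m₁ - m = m * (|t|⁻¹ / |m|) := by rw [hm₁]; ring
      rw [e, hm₁a, add_sub_cancel_left, abs_mul, abs_div, abs_abs, abs_of_pos htinv]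
      field_simp) v
  refine ⟨x, y - A x, (Φ (yosFun t)).1 x, A x, hxy, hΦ.yosida_graph ht x,
    (yosida_add Φ ht x).symm, ?_⟩
  rw [← hv, mul_smul, neg_smul, Complex.coe_smul]
  module

theorem FTuple.norm_commutator_estimate (hS : IsSelfAdjointRegular B S)
    (hC : 0 < C) (hest : FormEstimate B S T C) {w a b p q y : E} (h : FTuple S T w a b p q)
    {t : ℝ} (ht : 4 * C * t ^ 2 ≤ 1) (hy : y = b + t • Complex.I • p) :
    ‖b‖ ^ 2 ≤ 2 * t ^ 2 * ‖p + q‖ ^ 2 + 2 * ‖y‖ ^ 2 ∧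
    ‖p + q‖ ^ 2 ≤ 2 * C * (‖w‖ ^ 2 + ‖a‖ ^ 2) + 4 * C * ‖y‖ ^ 2 := by
  constructor
  · have := norm_sq_le_of_form B (x := b) (y := p + q) (z := y) (w := (0 : E)) (c₁ := 2 * t ^ 2)
      (c₂ := 2) (c₃ := 0) (by positivity) (by positivity) le_rfl
      (fun f hf => by linarith [(h.commutator_estimate hS hC hest hf ht hy).1])
    linarith
  · have := norm_sq_le_of_form B (x := p + q) (y := w) (z := a) (w := y) (c₁ := 2 * C)
      (c₂ := 2 * C) (c₃ := 4 * C) (by positivity) (by positivity) (by positivity)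
      (fun f hf => by linarith [(h.commutator_estimate hS hC hest hf ht hy).2])
    linarith

theorem norm_smul_I_smul (t : ℝ) (x : E) : ‖t • Complex.I • x‖ = |t| * ‖x‖ := by
  rw [norm_smul, norm_smul, Complex.norm_I, one_mul, Real.norm_eq_abs]

theorem FTuple.norm_apriori (hS : IsSelfAdjointRegular B S) (hT : IsSelfAdjointRegular B T)
    (hC : 0 < C) (hest : FormEstimate B S T C) {w a b p q x y v : E} (h : FTuple S T w a b p q)
    {t m : ℝ} (htm : 0 ≤ t * m) (ht : 4 * C * t ^ 2 ≤ 1) (hm : 8 * C + 1 ≤ m ^ 2)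
    (hx : x = w + t • Complex.I • a) (hy : y = b + t • Complex.I • p)
    (hv : v = y + a - m • Complex.I • x) :
    ‖w‖ ^ 2 ≤ 2 * ‖v‖ ^ 2 ∧ ‖a‖ ^ 2 ≤ 2 * ‖v‖ ^ 2 ∧ ‖b‖ ^ 2 ≤ 12 * ‖v‖ ^ 2 ∧
      ‖p + q‖ ^ 2 ≤ 16 * C * ‖v‖ ^ 2 := by
  have hap (f : B →L[ℝ] ℝ) (hf : IsPosFunctional f) :
      form f y y + form f a a + m ^ 2 * form f x x ≤ 2 * form f v v :=
    h.apriori hS hT hC hest hf htm ht hm hx hy hv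
  have hb2 (c : E) (hc : ∀ f : B →L[ℝ] ℝ, IsPosFunctional f → form f c c ≤ 2 * form f v v) :
      ‖c‖ ^ 2 ≤ 2 * ‖v‖ ^ 2 := by
    have := norm_sq_le_of_form B (x := c) (y := v) (z := (0 : E)) (w := (0 : E)) (c₁ := 2)
      (c₂ := 0) (c₃ := 0) (by positivity) le_rfl le_rfl (fun f hf => by linarith [hc f hf])
    linarith
  have hm1 : 1 ≤ m ^ 2 := by linarith
  have hmx (f : B →L[ℝ] ℝ) (hf : IsPosFunctional f) : form f x x ≤ m ^ 2 * form f x x :=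
    le_mul_of_one_le_left (hf.form_self_nonneg x) hm1
  have hny : ‖y‖ ^ 2 ≤ 2 * ‖v‖ ^ 2 := hb2 y fun f hf => by
    linarith [hap f hf, hmx f hf, hf.form_self_nonneg a, hf.form_self_nonneg x]
  have hna : ‖a‖ ^ 2 ≤ 2 * ‖v‖ ^ 2 := hb2 a fun f hf => by
    linarith [hap f hf, hmx f hf, hf.form_self_nonneg y, hf.form_self_nonneg x]
  have hnw : ‖w‖ ^ 2 ≤ 2 * ‖v‖ ^ 2 := hb2 w fun f hf => by
    have h1 := hS.form_shift' hf h.hS t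
    rw [← hx] at h1
    linarith [hap f hf, hmx f hf, hf.form_self_nonneg y, hf.form_self_nonneg a,
      mul_nonneg (sq_nonneg t) (hf.form_self_nonneg a)]
  obtain ⟨hnb, hnk⟩ := h.norm_commutator_estimate hS hC hest ht hy
  have e1 := mul_le_mul_of_nonneg_left hnw hC.le
  have e2 := mul_le_mul_of_nonneg_left hna hC.le
  have e3 := mul_le_mul_of_nonneg_left hny hC.le
  have hnk' : ‖p + q‖ ^ 2 ≤ 16 * C * ‖v‖ ^ 2 := by linarith
  have e4 := mul_le_mul_of_nonneg_left hnk' (sq_nonneg t)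
  have e5 := mul_le_mul_of_nonneg_right ht (sq_nonneg ‖v‖)
  exact ⟨hnw, hna, by linarith, hnk'⟩

set_option maxHeartbeats 1000000 in
/-- Mollified solutions of the regularized equation are approximate solutions of
`Su + Tu - imu = v`. -/
theorem StronglyAnticommuting.mollify [CompleteSpace E] (h : StronglyAnticommuting B S T C l)
    (hC : 0 < C) {Φ : (ℝ →ᵇ ℂ) →⋆ₐ[ℂ] Adj B E} (hΦ : IsFunctionalCalculus S Φ)
    {t τ m : ℝ} (ht : t ≠ 0) (hτ : τ ≠ 0) (htl : l * |t| ≤ 1) (hτl : l * |τ| ≤ 1)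
    (htC : 4 * C * t ^ 2 ≤ 1) (hτC : 4 * C * τ ^ 2 ≤ 1) (htm : 0 < t * m)
    (hm : 8 * C + 1 ≤ m ^ 2) (v : E) :
    ∃ u a b p q, FTuple S T u a b p q ∧
      ‖(Φ (yosFun (-τ))).1 ((Φ (yosFun τ)).1 v) - (a + b - m • Complex.I • u)‖ ≤
        |τ| * (40 * (C + 1) * ‖v‖) +
          |t| * ((20 * (C + 1) + 4 * |τ|⁻¹ + 2 * |m|) * ‖v‖) := by
  have hS := h.left
  have hT := h.right
  obtain ⟨x, y, w, a, hxy, hwa, hx, hv⟩ := exists_regularized hS hT htm v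
  obtain ⟨w', a', b, p, q, hF, hx', hy⟩ := h.yosida_tuple ht htl hxy
  obtain rfl : w' = w := by
    have h1 := hΦ.yosida_apply ht hwa
    have h2 := hΦ.yosida_apply ht hF.hS
    rw [← hx] at h1
    rw [← hx'] at h2
    exact h2.symm.trans h1
  obtain rfl := graph_unique hF.hS hwa
  clear hx'
  obtain ⟨hnw, hna, hnb', hnk'⟩ :=
    hF.norm_apriori hS hT hC h.estimate htm.le htC hm hx hy hv
  have hN : 0 ≤ ‖v‖ ^ 2 := sq_nonneg _
  have hCN : 0 ≤ C * ‖v‖ ^ 2 := by positivity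
  -- first mollification
  obtain ⟨w₁, a₁, b₁, p₁, q₁, hF₁, hw₁, hb₁⟩ := h.yosida_tuple hτ hτl hF.hT
  obtain ⟨w₂, a₂, b₂, p₂, q₂, hF₂, hw₂, hb₂⟩ := h.yosida_tuple (t := -τ) (neg_ne_zero.2 hτ)
    (by rwa [abs_neg]) hF₁.hT
  set J := (Φ (yosFun τ)).1
  set J' := (Φ (yosFun (-τ))).1
  have hJ : ∀ x, ‖J x‖ ≤ ‖x‖ := norm_yosida_le Φ τ
  have hJ' : ∀ x, ‖J' x‖ ≤ ‖x‖ := norm_yosida_le Φ (-τ)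
  have eJw : J w' = w₁ := by rw [hw₁]; exact hΦ.yosida_apply hτ hF₁.hS
  have eJa : J a' = a₁ := hΦ.yosida_apply_right hτ hwa hF₁.hS hw₁
  have eJw₁ : J' w₁ = w₂ := by
    rw [hw₂]; exact hΦ.yosida_apply (neg_ne_zero.2 hτ) hF₂.hS
  have eJa₁ : J' a₁ = a₂ := hΦ.yosida_apply_right (neg_ne_zero.2 hτ) hF₁.hS hF₂.hS hw₂
  -- Since T nearly anticommutes with S, moving T across (1 + iτS)⁻¹ reverses the sign of τ, with an
  -- error τ times an anticommutator. This is why the mollifier is the product of both signs: T then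
  -- passes through J'J and the product is unchanged.
  have eJb : J' b = b₁ + τ • Complex.I • J' (p₁ + q₁) := by
    have h1 := hΦ.yosida_apply (neg_ne_zero.2 hτ) hF₁.hST
    have h2 : b = (b₁ + -τ • Complex.I • q₁) + ((τ : ℂ) * Complex.I) • (p₁ + q₁) := by
      rw [hb₁, mul_smul, Complex.coe_smul]; module
    conv_lhs => rw [h2, map_add, map_smul, h1, mul_smul, Complex.coe_smul]
  have eJb₁ : J b₁ = b₂ - τ • Complex.I • J (p₂ + q₂) := by
    have h1 := hΦ.yosida_apply hτ hF₂.hST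
    have h2 : b₁ = (b₂ + τ • Complex.I • q₂) - ((τ : ℂ) * Complex.I) • (p₂ + q₂) := by
      rw [hb₂, mul_smul, Complex.coe_smul]; module
    conv_lhs => rw [h2, map_sub, map_smul, h1, mul_smul, Complex.coe_smul]
  -- q = STw has no bound uniform in t. Only Jq = S(1 + iτS)⁻¹b is bounded, at the cost 1/|τ|, so t
  -- must be chosen after τ.
  have eJq : ‖J q‖ ≤ |τ|⁻¹ * ‖b‖ := by
    rw [← hΦ.apply_graph (f := yosFun τ) (h := yosMul τ hτ) (fun _ => rfl) hF.hST]
    exact norm_calc_le Φ (norm_yosMul_le hτ) _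
  have hcomm (x : E) : J' (J x) = J (J' x) := yosida_comm Φ _ _ x
  have eKb : J' (J b) = b₂ - τ • Complex.I • J (p₂ + q₂) +
      τ • Complex.I • J (J' (p₁ + q₁)) := by
    rw [hcomm, eJb, map_add, eJb₁]
    simp only [← Complex.coe_smul, map_smul]
  -- bounds after mollification
  have hn₁ : ‖w₁‖ ≤ ‖w'‖ := eJw ▸ hJ w'
  have hna₁ : ‖a₁‖ ≤ ‖a'‖ := eJa ▸ hJ a'
  have hn₂ : ‖w₂‖ ≤ ‖w₁‖ := eJw₁ ▸ hJ' w₁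
  have hna₂ : ‖a₂‖ ≤ ‖a₁‖ := eJa₁ ▸ hJ' a₁
  have hn₁' : ‖w₁‖ ^ 2 ≤ 2 * ‖v‖ ^ 2 := (pow_le_pow_left₀ (norm_nonneg _) hn₁ 2).trans hnw
  have hna₁' : ‖a₁‖ ^ 2 ≤ 2 * ‖v‖ ^ 2 := (pow_le_pow_left₀ (norm_nonneg _) hna₁ 2).trans hna
  have hn₂' : ‖w₂‖ ^ 2 ≤ 2 * ‖v‖ ^ 2 := (pow_le_pow_left₀ (norm_nonneg _) hn₂ 2).trans hn₁'
  have hna₂' : ‖a₂‖ ^ 2 ≤ 2 * ‖v‖ ^ 2 := (pow_le_pow_left₀ (norm_nonneg _) hna₂ 2).trans hna₁'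
  obtain ⟨hnb₁, hnk₁⟩ := hF₁.norm_commutator_estimate hS hC h.estimate hτC hb₁
  obtain ⟨hnb₂, hnk₂⟩ := hF₂.norm_commutator_estimate hS hC h.estimate
    (by rwa [neg_sq]) hb₂
  have hnk₁' : ‖p₁ + q₁‖ ^ 2 ≤ 56 * C * ‖v‖ ^ 2 := by
    linarith [mul_le_mul_of_nonneg_left hn₁' hC.le, mul_le_mul_of_nonneg_left hna₁' hC.le,
      mul_le_mul_of_nonneg_left hnb' hC.le]
  have hnb₁' : ‖b₁‖ ^ 2 ≤ 52 * ‖v‖ ^ 2 := by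
    linarith [mul_le_mul_of_nonneg_left hnk₁' (sq_nonneg τ),
      mul_le_mul_of_nonneg_right hτC (sq_nonneg ‖v‖)]
  have hnk₂' : ‖p₂ + q₂‖ ^ 2 ≤ 216 * C * ‖v‖ ^ 2 := by
    linarith [mul_le_mul_of_nonneg_left hn₂' hC.le, mul_le_mul_of_nonneg_left hna₂' hC.le,
      mul_le_mul_of_nonneg_left hnb₁' hC.le]
  have hroot (c : E) (hc : ‖c‖ ^ 2 ≤ 216 * C * ‖v‖ ^ 2) : ‖c‖ ≤ 20 * (C + 1) * ‖v‖ := by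
    refine le_of_sq_le_sq (hc.trans ?_) (by positivity)
    rw [mul_pow]
    gcongr
    nlinarith
  have hk0 := hroot _ (hnk'.trans (by linarith))
  have hk1 := hroot _ (hnk₁'.trans (by linarith))
  have hk2 := hroot _ hnk₂'
  have hbN : ‖b‖ ≤ 4 * ‖v‖ := le_of_sq_le_sq (by rw [mul_pow]; linarith) (by positivity)
  have haN : ‖a₂‖ ≤ 2 * ‖v‖ := le_of_sq_le_sq (by rw [mul_pow]; linarith) (by positivity)
  -- the error
  have herr : J' (J v) - (a₂ + b₂ - m • Complex.I • w₂) =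
      (τ • Complex.I • (J (J' (p₁ + q₁)) - J (p₂ + q₂))) +
      (t • Complex.I • (J' (J (p + q)) - J' (J q)) + (m * t) • a₂) := by
    have e1 : J' (J v) = J' (J b) + t • Complex.I • (J' (J (p + q)) - J' (J q)) + a₂ -
        m • Complex.I • (w₂ + t • Complex.I • a₂) := by
      rw [hv, hx, hy]
      rw [← eJa₁, ← eJw₁, ← eJw, ← eJa]
      simp only [← Complex.coe_smul, map_add, map_sub, map_smul, add_sub_cancel_right]
    rw [e1, eKb, smul_add, smul_comm Complex.I t, I_smul_I_smul]
    module
  refine ⟨w₂, a₂, b₂, p₂, q₂, hF₂, ?_⟩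
  rw [herr]
  refine (norm_add_le _ _).trans (add_le_add ?_ ((norm_add_le _ _).trans ?_))
  · rw [norm_smul_I_smul]
    gcongr
    refine (norm_sub_le _ _).trans ?_
    have h1 := (hJ _).trans ((hJ' _).trans hk1)
    have h2 := (hJ _).trans hk2
    linarith
  · rw [norm_smul_I_smul, norm_smul, Real.norm_eq_abs, abs_mul]
    have h1 : ‖J' (J (p + q)) - J' (J q)‖ ≤ (20 * (C + 1) + 4 * |τ|⁻¹) * ‖v‖ := by
      refine (norm_sub_le _ _).trans ?_
      have h1 := (hJ' _).trans ((hJ _).trans hk0)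
      have h2 := (hJ' _).trans eJq
      have h3 : |τ|⁻¹ * ‖b‖ ≤ |τ|⁻¹ * (4 * ‖v‖) := by gcongr
      linarith
    have h2 : |m| * |t| * ‖a₂‖ ≤ |m| * |t| * (2 * ‖v‖) := by gcongr
    have h3 := mul_le_mul_of_nonneg_left h1 (abs_nonneg t)
    linarith

end Sum

end HilbertMod

namespace HilbertMod

section Sum

variable {B E : Type*} [NonUnitalCStarAlgebra B] [PartialOrder B] [StarOrderedRing B]
  [NormedAddCommGroup E] [NormedSpace ℂ E] [SMul B E] [CStarModule B E] [CompleteSpace E]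
  {S T : E →ₗ.[ℂ] E} {C l : ℝ}

theorem eventually_small (C l : ℝ) :
    ∀ᶠ t : ℝ in nhds 0, l * |t| ≤ 1 ∧ 4 * C * t ^ 2 ≤ 1 := by
  have h1 : Filter.Tendsto (fun t : ℝ => l * |t|) (nhds 0) (nhds 0) :=
    Continuous.tendsto' (by fun_prop) _ _ (by simp)
  have h2 : Filter.Tendsto (fun t : ℝ => 4 * C * t ^ 2) (nhds 0) (nhds 0) :=
    Continuous.tendsto' (by fun_prop) _ _ (by simp)
  filter_upwards [h1.eventually_le_const zero_lt_one, h2.eventually_le_const zero_lt_one]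
    with t a b using ⟨a, b⟩

theorem StronglyAnticommuting.mem_closure (h : StronglyAnticommuting B S T C l)
    (hC : 0 < C) {m : ℝ} (hm : 8 * C + 1 ≤ m ^ 2) (v : E) :
    v ∈ closure {v : E | ∃ u a b p q, FTuple S T u a b p q ∧ v = a + b - m • Complex.I • u} := by
  have hm0 : m ≠ 0 := by rintro rfl; norm_num at hm; linarith
  obtain ⟨Φ, hΦ⟩ := h.left.exists_calculus
  rw [Metric.mem_closure_iff]
  intro ε hε
  have hlim : Filter.Tendsto (fun τ : ℝ => ‖(Φ (yosFun τ)).1 v - v‖ +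
      ‖(Φ (yosFun (-τ))).1 v - v‖ + |τ| * (40 * (C + 1) * ‖v‖)) (nhds 0) (nhds 0) := by
    have h1 := hΦ.tendsto_yosida h.left v
    have h2 : Filter.Tendsto (fun τ : ℝ => (Φ (yosFun (-τ))).1 v) (nhds 0) (nhds v) :=
      h1.comp (Continuous.tendsto' continuous_neg _ _ neg_zero)
    have h3 : Filter.Tendsto (fun τ : ℝ => |τ| * (40 * (C + 1) * ‖v‖)) (nhds 0) (nhds 0) :=
      Continuous.tendsto' (by fun_prop) _ _ (by simp)
    have := ((h1.sub_const v).norm.add (h2.sub_const v).norm).add h3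
    simpa using this
  obtain ⟨τ, ⟨⟨hτl, hτC⟩, hτε⟩, hτ⟩ := ((((eventually_small C l).and
    (hlim.eventually_lt_const (half_pos hε))).filter_mono nhdsWithin_le_nhds).and
      (self_mem_nhdsWithin (a := (0 : ℝ)) (s := Set.Ioi 0))).exists
  have hlim2 : Filter.Tendsto (fun σ : ℝ => |σ * m| *
      ((20 * (C + 1) + 4 * |τ|⁻¹ + 2 * |m|) * ‖v‖)) (nhds 0) (nhds 0) :=
    Continuous.tendsto' (by fun_prop) _ _ (by simp)
  have hlim3 : Filter.Tendsto (fun σ : ℝ => σ * m) (nhds 0) (nhds 0) :=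
    Continuous.tendsto' (by fun_prop) _ _ (by simp)
  obtain ⟨σ, ⟨⟨hσl, hσC⟩, hσε⟩, hσ⟩ := ((((hlim3.eventually (eventually_small C l)).and
    (hlim2.eventually_lt_const (half_pos hε))).filter_mono nhdsWithin_le_nhds).and
      (self_mem_nhdsWithin (a := (0 : ℝ)) (s := Set.Ioi 0))).exists
  -- The choice t = σm with σ > 0 gives t the sign of m, so tm = σm² > 0.
  obtain ⟨u, a, b, p, q, hF, hn⟩ := h.mollify hC hΦ (mul_ne_zero hσ.ne' hm0) hτ.ne' hσl hτl hσC hτC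
    (by rw [mul_assoc]; exact mul_pos hσ (mul_self_pos.2 hm0)) hm v
  refine ⟨_, ⟨u, a, b, p, q, hF, rfl⟩, ?_⟩
  rw [dist_eq_norm]
  have e1 : ‖v - (Φ (yosFun (-τ))).1 ((Φ (yosFun τ)).1 v)‖ ≤
      ‖(Φ (yosFun τ)).1 v - v‖ + ‖(Φ (yosFun (-τ))).1 v - v‖ := by
    have e : v - (Φ (yosFun (-τ))).1 ((Φ (yosFun τ)).1 v) =
        -((Φ (yosFun (-τ))).1 ((Φ (yosFun τ)).1 v - v)) - ((Φ (yosFun (-τ))).1 v - v) := by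
      rw [map_sub]; abel
    rw [e]
    refine (norm_sub_le _ _).trans ?_
    rw [norm_neg]
    gcongr
    exact norm_yosida_le Φ _ _
  have e2 := norm_sub_le_norm_sub_add_norm_sub v ((Φ (yosFun (-τ))).1 ((Φ (yosFun τ)).1 v))
    (a + b - m • Complex.I • u)
  linarith

/-- Solvability of `Su + Tu - imu = v` with bounds. -/
theorem StronglyAnticommuting.exists_solution (h : StronglyAnticommuting B S T C l)
    (hC : 0 < C) {m : ℝ} (hm : 8 * C + 1 ≤ m ^ 2) (v : E) :
    ∃ u a b, (u, a) ∈ S.graph ∧ (u, b) ∈ T.graph ∧ a + b - m • Complex.I • u = v ∧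
      ‖a‖ ≤ 2 * ‖v‖ ∧ ‖b‖ ≤ 2 * ‖v‖ ∧ ‖u‖ ≤ 2 * ‖v‖ := by
  -- The solution relation v ↦ (u, Su, Tu) on 𝓕(S,T). As Su and Tu are bounded separately, limits
  -- stay in both domains.
  let M : Submodule ℂ (E × (E × (E × E))) :=
    { carrier := {x | ∃ p q, FTuple S T x.2.1 x.2.2.1 x.2.2.2 p q ∧
        x.2.2.1 + x.2.2.2 - m • Complex.I • x.2.1 = x.1}
      add_mem' := by
        rintro x y ⟨p, q, h1, h2⟩ ⟨p', q', h3, h4⟩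
        refine ⟨_, _, h1.add h3, ?_⟩
        simp only [Prod.fst_add, Prod.snd_add, ← h2, ← h4, smul_add]
        abel
      zero_mem' := ⟨0, 0, ⟨S.graph.zero_mem, T.graph.zero_mem, T.graph.zero_mem,
        S.graph.zero_mem⟩, by simp⟩
      smul_mem' := by
        rintro c x ⟨p, q, h1, h2⟩
        refine ⟨_, _, h1.smul c, ?_⟩
        simp only [Prod.smul_fst, Prod.smul_snd, ← h2, smul_add, smul_sub]
        rw [smul_comm c m, smul_comm c Complex.I] }
  have hMb : ∀ q ∈ M, ‖q.2‖ ≤ 2 * ‖q.1‖ := by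
    rintro ⟨w, u, a, b⟩ ⟨p, q, hF, hw⟩
    have hfin (c : E) (hc : ∀ f : B →L[ℝ] ℝ, IsPosFunctional f →
        form f c c ≤ form f a a + form f b b ∨ form f c c ≤ form f u u) : ‖c‖ ≤ 2 * ‖w‖ := by
      have h1 := norm_sq_le_of_form B (x := c) (y := w) (z := (0 : E)) (w := (0 : E))
        (c₁ := 2) (c₂ := 0) (c₃ := 0) (by positivity) le_rfl le_rfl (fun f hf => by
          have e1 := hF.sum_estimate h.left h.right hC h.estimate hf
          have e2 := h.left.form_I_graph hf hF.hS
          have e3 := h.right.form_I_graph hf hF.hT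
          have e5 := hf.form_comm (a + b) (Complex.I • u)
          have e4 : form f w w = form f (a + b) (a + b) + m ^ 2 * form f u u := by
            have e6 : form f u (Complex.I • (a + b)) = 0 := by
              rw [smul_add, form_add_right, e2, e3, add_zero]
            rw [form_I_left, e6] at e5
            simp only at hw
            rw [← hw, form_sub_left, form_sub_right, form_sub_right]
            simp only [form_smul_left, form_smul_right, form_I_I, e5]
            rw [form_I_left, e6]
            ring
          have e7 := mul_le_mul_of_nonneg_right hm (hf.form_self_nonneg u)
          have e8 := mul_nonneg hC.le (hf.form_self_nonneg u)
          have e9 := hf.form_self_nonneg u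
          have e10 := hf.form_self_nonneg (a + b)
          rcases hc f hf with h | h <;> linarith)
      refine le_of_sq_le_sq (h1.trans ?_) (by positivity)
      nlinarith [sq_nonneg ‖w‖]
    refine max_le (hfin u fun f hf => Or.inr le_rfl)
      (max_le (hfin a fun f hf => Or.inl ?_) (hfin b fun f hf => Or.inl ?_))
    · linarith [hf.form_self_nonneg b]
    · linarith [hf.form_self_nonneg a]
  have hcl : v ∈ closure (Prod.fst '' (M : Set (E × (E × (E × E))))) := by
    refine closure_mono ?_ (h.mem_closure hC hm v)
    rintro _ ⟨u, a, b, p, q, hF, rfl⟩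
    exact ⟨(_, u, a, b), ⟨p, q, hF, rfl⟩, rfl⟩
  obtain ⟨⟨u, a, b⟩, hz, hn⟩ := exists_mem_closure_of_bounded M zero_le_two hMb hcl
  have hclosed : IsClosed {x : E × (E × (E × E)) | (x.2.1, x.2.2.1) ∈ (S.graph : Set (E × E)) ∧
      (x.2.1, x.2.2.2) ∈ (T.graph : Set (E × E)) ∧
        x.2.2.1 + x.2.2.2 - m • Complex.I • x.2.1 = x.1} :=
    (h.left.isClosed_graph.preimage (by fun_prop)).inter
      ((h.right.isClosed_graph.preimage (by fun_prop)).inter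
        (isClosed_eq (by fun_prop) (by fun_prop)))
  obtain ⟨h1, h2, h3⟩ := closure_minimal (s := (M : Set (E × (E × (E × E)))))
    (by rintro x ⟨p, q, hF, hx⟩; exact ⟨hF.hS, hF.hT, hx⟩) hclosed hz
  exact ⟨u, a, b, h1, h2, h3, ((le_max_left _ _).trans (le_max_right _ _)).trans hn,
    ((le_max_right _ _).trans (le_max_right _ _)).trans hn, (le_max_left _ _).trans hn⟩

end Sum

end HilbertMod

namespace HilbertMod

/-! ### Self-adjointness and regularity of S + T. -/

section Sum

variable {B E : Type*} [NonUnitalCStarAlgebra B] [PartialOrder B] [StarOrderedRing B]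
  [NormedAddCommGroup E] [NormedSpace ℂ E] [SMul B E] [CStarModule B E]
  {S T D : E →ₗ.[ℂ] E} {C l : ℝ}

theorem mem_graph_add_iff {u d : E} :
    (u, d) ∈ (S + T).graph ↔ ∃ a b, (u, a) ∈ S.graph ∧ (u, b) ∈ T.graph ∧ a + b = d := by
  constructor
  · intro h
    obtain ⟨hu, rfl⟩ := exists_domain_of_graph h
    exact ⟨_, _, mem_graph_of_domain hu.1, mem_graph_of_domain hu.2, rfl⟩
  · rintro ⟨a, b, ha, hb, rfl⟩
    obtain ⟨hu, rfl⟩ := exists_domain_of_graph ha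
    obtain ⟨hu', rfl⟩ := exists_domain_of_graph hb
    exact (S + T).mem_graph ⟨u, hu, hu'⟩

theorem mem_graph_smul_iff {c : ℂ} {u d : E} :
    (u, d) ∈ (c • S).graph ↔ ∃ a, (u, a) ∈ S.graph ∧ c • a = d := by
  constructor
  · intro h
    obtain ⟨hu, rfl⟩ := exists_domain_of_graph h
    exact ⟨_, mem_graph_of_domain (D := S) hu, rfl⟩
  · rintro ⟨a, ha, rfl⟩
    obtain ⟨hu, rfl⟩ := exists_domain_of_graph ha
    exact (c • S).mem_graph ⟨u, hu⟩

-- Basic criterion of self-adjointness. If (y, w) lies in the graph of the adjoint and u solves (D -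
-- im)u = w - imy, then y - u is orthogonal to the range of D + im, which is everything.
variable (B) in
theorem isSelfAdjointRegular_of_surjective (hd : Dense (D.domain : Set E))
    (hs : ∀ x y x' y', (x, y) ∈ D.graph → (x', y') ∈ D.graph → inner B y x' = inner B x y')
    {m : ℝ} (hm : m ≠ 0)
    (h₁ : ∀ v, ∃ x y, (x, y) ∈ D.graph ∧ y - m • Complex.I • x = v)
    (h₂ : ∀ v, ∃ x y, (x, y) ∈ D.graph ∧ y + m • Complex.I • x = v) :
    IsSelfAdjointRegular B D where
  dense_domain := hd
  symmetric x y := hs _ _ _ _ (D.mem_graph x) (D.mem_graph y)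
  adjoint_le y w h := by
    obtain ⟨u, d, hud, hv⟩ := h₁ (w - m • Complex.I • y)
    obtain ⟨x, e, hxe, hz⟩ := h₂ (y - u)
    have hw : w - d = m • Complex.I • (y - u) := by
      rw [smul_sub, smul_sub]
      linear_combination (norm := module) (-1 : ℝ) • hv
    have h0 : inner B (y - u) (y - u) = (0 : B) := by
      obtain ⟨hx, rfl⟩ := exists_domain_of_graph hxe
      have e1 : inner B (D ⟨x, hx⟩) (y - u) = inner B x (m • Complex.I • (y - u)) := by
        rw [← hw, CStarModule.inner_sub_right, CStarModule.inner_sub_right, h ⟨x, hx⟩,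
          hs _ _ _ _ hxe hud]
      nth_rewrite 1 [← hz]
      rw [CStarModule.inner_add_left, e1]
      simp [← Complex.coe_smul, smul_sub]
    have h1 : y = u := by rwa [CStarModule.inner_self, sub_eq_zero] at h0
    subst h1
    have h2 : w = d := by
      have : w - d = 0 := by rw [hw]; simp
      exact sub_eq_zero.1 this
    subst h2
    exact exists_domain_of_graph hud
  regular := by
    refine ⟨m * Complex.I, by simpa using hm, ?_, ?_⟩
    · refine Function.Surjective.denseRange fun v => ?_
      obtain ⟨x, y, hxy, rfl⟩ := h₂ v
      obtain ⟨hx, rfl⟩ := exists_domain_of_graph hxy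
      exact ⟨⟨x, hx⟩, by simp only [mul_smul, Complex.coe_smul]⟩
    · refine Function.Surjective.denseRange fun v => ?_
      obtain ⟨x, y, hxy, rfl⟩ := h₁ v
      obtain ⟨hx, rfl⟩ := exists_domain_of_graph hxy
      exact ⟨⟨x, hx⟩, by simp only [mul_smul, Complex.coe_smul]⟩

theorem IsSelfAdjointRegular.inner_add (hS : IsSelfAdjointRegular B S)
    (hT : IsSelfAdjointRegular B T) {x y x' y' : E} (h : (x, y) ∈ (S + T).graph)
    (h' : (x', y') ∈ (S + T).graph) : inner B y x' = inner B x y' := by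
  obtain ⟨a, b, ha, hb, rfl⟩ := mem_graph_add_iff.1 h
  obtain ⟨a', b', ha', hb', rfl⟩ := mem_graph_add_iff.1 h'
  simp [hS.inner_graph ha ha', hT.inner_graph hb hb']

/-- For x in 𝓓(T) the vectors (1 + itS)⁻¹x lie in both domains and converge to x. -/
theorem StronglyAnticommuting.dense_domain_add [CompleteSpace E]
    (h : StronglyAnticommuting B S T C l) : Dense ((S + T).domain : Set E) := by
  obtain ⟨Φ, hΦ⟩ := h.left.exists_calculus
  have hsub : (T.domain : Set E) ⊆ closure ((S + T).domain : Set E) := by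
    intro x hx
    have h1 := (hΦ.tendsto_yosida h.left x).mono_left
      (nhdsWithin_le_nhds (s := Set.Ioi 0))
    refine mem_closure_of_tendsto h1 ?_
    filter_upwards [(eventually_small C l).filter_mono nhdsWithin_le_nhds,
      self_mem_nhdsWithin] with t ht ht0
    obtain ⟨w, a, b, p, q, hF, hw, -⟩ := h.yosida_tuple (ne_of_gt ht0) ht.1
      (mem_graph_of_domain hx)
    have h2 := hΦ.yosida_apply (ne_of_gt ht0) hF.hS
    rw [← hw] at h2
    rw [h2]
    exact ⟨(exists_domain_of_graph hF.hS).1, (exists_domain_of_graph hF.hT).1⟩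
  exact dense_closure.1 (h.right.dense_domain.mono hsub)

theorem StronglyAnticommuting.isSelfAdjointRegular_add [CompleteSpace E]
    (h : StronglyAnticommuting B S T C l) (hC : 0 < C) : IsSelfAdjointRegular B (S + T) := by
  have hm : 8 * C + 1 ≤ (8 * C + 1) ^ 2 := by nlinarith
  refine isSelfAdjointRegular_of_surjective B h.dense_domain_add
    (fun _ _ _ _ => h.left.inner_add h.right) (m := 8 * C + 1) (by positivity) (fun v => ?_)
    (fun v => ?_)
  · obtain ⟨u, a, b, ha, hb, hv, -⟩ := h.exists_solution hC hm v
    exact ⟨u, a + b, mem_graph_add_iff.2 ⟨a, b, ha, hb, rfl⟩, hv⟩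
  · obtain ⟨u, a, b, ha, hb, hv, -⟩ := h.exists_solution hC (m := -(8 * C + 1))
      (by rwa [neg_sq]) v
    refine ⟨u, a + b, mem_graph_add_iff.2 ⟨a, b, ha, hb, rfl⟩, ?_⟩
    rwa [neg_smul, sub_neg_eq_add] at hv

/-- T is bounded relative to S + T: by uniqueness u is the solution found in `exists_solution`,
whose bound on Tu applies. -/
theorem StronglyAnticommuting.norm_le_add [CompleteSpace E]
    (h : StronglyAnticommuting B S T C l) (hC : 0 < C) {u a b : E} (ha : (u, a) ∈ S.graph)
    (hb : (u, b) ∈ T.graph) :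
    ‖b‖ ≤ 2 * (‖a + b‖ + (8 * C + 1) * ‖u‖) := by
  have hm : 8 * C + 1 ≤ (8 * C + 1) ^ 2 := by nlinarith
  obtain ⟨u', a', b', ha', hb', hv, -, hn, -⟩ :=
    h.exists_solution hC hm (a + b - (8 * C + 1) • Complex.I • u)
  have h0 : ‖u - u'‖ = 0 := by
    have h1 := (h.isSelfAdjointRegular_add hC).norm_le (-((8 * C + 1 : ℝ) : ℂ) * Complex.I)
      (mem_graph_add_iff.2 ⟨_, _, graph_sub ha ha', graph_sub hb hb', rfl⟩)
    have h2 : a - a' + (b - b') + (-((8 * C + 1 : ℝ) : ℂ) * Complex.I) • (u - u') = 0 := by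
      rw [mul_smul, neg_smul, Complex.coe_smul, smul_sub, smul_sub]
      linear_combination (norm := module) (-1 : ℝ) • hv
    rw [h2, norm_zero] at h1
    have h3 : 0 < |(-((8 * C + 1 : ℝ) : ℂ) * Complex.I).im| := by
      simp only [Complex.mul_I_im, Complex.neg_re, Complex.ofReal_re, abs_neg]
      positivity
    exact le_antisymm (nonpos_of_mul_nonpos_right h1 h3) (norm_nonneg _)
  rw [norm_eq_zero, sub_eq_zero] at h0
  subst h0
  obtain rfl := graph_unique hb hb'
  refine hn.trans ?_
  have h4 := norm_sub_le (a + b) ((8 * C + 1) • Complex.I • u)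
  rw [norm_smul_I_smul, abs_of_pos (by positivity)] at h4
  linarith

end Sum

/-! ### Rescaling the pair by r. -/

section Scaling

variable {B E : Type*} [NonUnitalCStarAlgebra B] [PartialOrder B] [StarOrderedRing B]
  [NormedAddCommGroup E] [NormedSpace ℂ E] [SMul B E] [CStarModule B E] [CompleteSpace E]
  {S T D : E →ₗ.[ℂ] E} {C l : ℝ}

theorem IsSelfAdjointRegular.smul (hD : IsSelfAdjointRegular B D) {r : ℝ} (hr : r ≠ 0) :
    IsSelfAdjointRegular B ((r : ℂ) • D) := by
  have hr' : (r : ℂ) ≠ 0 := by exact_mod_cast hr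
  have key (s : ℝ) (hs : s ≠ 0) (v : E) :
      ∃ x y, (x, y) ∈ ((r : ℂ) • D).graph ∧ y + s • Complex.I • x = v := by
    obtain ⟨x, y, hxy, hv⟩ := hD.surjective (w := ((r⁻¹ * s : ℝ) : ℂ) * Complex.I)
      (by simp [hr, hs]) ((r : ℂ)⁻¹ • v)
    refine ⟨x, _, mem_graph_smul_iff.2 ⟨y, hxy, rfl⟩, ?_⟩
    rw [← smul_inv_smul₀ hr' v, ← hv, smul_add, ← Complex.coe_smul, smul_smul, smul_smul]
    congr 2
    push_cast
    field_simp
  refine isSelfAdjointRegular_of_surjective B hD.dense_domain ?_ one_ne_zero (fun v => ?_)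
    (key 1 one_ne_zero)
  · intro x y x' y' h h'
    obtain ⟨a, ha, rfl⟩ := mem_graph_smul_iff.1 h
    obtain ⟨a', ha', rfl⟩ := mem_graph_smul_iff.1 h'
    simp [hD.inner_graph ha ha']
  · obtain ⟨x, y, hxy, hv⟩ := key (-1) (by norm_num) v
    exact ⟨x, y, hxy, by rw [← hv]; module⟩

/-- The square of the anticommutator scales by r⁴, while ⟨Su, Su⟩ and ⟨Tu, Tu⟩ scale only by r²,
which leaves r²C. For the term ⟨u, u⟩ one uses r⁴ ≤ r². -/
theorem StronglyAnticommuting.smul (h : StronglyAnticommuting B S T C l) (hC : 0 < C) {r : ℝ}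
    (hr : 0 < r) (hr1 : r ≤ 1) :
    StronglyAnticommuting B ((r : ℂ) • S) ((r : ℂ) • T) (r ^ 2 * C) (r * l) where
  left := h.left.smul hr.ne'
  right := h.right.smul hr.ne'
  estimate u a b p q hF f hf := by
    obtain ⟨a, ha, rfl⟩ := mem_graph_smul_iff.1 hF.hS
    obtain ⟨b, hb, rfl⟩ := mem_graph_smul_iff.1 hF.hT
    obtain ⟨p, hp, rfl⟩ := mem_graph_smul_iff.1 hF.hTS
    obtain ⟨q, hq, rfl⟩ := mem_graph_smul_iff.1 hF.hST
    have hr' : (r : ℂ) ≠ 0 := by exact_mod_cast hr.ne'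
    have hp' := graph_smul (r : ℂ)⁻¹ hp
    have hq' := graph_smul (r : ℂ)⁻¹ hq
    rw [inv_smul_smul₀ hr'] at hp' hq'
    have h1 := h.estimate _ _ _ _ _ ⟨ha, hb, hp', hq'⟩ f hf
    set p' := (r : ℂ)⁻¹ • p
    set q' := (r : ℂ)⁻¹ • q
    have ep : p = r • p' := by rw [← Complex.coe_smul, smul_inv_smul₀ hr']
    have eq : q = r • q' := by rw [← Complex.coe_smul, smul_inv_smul₀ hr']
    rw [ep, eq]
    simp only [Complex.coe_smul, ← smul_add]
    simp only [form_smul_left, form_smul_right]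
    have h2 := mul_le_mul_of_nonneg_left h1 (show 0 ≤ r ^ 4 by positivity)
    have h3 : r ^ 2 ≤ 1 := pow_le_one₀ hr.le hr1
    have h4 := mul_le_mul_of_nonneg_right h3
      (show 0 ≤ r ^ 2 * C * form f u u from mul_nonneg (by positivity) (hf.form_self_nonneg u))
    linarith
  resolvent m hm x y hxy := by
    obtain ⟨y, hy, rfl⟩ := mem_graph_smul_iff.1 hxy
    have hr' : (r : ℂ) ≠ 0 := by exact_mod_cast hr.ne'
    obtain ⟨u, a, b, p, q, hF, rfl, rfl⟩ := h.resolvent (r⁻¹ * m) (by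
      rw [abs_mul, abs_inv, abs_of_pos hr, inv_mul_eq_div, le_div_iff₀' hr]
      exact hm) x y hy
    refine ⟨(r : ℂ)⁻¹ • u, a, b, (r : ℂ) • p, (r : ℂ) • q, ⟨?_, ?_, ?_, ?_⟩, ?_, ?_⟩
    · exact mem_graph_smul_iff.2 ⟨_, graph_smul _ hF.hS, smul_inv_smul₀ hr' _⟩
    · exact mem_graph_smul_iff.2 ⟨_, graph_smul _ hF.hT, smul_inv_smul₀ hr' _⟩
    · exact mem_graph_smul_iff.2 ⟨_, hF.hTS, rfl⟩
    · exact mem_graph_smul_iff.2 ⟨_, hF.hST, rfl⟩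
    · rw [← Complex.coe_smul, ← Complex.coe_smul, smul_smul, smul_smul, smul_smul]
      congr 2
      push_cast
      ring
    · rw [smul_add, ← Complex.coe_smul, ← Complex.coe_smul, smul_smul, smul_smul, smul_smul]
      congr 2
      push_cast
      field_simp

theorem StronglyAnticommuting.isWeaklyAnticommuting (h : StronglyAnticommuting B S T C l)
    (hC : 0 < C) (hl : 0 < l) : IsWeaklyAnticommuting B S T where
  left := h.left
  right := h.right
  form_estimate := by
    refine ⟨C, C, C, hC, hC, hC, fun x hS hT hST hTS => ?_⟩
    have sa (x : E) : IsSelfAdjoint (inner B x x) := CStarModule.isSelfAdjoint_inner_self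
    have sa' (x : E) : IsSelfAdjoint (C • inner B x x) := (IsSelfAdjoint.all C).smul (sa x)
    refine le_of_posFunctional ((((sa' _).add (sa' _)).add (sa' _)).sub (sa _)) fun f hf => ?_
    have h1 := h.estimate _ _ _ _ _ ⟨mem_graph_of_domain hS, mem_graph_of_domain hT,
      mem_graph_of_domain hST, mem_graph_of_domain hTS⟩ f hf
    rw [add_comm (S _)]
    simp only [form] at h1
    simp only [map_add, map_smul, smul_eq_mul]
    linarith
  core := by
    refine ⟨T.domain, ?_, l, hl, fun μ hμ x hx => ?_⟩
    · have h1 := T.closureHasCore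
      have hcl : T.IsClosed := h.right.isClosed_graph
      have h2 : T.closure = T := by
        refine LinearPMap.eq_of_eq_graph ?_
        rw [← hcl.isClosable.graph_closure_eq_closure_graph]
        exact hcl.submodule_topologicalClosure_eq
      rwa [h2] at h1
    · obtain ⟨u, a, b, p, q, hF, hu, -⟩ := h.resolvent μ hμ _ _ (mem_graph_of_domain hx)
      have h0 : ‖(x : E) - u‖ = 0 := by
        have h1 := h.left.norm_le (μ * Complex.I) (graph_sub (S.mem_graph x) hF.hS)
        have h2 : S x - a + (μ * Complex.I) • ((x : E) - u) = 0 := by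
          rw [smul_sub]
          rw [mul_smul _ _ u, Complex.coe_smul]
          linear_combination (norm := module) (1 : ℝ) • hu
        rw [h2, norm_zero] at h1
        have h3 : 0 < |(μ * Complex.I : ℂ).im| := by
          simpa using hl.trans_le hμ
        exact le_antisymm (nonpos_of_mul_nonpos_right h1 h3) (norm_nonneg _)
      rw [norm_eq_zero, sub_eq_zero] at h0
      obtain ⟨h1, h1'⟩ := exists_domain_of_graph hF.hS
      obtain ⟨h2, h2'⟩ := exists_domain_of_graph hF.hT
      rw [h0]
      refine ⟨h1, h2, ?_, ?_⟩
      · rw [h1']; exact (exists_domain_of_graph hF.hTS).1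
      · rw [h2']; exact (exists_domain_of_graph hF.hST).1

end Scaling

end HilbertMod

namespace HilbertMod

/-! ### An operator inequality by monotonicity of the square root. -/

section Order

/-- Self-adjointness gives (PZ)² = PZZ*P ≤ ‖Z‖²P². Taking square roots yields |PZ| ≤ ‖Z‖P, and PZ ≥
-|PZ|. -/
theorem neg_norm_smul_le_mul {A : Type*} [CStarAlgebra A] [PartialOrder A] [StarOrderedRing A]
    {P Z : A} (hP : 0 ≤ P) (hV : IsSelfAdjoint (P * Z)) : -(‖Z‖ • P) ≤ P * Z := by
  have hPs : star P = P := (IsSelfAdjoint.of_nonneg hP).star_eq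
  have hV' : star Z * P = P * Z := by simpa [hPs] using hV.star_eq
  have h1 : star (P * Z) * (P * Z) ≤ (‖Z‖ • P) * (‖Z‖ • P) := by
    have h2 := CStarAlgebra.star_left_conjugate_le_norm_smul (a := P) (b := Z * star Z)
    have h3 : star (P * Z) * (P * Z) = star P * (Z * star Z) * P := by
      rw [hV.star_eq, hPs]
      nth_rewrite 2 [← hV']
      simp only [mul_assoc]
    rw [h3]
    refine h2.trans (le_of_eq ?_)
    rw [CStarRing.norm_self_mul_star, hPs, smul_mul_smul_comm]
  have h2 := CFC.sqrt_le_sqrt _ _ h1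
  rw [CFC.sqrt_mul_self (‖Z‖ • P) (smul_nonneg (norm_nonneg _) hP)] at h2
  have h3 : 0 ≤ CFC.abs (P * Z) + P * Z := by
    rw [CFC.abs_add_self (P * Z)]
    exact smul_nonneg (by norm_num) (CFC.posPart_nonneg _)
  have h4 : CFC.abs (P * Z) ≤ ‖Z‖ • P := h2
  calc -(‖Z‖ • P) ≤ -CFC.abs (P * Z) := neg_le_neg h4
    _ ≤ P * Z := by rw [neg_le_iff_add_nonneg']; exact h3

variable {B E : Type*} [NonUnitalCStarAlgebra B] [PartialOrder B] [StarOrderedRing B]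
  [NormedAddCommGroup E] [NormedSpace ℂ E] [CompleteSpace E] [SMul B E] [CStarModule B E]

/-- If `PZ` is self-adjoint and `P ≥ 0`, then `PZ ≥ -cP` for every bound `c` of `Z`. -/
theorem form_mul_ge {Q Z : Adj B E} (hV : IsSelfAdjoint (star Q * Q * Z)) {c : ℝ} (hc : 0 ≤ c)
    (hZ : ∀ x, ‖Z.1 x‖ ≤ c * ‖x‖) {f : B →L[ℝ] ℝ} (hf : IsPosFunctional f) (x : E) :
    -(c * form f x ((star Q * Q).1 x)) ≤ form f x ((star Q * Q * Z).1 x) := by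
  let _ : PartialOrder (Adj B E) := CStarAlgebra.spectralOrder _
  have _ : StarOrderedRing (Adj B E) := CStarAlgebra.spectralOrderedRing _
  have h1 := neg_norm_smul_le_mul (star_mul_self_nonneg Q) hV
  have h2 : 0 ≤ star Q * Q * Z + ‖Z‖ • (star Q * Q) := neg_le_iff_add_nonneg.1 h1
  obtain ⟨b, hb⟩ := CStarAlgebra.nonneg_iff_eq_star_mul_self.1 h2
  have h3 : 0 ≤ form f x ((star Q * Q * Z + ‖Z‖ • (star Q * Q)).1 x) := by
    rw [hb, Adj.mul_apply, form_star_right]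
    exact hf.form_self_nonneg _
  rw [Adj.add_apply, Adj.real_smul_apply, form_add_right, form_smul_right] at h3
  have h4 : ‖Z‖ ≤ c := Z.1.opNorm_le_bound hc hZ
  have h5 : 0 ≤ form f x ((star Q * Q).1 x) := by
    rw [Adj.mul_apply, form_star_right]; exact hf.form_self_nonneg _
  have h6 := mul_le_mul_of_nonneg_right h4 h5
  linarith

end Order

/-! ### Adjointability of bounded compositions with T. -/

section Adjoints

variable {B E : Type*} [NonUnitalCStarAlgebra B] [PartialOrder B] [StarOrderedRing B]
  [NormedAddCommGroup E] [NormedSpace ℂ E] [CompleteSpace E] [SMul B E] [CStarModule B E]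

/-- A bounded operator with a densely defined adjoint is adjointable. -/
theorem exists_adj_of_dense {M : Submodule ℂ E} (hM : Dense (M : Set E)) (A : E →L[ℂ] E)
    (g : M →ₗ[ℂ] E) (h : ∀ x (y : M), inner B (A x) (y : E) = inner B x (g y)) :
    ∃ A' : Adj B E, A'.1 = A := by
  have hd : DenseRange M.subtype := by
    rw [DenseRange, Submodule.coe_subtype, Subtype.range_coe]; exact hM
  have hg (y : M) : ‖g y‖ ≤ ‖A‖ * ‖M.subtype y‖ := by
    rcases (norm_nonneg (g y)).eq_or_lt with h0 | h0
    · rw [← h0]; positivity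
    · refine le_of_mul_le_mul_right ?_ h0
      rw [← sq, CStarModule.norm_sq_eq (A := B), ← h]
      refine (CStarModule.norm_inner_le E).trans ?_
      have := A.le_opNorm (g y)
      calc ‖A (g y)‖ * ‖(y : E)‖ ≤ ‖A‖ * ‖g y‖ * ‖(y : E)‖ := by gcongr
        _ = _ := by rw [Submodule.subtype_apply]; ring
  refine ⟨⟨A, g.extendOfNorm M.subtype, fun x y => ?_⟩, rfl⟩
  revert y
  refine hd.induction (fun y hy => ?_) (isClosed_eq ?_ ?_)
  · obtain ⟨y, rfl⟩ := hy
    rw [LinearMap.extendOfNorm_eq hd ⟨‖A‖, hg⟩ y]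
    exact h x y
  · exact CStarModule.continuous_inner.comp (continuous_const.prodMk continuous_id)
  · exact CStarModule.continuous_inner.comp (continuous_const.prodMk
      (g.extendOfNorm M.subtype).continuous)

/-- On a Hilbert module boundedness of TX does not give an adjoint, but X*T is one on the dense
domain of T and extends. -/
theorem IsSelfAdjointRegular.exists_adj_comp {T : E →ₗ.[ℂ] E} (hT : IsSelfAdjointRegular B T)
    (X : Adj B E) {c : ℝ} (h : ∀ x, ∃ y, (X.1 x, y) ∈ T.graph ∧ ‖y‖ ≤ c * ‖x‖) :
    ∃ Q : Adj B E, ∀ x, (X.1 x, Q.1 x) ∈ T.graph := by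
  choose q hq hn using h
  let A : E →ₗ[ℂ] E :=
    { toFun := q
      map_add' := fun x y => graph_unique (hq (x + y)) (by
        rw [map_add]; exact graph_add (hq x) (hq y))
      map_smul' := fun a x => graph_unique (hq (a • x)) (by
        rw [map_smul]; exact graph_smul a (hq x)) }
  obtain ⟨Q, hQ⟩ := exists_adj_of_dense (B := B) hT.dense_domain (A.mkContinuous c hn)
    ((star X).1.toLinearMap.comp T.toFun) (fun x y => by
      change inner B (q x) (y : E) = inner B x ((star X).1 (T y))
      rw [hT.inner_graph (hq x) (T.mem_graph y), inner_star_right])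
  refine ⟨Q, fun x => ?_⟩
  rw [hQ]
  exact hq x

end Adjoints

end HilbertMod

namespace HilbertMod

/-! ### The scalar functions used in the final estimates. -/

section Functions

/-- The function `t ↦ 1 / (s ^ 2 + t ^ 2)` for `1 ≤ s`. -/
noncomputable def oneQuot : ℝ → ℝ →ᵇ ℂ :=
  quotFun (fun _ => 1) continuous_const fun t => by rw [abs_one]; nlinarith [sq_nonneg t]

/-- The function `t ↦ t ^ 2 / (s ^ 2 + t ^ 2)` for `1 ≤ s`. -/
noncomputable def sqQuot : ℝ → ℝ →ᵇ ℂ :=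
  quotFun (fun t => t ^ 2) (by fun_prop) fun t => by rw [abs_of_nonneg (sq_nonneg t)]; linarith

theorem abs_mul_sqrt_le_one_add_sq (t : ℝ) : |t * Real.sqrt (1 + t ^ 2)| ≤ 1 + t ^ 2 := by
  rw [abs_mul, abs_of_nonneg (Real.sqrt_nonneg _)]
  have h : |t| ≤ Real.sqrt (1 + t ^ 2) := Real.abs_le_sqrt (by linarith)
  calc |t| * Real.sqrt (1 + t ^ 2) ≤ Real.sqrt (1 + t ^ 2) * Real.sqrt (1 + t ^ 2) := by gcongr
    _ = _ := Real.mul_self_sqrt (by positivity)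

/-- The function `t ↦ t√(1 + t ^ 2) / (s ^ 2 + t ^ 2)` for `1 ≤ s`. -/
noncomputable def idSqrtQuot : ℝ → ℝ →ᵇ ℂ :=
  quotFun (fun t => t * Real.sqrt (1 + t ^ 2)) (by fun_prop) abs_mul_sqrt_le_one_add_sq

theorem one_le_sqrt (t : ℝ) : 1 ≤ Real.sqrt (1 + t ^ 2) := by
  rw [Real.one_le_sqrt]; nlinarith [sq_nonneg t]

theorem abs_inv_sqrt_le (t : ℝ) : |(Real.sqrt (1 + t ^ 2))⁻¹| ≤ 1 := by
  rw [abs_of_nonneg (by positivity)]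
  exact inv_le_one_of_one_le₀ (one_le_sqrt t)

theorem abs_mul_inv_sqrt_le (t : ℝ) : |t * (Real.sqrt (1 + t ^ 2))⁻¹| ≤ 1 := by
  rw [abs_mul, abs_of_nonneg (a := (Real.sqrt (1 + t ^ 2))⁻¹) (by positivity), ← div_eq_mul_inv,
    div_le_one (zero_lt_one.trans_le (one_le_sqrt t))]
  exact Real.abs_le_sqrt (by linarith)

theorem sqrt_one_add_sq_ne_zero (t : ℝ) : Real.sqrt (1 + t ^ 2) ≠ 0 :=
  (zero_lt_one.trans_le (one_le_sqrt t)).ne'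

/-- The function `t ↦ 1 / √(1 + t ^ 2)`. -/
noncomputable def invSqrt : ℝ →ᵇ ℂ :=
  bddFun (fun t => (((Real.sqrt (1 + t ^ 2))⁻¹ : ℝ) : ℂ))
    (Complex.continuous_ofReal.comp (Continuous.inv₀ (by fun_prop) sqrt_one_add_sq_ne_zero))
    (C := 1) fun t => by rw [Complex.norm_real]; exact abs_inv_sqrt_le t

/-- The function `t ↦ t / √(1 + t ^ 2)`. -/
noncomputable def idInvSqrt : ℝ →ᵇ ℂ :=
  bddFun (fun t => ((t * (Real.sqrt (1 + t ^ 2))⁻¹ : ℝ) : ℂ))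
    (Complex.continuous_ofReal.comp
      (continuous_id.mul (Continuous.inv₀ (by fun_prop) sqrt_one_add_sq_ne_zero)))
    (C := 1) fun t => by rw [Complex.norm_real]; exact abs_mul_inv_sqrt_le t

theorem star_eq_self_of_real {f : ℝ →ᵇ ℂ} {p : ℝ → ℝ} (h : ∀ t, f t = (p t : ℂ)) : star f = f := by
  ext t
  rw [BoundedContinuousFunction.star_apply, h, Complex.star_def, Complex.conj_ofReal]

/-- The function `t ↦ (t + im)⁻¹`. -/
noncomputable def imRes (m : ℝ) (hm : m ≠ 0) : ℝ →ᵇ ℂ :=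
  resFun (m * Complex.I) (by simpa using hm)

theorem norm_imRes_le {m : ℝ} (hm : m ≠ 0) (t : ℝ) : ‖imRes m hm t‖ ≤ |m|⁻¹ := by
  rw [imRes, resFun_apply, norm_inv]
  refine inv_anti₀ (abs_pos.2 hm) ?_
  simpa using Complex.abs_im_le_norm ((t : ℂ) + m * Complex.I)

theorem idQuot_eq {s : ℝ} (hs : 1 ≤ s) (h₁ : s ≠ 0) (h₂ : -s ≠ 0) :
    idQuot s = (2⁻¹ : ℂ) • (imRes s h₁ + imRes (-s) h₂) := by
  ext t
  have e1 := ofReal_add_ne_zero (z := s * Complex.I) (by simpa using h₁) t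
  have e2 := ofReal_add_ne_zero (z := ((-s : ℝ) : ℂ) * Complex.I) (by simpa using h₁) t
  have e3 : ((s : ℂ) ^ 2 + (t : ℂ) ^ 2) ≠ 0 := by
    have : s ^ 2 + t ^ 2 ≠ 0 := by positivity
    exact_mod_cast this
  rw [idQuot_apply hs, BoundedContinuousFunction.smul_apply, BoundedContinuousFunction.add_apply,
    imRes, imRes, resFun_apply, resFun_apply]
  push_cast at *
  simp only [neg_mul, ← sub_eq_add_neg] at *
  have e4 : ((s : ℂ) ^ 2 + (t : ℂ) ^ 2) = (t + s * Complex.I) * (t - s * Complex.I) := by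
    linear_combination (s : ℂ) ^ 2 * Complex.I_sq
  rw [e4, smul_eq_mul]
  field_simp
  ring

end Functions

/-! ### Anticommutators of T with functions of S, and the bound for χ(S)χ(D). -/

section Estimates

variable {B E : Type*} [NonUnitalCStarAlgebra B] [PartialOrder B] [StarOrderedRing B]
  [NormedAddCommGroup E] [NormedSpace ℂ E] [CompleteSpace E] [SMul B E] [CStarModule B E]
  {S T : E →ₗ.[ℂ] E} {Φ Ψ : (ℝ →ᵇ ℂ) →⋆ₐ[ℂ] Adj B E}

/-- With R(m) = (S + im)⁻¹ one has TR(m)u + R(-m)Tu = R(-m)[S,T]R(m)u. The left resolvent gives one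
factor 1/|m|. The form estimate gives the other, because R(m)u, SR(m)u = R(m)Su and TR(m)u =
R(-m)([S,T]R(m)u - Tu) all carry it; γ ≤ 1/2 absorbs the anticommutator on the right. -/
theorem StronglyAnticommuting.resolvent_commutator {γ l : ℝ}
    (h : StronglyAnticommuting B S T (γ ^ 2) l) (hγ : 0 < γ) (hγ1 : γ ≤ 1 / 2)
    (hΦ : IsFunctionalCalculus S Φ) {m : ℝ} (hm : m ≠ 0) (hm' : -m ≠ 0) (hlm : l ≤ |m|)
    (hm1 : 1 ≤ |m|) {u a₀ b₀ : E} (ha : (u, a₀) ∈ S.graph) (hb : (u, b₀) ∈ T.graph) :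
    ∃ b, ((Φ (imRes m hm)).1 u, b) ∈ T.graph ∧
      ‖b + (Φ (imRes (-m) hm')).1 b₀‖ ≤ 2 * γ * (m ^ 2)⁻¹ * (‖u‖ + ‖a₀‖ + ‖b₀‖) := by
  obtain ⟨w, a, b, p, q, hF, hu, hv⟩ := h.resolvent m hlm u b₀ hb
  have hr : IsResolvent S (m * Complex.I) (Φ (imRes m hm)) := hΦ.isResolvent _
  have hr' : IsResolvent S (((-m : ℝ) : ℂ) * Complex.I) (Φ (imRes (-m) hm')) := hΦ.isResolvent _
  set R := Φ (imRes m hm)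
  set R' := Φ (imRes (-m) hm')
  have hR (x : E) : ‖R.1 x‖ ≤ |m|⁻¹ * ‖x‖ := norm_calc_le Φ (norm_imRes_le hm) x
  have hR' (x : E) : ‖R'.1 x‖ ≤ |m|⁻¹ * ‖x‖ := by
    have := norm_calc_le Φ (norm_imRes_le hm') x
    rwa [abs_neg] at this
  have ew : R.1 u = w := by
    have := hr.apply_graph hF.hS
    rwa [mul_smul, Complex.coe_smul, ← hu] at this
  have ea : R.1 a₀ = a := by
    have := hr.apply_graph ha
    rw [map_add, map_smul, ew, mul_smul, Complex.coe_smul] at this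
    rw [eq_sub_of_add_eq this, hu]
    abel
  have eb : b = R'.1 (p + q - b₀) := by
    have := hr'.apply_graph hF.hST
    rw [← this, hv, mul_smul, Complex.coe_smul]
    congr 1
    module
  refine ⟨b, ew ▸ hF.hT, ?_⟩
  have e1 : b + R'.1 b₀ = R'.1 (p + q) := by rw [eb, map_sub, sub_add_cancel]
  rw [e1]
  set s := |m|⁻¹ with hs
  have hs0 : 0 < s := inv_pos.2 (abs_pos.2 hm)
  have hs1 : s ≤ 1 := inv_le_one_of_one_le₀ hm1
  have hest : ‖p + q‖ ^ 2 ≤ γ ^ 2 * ‖w‖ ^ 2 + γ ^ 2 * ‖a‖ ^ 2 + γ ^ 2 * ‖b‖ ^ 2 :=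
    norm_sq_le_of_form B (sq_nonneg _) (sq_nonneg _) (sq_nonneg _) fun f hf => by
      linarith [h.estimate _ _ _ _ _ hF f hf]
  set k := ‖p + q‖ with hk
  set N := ‖u‖ + ‖a₀‖ + ‖b₀‖ with hN
  have hk0 : 0 ≤ k := norm_nonneg _
  have nw : ‖w‖ ≤ s * ‖u‖ := ew ▸ hR u
  have na : ‖a‖ ≤ s * ‖a₀‖ := ea ▸ hR a₀
  have nb : ‖b‖ ≤ s * (k + ‖b₀‖) := by
    conv_lhs => rw [eb]
    refine (hR' _).trans ?_
    gcongr
    exact norm_sub_le _ _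
  have hkN : k ≤ 2 * γ * s * N := by
    have u0 := norm_nonneg u
    have a0 := norm_nonneg a₀
    have b0 := norm_nonneg b₀
    have f1 : ‖w‖ ^ 2 ≤ s ^ 2 * ‖u‖ ^ 2 := by rw [← mul_pow]; gcongr
    have f2 : ‖a‖ ^ 2 ≤ s ^ 2 * ‖a₀‖ ^ 2 := by rw [← mul_pow]; gcongr
    have f3 : ‖b‖ ^ 2 ≤ s ^ 2 * (2 * k ^ 2 + 2 * ‖b₀‖ ^ 2) := by
      refine (pow_le_pow_left₀ (norm_nonneg _) nb 2).trans ?_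
      rw [mul_pow]
      gcongr
      nlinarith [sq_nonneg (k - ‖b₀‖)]
    have f4 : ‖u‖ ^ 2 + ‖a₀‖ ^ 2 + 2 * ‖b₀‖ ^ 2 ≤ 2 * N ^ 2 := by
      rw [hN]; nlinarith [mul_nonneg u0 a0, mul_nonneg u0 b0, mul_nonneg a0 b0]
    have f5 : γ ^ 2 * s ^ 2 ≤ 1 / 4 := by
      have g1 : γ ^ 2 ≤ 1 / 4 := by nlinarith
      have g2 : s ^ 2 ≤ 1 := pow_le_one₀ hs0.le hs1
      nlinarith [sq_nonneg γ]
    have f6 := mul_le_mul_of_nonneg_right f5 (sq_nonneg k)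
    have f7 := mul_le_mul_of_nonneg_left f4 (show 0 ≤ γ ^ 2 * s ^ 2 by positivity)
    have f8 := mul_le_mul_of_nonneg_left (add_le_add (add_le_add f1 f2) f3) (sq_nonneg γ)
    refine le_of_sq_le_sq ?_ (by positivity)
    have : (2 * γ * s * N) ^ 2 = 4 * (γ ^ 2 * s ^ 2 * N ^ 2) := by ring
    rw [this]
    linarith
  have hs2 : (m ^ 2)⁻¹ = s * s := by rw [hs, ← sq, inv_pow, sq_abs]
  calc ‖R'.1 (p + q)‖ ≤ s * k := hR' _
    _ ≤ s * (2 * γ * s * N) := by gcongr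
    _ = _ := by rw [hs2]; ring

/-- S(s² + S²)⁻¹ is the mean of the resolvents at is and -is, which T nearly interchanges. -/
theorem StronglyAnticommuting.idQuot_commutator {γ l : ℝ}
    (h : StronglyAnticommuting B S T (γ ^ 2) l) (hγ : 0 < γ) (hγ1 : γ ≤ 1 / 2) (hl : l ≤ 1)
    (hΦ : IsFunctionalCalculus S Φ) {s : ℝ} (hs : 1 ≤ s) {u a₀ b₀ : E} (ha : (u, a₀) ∈ S.graph)
    (hb : (u, b₀) ∈ T.graph) :
    ∃ b, ((Φ (idQuot s)).1 u, b) ∈ T.graph ∧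
      ‖b + (Φ (idQuot s)).1 b₀‖ ≤ 2 * γ * (s ^ 2)⁻¹ * (‖u‖ + ‖a₀‖ + ‖b₀‖) := by
  have h₁ : s ≠ 0 := by positivity
  have h₂ : -s ≠ 0 := neg_ne_zero.2 h₁
  have h₃ : - -s ≠ 0 := neg_ne_zero.2 h₂
  have habs : |s| = s := abs_of_pos (by positivity)
  obtain ⟨b, hb1, hn⟩ := h.resolvent_commutator hγ hγ1 hΦ h₁ h₂ (by linarith) (by linarith) ha hb
  obtain ⟨b', hb1', hn'⟩ := h.resolvent_commutator hγ hγ1 hΦ h₂ h₃ (by rw [abs_neg]; linarith)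
    (by rw [abs_neg]; linarith) ha hb
  simp only [neg_neg, neg_sq] at hn'
  have hX (x : E) : (Φ (idQuot s)).1 x =
      (2⁻¹ : ℂ) • ((Φ (imRes s h₁)).1 x + (Φ (imRes (-s) h₂)).1 x) := by
    rw [idQuot_eq hs h₁ h₂, map_smul, map_add]; rfl
  refine ⟨(2⁻¹ : ℂ) • (b + b'), ?_, ?_⟩
  · rw [hX]
    exact graph_smul _ (graph_add hb1 hb1')
  · rw [hX, ← smul_add, add_comm _ ((Φ (imRes (-s) h₂)).1 b₀),
      add_add_add_comm, norm_smul]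
    have e : ‖(2⁻¹ : ℂ)‖ = 2⁻¹ := by simp
    rw [e]
    have := norm_add_le (b + (Φ (imRes (-s) h₂)).1 b₀) (b' + (Φ (imRes s h₁)).1 b₀)
    linarith

/-- Split DP = SP + TP. The S-part gives the form of S²(s² + S²)⁻¹, which is nonnegative. Twice the
T-part is ⟨x, PZx⟩ with Z = (TX + XT)P, where PZ is self-adjoint and Z has norm at most 4γ(1 +
2K)/s², so `form_mul_ge` applies. -/
theorem StronglyAnticommuting.form_idQuot_ge {γ l K : ℝ}
    (h : StronglyAnticommuting B S T (γ ^ 2) l) (hγ : 0 < γ) (hγ1 : γ ≤ 1 / 2) (hl : l ≤ 1)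
    (hK : 0 ≤ K)
    (hTK : ∀ u a b, (u, a) ∈ S.graph → (u, b) ∈ T.graph → ‖b‖ ≤ K * (‖a + b‖ + ‖u‖))
    (hΦ : IsFunctionalCalculus S Φ) (hΨ : IsFunctionalCalculus (S + T) Ψ) {φ : B →L[ℝ] ℝ}
    (hφ : IsPosFunctional φ) {s : ℝ} (hs : 1 ≤ s) (x : E) :
    -(2 * γ * (1 + 2 * K) * form φ x ((Ψ invSqrt).1 x) * (s ^ 2)⁻¹) ≤
      form φ ((Ψ idInvSqrt).1 x) ((Φ (idQuot s)).1 ((Ψ invSqrt).1 x)) := by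
  have hgr (x : E) : ((Ψ invSqrt).1 x, (Ψ idInvSqrt).1 x) ∈ (S + T).graph :=
    hΨ.mem_graph (fun t => by simp [invSqrt, idInvSqrt]) x
  have hn1 (x : E) : ‖(Ψ invSqrt).1 x‖ ≤ ‖x‖ := by
    simpa using norm_calc_le Ψ (f := invSqrt) (C := 1)
      (fun t => by rw [invSqrt, bddFun_apply, Complex.norm_real]; exact abs_inv_sqrt_le t) x
  have hn2 (x : E) : ‖(Ψ idInvSqrt).1 x‖ ≤ ‖x‖ := by
    simpa using norm_calc_le Ψ (f := idInvSqrt) (C := 1)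
      (fun t => by rw [idInvSqrt, bddFun_apply, Complex.norm_real]; exact abs_mul_inv_sqrt_le t) x
  obtain ⟨Q, hQ⟩ := exists_calc_eq_star_mul_self Ψ (f := invSqrt)
    (p := fun t => (Real.sqrt (1 + t ^ 2))⁻¹) (fun t => rfl) (fun t => by positivity)
  have hX : star (Φ (idQuot s)) = Φ (idQuot s) := by
    rw [← map_star, star_eq_self_of_real (idQuot_apply hs)]
  have hP : star (Ψ invSqrt) = Ψ invSqrt := by
    rw [← map_star, star_eq_self_of_real (fun t => rfl)]
  set X := Φ (idQuot s) with hXdef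
  set P := Ψ invSqrt
  set δ := (s ^ 2)⁻¹
  have hδ : 0 ≤ δ := by positivity
  choose a b ha hb hab using fun x => mem_graph_add_iff.1 (hgr x)
  have hnb (x : E) : ‖b x‖ ≤ 2 * K * ‖x‖ := by
    have h1 := hTK _ _ _ (ha x) (hb x)
    rw [hab] at h1
    have h2 := mul_le_mul_of_nonneg_left (add_le_add (hn2 x) (hn1 x)) hK
    linarith
  have hna (x : E) : ‖a x‖ ≤ (1 + 2 * K) * ‖x‖ := by
    have h1 : a x = (Ψ idInvSqrt).1 x - b x := by rw [← hab]; abel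
    have h2 := norm_sub_le ((Ψ idInvSqrt).1 x) (b x)
    rw [← h1] at h2
    linarith [hn2 x, hnb x]
  have hcomm (x : E) : ∃ y, (X.1 (P.1 x), y) ∈ T.graph ∧
      ‖y + X.1 (b x)‖ ≤ 4 * γ * (1 + 2 * K) * δ * ‖x‖ := by
    obtain ⟨y, hy, hn⟩ := h.idQuot_commutator hγ hγ1 hl hΦ hs (ha x) (hb x)
    refine ⟨y, hy, hn.trans ?_⟩
    have h1 : ‖P.1 x‖ + ‖a x‖ + ‖b x‖ ≤ (2 + 4 * K) * ‖x‖ := by linarith [hn1 x, hna x, hnb x]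
    have h2 := mul_le_mul_of_nonneg_left h1 (show 0 ≤ 2 * γ * δ by positivity)
    linarith
  -- `Q₁` is TP and `Q₂` is TXP. Both must be adjointable for `Z` to lie in the C⋆-algebra.
  obtain ⟨Q₁, hQ₁⟩ := h.right.exists_adj_comp P (c := 2 * K) fun x => ⟨b x, hb x, hnb x⟩
  have hQ₁b (x : E) : Q₁.1 x = b x := graph_unique (hQ₁ x) (hb x)
  obtain ⟨Q₂, hQ₂⟩ := h.right.exists_adj_comp (X * P)
    (c := 4 * γ * (1 + 2 * K) * δ + ‖X.1‖ * (2 * K)) fun x => by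
      obtain ⟨y, hy, hn⟩ := hcomm x
      refine ⟨y, hy, ?_⟩
      have h1 := norm_sub_le (y + X.1 (b x)) (X.1 (b x))
      rw [add_sub_cancel_right] at h1
      have h2 := X.1.le_opNorm (b x)
      have h3 := mul_le_mul_of_nonneg_left (hnb x) (norm_nonneg X.1)
      linarith
  simp only [Adj.mul_apply] at hQ₂
  set Z := Q₂ + X * Q₁
  have hZ (x : E) : ‖Z.1 x‖ ≤ 4 * γ * (1 + 2 * K) * δ * ‖x‖ := by
    obtain ⟨y, hy, hn⟩ := hcomm x
    rw [Adj.add_apply, Adj.mul_apply, hQ₁b, graph_unique (hQ₂ x) hy]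
    exact hn
  have iX (x y : E) : inner B (X.1 x) y = inner B x (X.1 y) := by
    rw [inner_star_right, hX]
  have iP (x y : E) : inner B (P.1 x) y = inner B x (P.1 y) := by
    rw [inner_star_right, hP]
  have hsa : IsSelfAdjoint (star Q * Q * Z) := by
    rw [← hQ]
    refine star_eq_of_inner fun x y => ?_
    rw [Adj.mul_apply, Adj.mul_apply, iP (Z.1 x), ← iP x, Adj.add_apply, Adj.add_apply, Adj.mul_apply,
      Adj.mul_apply, CStarModule.inner_add_left, CStarModule.inner_add_right, iX,
      h.right.inner_graph (hQ₂ x) (hQ₁ y), iX, h.right.inner_graph (hQ₁ x) (hQ₂ y), add_comm]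
  have key := form_mul_ge hsa (by positivity) hZ hφ x
  rw [← hQ] at key
  have e1 : form φ x ((P * Z).1 x) = 2 * form φ (X.1 (P.1 x)) (b x) := by
    rw [Adj.mul_apply, form, ← iP, ← form, Adj.add_apply, Adj.mul_apply, hQ₁b, form_add_right,
      ← h.right.form_graph φ (hb x) (hQ₂ x), hφ.form_comm (b x)]
    simp only [form, iX]
    ring
  have e2 : 0 ≤ form φ (X.1 (P.1 x)) (a x) := by
    have f1 := hΦ.apply_graph (f := idQuot s) (h := sqQuot s) (fun t => by
      rw [idQuot_apply hs, sqQuot, quotFun_apply _ _ _ hs]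
      push_cast
      ring) (ha x)
    rw [form, iX, ← form, hXdef, ← f1]
    exact form_calc_nonneg Φ hφ (f := sqQuot s) (quotFun_apply _ _ _ hs)
      (fun t => by positivity) _
  have e3 : form φ ((Ψ idInvSqrt).1 x) (X.1 (P.1 x)) =
      form φ (X.1 (P.1 x)) (a x) + form φ (X.1 (P.1 x)) (b x) := by
    rw [hφ.form_comm, ← hab, form_add_right]
  rw [e1] at key
  rw [e3]
  linarith

/-- With y = (s² + D²)⁻¹z one has z = s²y + D²y, so ⟨χ(S)z, Dy⟩ splits into s²⟨χ(S)y, Dy⟩ and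
⟨χ(S)D(Dy), Dy⟩. The bound for Dχ(S) applies at y and at Dy, and the two errors add up to c⟨z, √(1 +
D²)(s² + D²)⁻¹z⟩. -/
theorem StronglyAnticommuting.form_chi_mul_chi_ge {γ l K : ℝ}
    (h : StronglyAnticommuting B S T (γ ^ 2) l) (hγ : 0 < γ) (hγ1 : γ ≤ 1 / 2) (hl : l ≤ 1)
    (hK : 0 ≤ K)
    (hTK : ∀ u a b, (u, a) ∈ S.graph → (u, b) ∈ T.graph → ‖b‖ ≤ K * (‖a + b‖ + ‖u‖))
    (hD : IsSelfAdjointRegular B (S + T))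
    (hΦ : IsFunctionalCalculus S Φ) (hΨ : IsFunctionalCalculus (S + T) Ψ) {φ : B →L[ℝ] ℝ}
    (hφ : IsPosFunctional φ) (z : E) :
    -(8 * γ * (1 + 2 * K) * form φ z z) ≤ form φ ((Φ chi).1 z) ((Ψ chi).1 z) := by
  have hinv := form_calc_nonneg Ψ hφ (f := invSqrt)
    (p := fun t => (Real.sqrt (1 + t ^ 2))⁻¹) (fun t => rfl) (fun t => by positivity)
  set c := 2 * γ * (1 + 2 * K) with hc
  have hc0 : 0 ≤ c := by positivity
  have step (x : E) : -(c * form φ x ((Ψ invSqrt).1 x)) ≤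
      form φ ((Ψ idInvSqrt).1 x) ((Φ chi).1 ((Ψ invSqrt).1 x)) :=
    hΦ.le_form_chi h.left (mul_nonneg hc0 (hinv x)) fun s hs =>
      h.form_idQuot_ge hγ hγ1 hl hK hTK hΦ hΨ hφ hs x
  have hF (x y : E) : form φ ((Φ chi).1 x) y = form φ x ((Φ chi).1 y) :=
    form_calc_symm Φ φ star_chi x y
  have main := hΨ.le_form_chi_of_sqrtQuot hD hφ (v := (Φ chi).1 z) (z := z) hc0 fun s hs => by
    have sq (t : ℝ) : (Real.sqrt (1 + t ^ 2)) ^ 2 = 1 + t ^ 2 := Real.sq_sqrt (by positivity)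
    have hs0 (t : ℝ) : s ^ 2 + t ^ 2 ≠ 0 := by positivity
    have hr := sqrt_one_add_sq_ne_zero
    have ap {x y w : ℝ →ᵇ ℂ} {p q r : ℝ → ℝ} (hx : ∀ t, x t = (p t : ℂ))
        (hy : ∀ t, y t = (q t : ℂ)) (hw : ∀ t, w t = (r t : ℂ)) (he : ∀ t, p t * q t = r t) :
        (Ψ x).1 ((Ψ y).1 z) = (Ψ w).1 z := by
      rw [calc_mul_apply]
      congr 3
      ext t
      rw [BoundedContinuousFunction.mul_apply, hx, hy, hw, ← he]
      push_cast
      rfl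
    have v1 (t : ℝ) : oneQuot s t = ((1 / (s ^ 2 + t ^ 2) : ℝ) : ℂ) := quotFun_apply _ _ _ hs t
    have v2 (t : ℝ) : sqQuot s t = ((t ^ 2 / (s ^ 2 + t ^ 2) : ℝ) : ℂ) := quotFun_apply _ _ _ hs t
    have v3 (t : ℝ) : idSqrtQuot s t =
      ((t * Real.sqrt (1 + t ^ 2) / (s ^ 2 + t ^ 2) : ℝ) : ℂ) := quotFun_apply _ _ _ hs t
    have v4 := idQuot_apply hs
    have v5 := sqrtQuot_apply hs
    have v6 (t : ℝ) : invSqrt t = (((Real.sqrt (1 + t ^ 2))⁻¹ : ℝ) : ℂ) := rfl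
    have v7 (t : ℝ) : idInvSqrt t = ((t * (Real.sqrt (1 + t ^ 2))⁻¹ : ℝ) : ℂ) := rfl
    have a1 := ap v6 v5 v1 fun t => by have := hr t; field_simp
    have a2 := ap v7 v5 v4 fun t => by have := hr t; field_simp
    have a3 := ap v6 v3 v4 fun t => by have := hr t; field_simp
    have a4 := ap v7 v3 v2 fun t => by have := hr t; field_simp
    -- The vectors are chosen so that P maps them to (s² + D²)⁻¹z and D(s² + D²)⁻¹z.
    have s1 := step ((Ψ (sqrtQuot s)).1 z)
    have s2 := step ((Ψ (idSqrtQuot s)).1 z)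
    rw [a1, a2] at s1
    rw [a3, a4] at s2
    rw [form_calc_symm Ψ φ (star_eq_self_of_real v5), calc_mul_apply] at s1
    rw [form_calc_symm Ψ φ (star_eq_self_of_real v3), calc_mul_apply] at s2
    have d1 : (s ^ 2) • (Ψ (oneQuot s)).1 z + (Ψ (sqQuot s)).1 z = z := by
      rw [← Complex.coe_smul, ← Adj.smul_apply, ← map_smul, ← Adj.add_apply, ← map_add]
      conv_rhs => rw [← Adj.one_apply (B := B) z, ← map_one Ψ]
      congr 3
      ext t
      rw [BoundedContinuousFunction.add_apply, BoundedContinuousFunction.smul_apply, v1, v2,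
        smul_eq_mul, ← Complex.ofReal_mul, ← Complex.ofReal_add,
        BoundedContinuousFunction.coe_one, Pi.one_apply, ← Complex.ofReal_one]
      congr 1
      have := hs0 t
      field_simp
    have d2 : (s ^ 2) • (Ψ (sqrtQuot s * oneQuot s)).1 z +
        (Ψ (idSqrtQuot s * idQuot s)).1 z = (Ψ (sqrtQuot s)).1 z := by
      rw [← Complex.coe_smul, ← Adj.smul_apply, ← map_smul, ← Adj.add_apply, ← map_add]
      congr 3
      ext t
      rw [BoundedContinuousFunction.add_apply, BoundedContinuousFunction.smul_apply,
        BoundedContinuousFunction.mul_apply, BoundedContinuousFunction.mul_apply, v1, v3, v4, v5,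
        smul_eq_mul, ← Complex.ofReal_mul, ← Complex.ofReal_mul, ← Complex.ofReal_mul,
        ← Complex.ofReal_add]
      congr 1
      have := hs0 t
      field_simp
    have gen (w : E) : form φ ((Φ chi).1 z) w = s ^ 2 * form φ w ((Φ chi).1 ((Ψ (oneQuot s)).1 z)) +
        form φ ((Ψ (sqQuot s)).1 z) ((Φ chi).1 w) := by
      rw [hF]
      conv_lhs => rw [← d1]
      rw [form_add_left, form_smul_left, ← hF, hφ.form_comm ((Φ chi).1 _)]
    rw [← d2, form_add_right, form_smul_right, gen]
    have s3 := mul_le_mul_of_nonneg_left s1 (sq_nonneg s)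
    linarith
  linarith

end Estimates

end HilbertMod

namespace HilbertMod

/-! ### Choice of r and the final inequality. -/

section Conclusion

/-- With γ = r√C and K = 2(8C + 1), the last condition says that twice the error 8γ(1 + 2K) of
`form_chi_mul_chi_ge` is at most κ. -/
theorem exists_scale (C l : ℝ) {κ : ℝ} (hκ : 0 < κ) :
    ∃ r, 0 < r ∧ r ≤ 1 ∧ r * l ≤ 1 ∧ r * √C ≤ 1 / 2 ∧
      16 * (r * √C) * (1 + 2 * (2 * (8 * C + 1))) ≤ κ := by
  have small (a b : ℝ) (hb : 0 < b) : ∀ᶠ r : ℝ in nhds 0, r * a ≤ b := by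
    have h1 : Filter.Tendsto (fun r : ℝ => r * a) (nhds 0) (nhds 0) :=
      Continuous.tendsto' (by fun_prop) _ _ (by simp)
    exact h1.eventually_le_const hb
  have h := ((small 1 1 one_pos).and ((small l 1 one_pos).and ((small (√C) (1 / 2) (by norm_num)).and
    (small (16 * √C * (1 + 2 * (2 * (8 * C + 1)))) κ hκ)))).filter_mono
      (nhdsWithin_le_nhds (s := Set.Ioi 0))
  obtain ⟨r, ⟨h1, h2, h3, h4⟩, hr⟩ := (h.and self_mem_nhdsWithin).exists
  exact ⟨r, hr, by linarith, h2, h3, by linarith⟩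

variable {A B E : Type*} [NonUnitalCStarAlgebra A] [NonUnitalCStarAlgebra B] [PartialOrder B]
  [StarOrderedRing B] [NormedAddCommGroup E] [NormedSpace ℂ E] [CompleteSpace E] [SMul B E]
  [CStarModule B E] {S T : E →ₗ.[ℂ] E} {C l : ℝ}

theorem star_calc_chi (Φ : (ℝ →ᵇ ℂ) →⋆ₐ[ℂ] Adj B E) : star (Φ chi) = Φ chi := by
  rw [← map_star, star_chi]

/-- The relative bound is taken from the unscaled pair, so it does not depend on r and cannot offset
the smallness of γ. -/
theorem StronglyAnticommuting.norm_le_smul_add (h : StronglyAnticommuting B S T C l) (hC : 0 < C)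
    {r : ℝ} (hr : 0 < r) (hr1 : r ≤ 1) (u a b : E) (ha : (u, a) ∈ ((r : ℂ) • S).graph)
    (hb : (u, b) ∈ ((r : ℂ) • T).graph) : ‖b‖ ≤ 2 * (8 * C + 1) * (‖a + b‖ + ‖u‖) := by
  obtain ⟨a, ha', rfl⟩ := mem_graph_smul_iff.1 ha
  obtain ⟨b, hb', rfl⟩ := mem_graph_smul_iff.1 hb
  have h1 := mul_le_mul_of_nonneg_left (h.norm_le_add hC ha' hb') hr.le
  rw [← smul_add, norm_smul, norm_smul, Complex.norm_real, Real.norm_eq_abs, abs_of_pos hr]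
  have h2 : 0 ≤ C * (r * ‖a + b‖) := by positivity
  have h3 : r * ((8 * C + 1) * ‖u‖) ≤ 1 * ((8 * C + 1) * ‖u‖) := by gcongr
  linarith

theorem zero_mem_compacts : (0 : Adj B E) ∈ compacts B E :=
  subset_closure (Submodule.zero_mem _)

theorem opLEModLocallyCompact_of_form (π : A →⋆ₙₐ[ℂ] Adj B E) {F G : Adj B E} (hF : star F = F)
    (hG : star G = G) {κ : ℝ}
    (h : ∀ f : B →L[ℝ] ℝ, IsPosFunctional f → ∀ z,
      -(κ * form f z z) ≤ 2 * form f (F.1 z) (G.1 z)) :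
    OpLEModLocallyCompact π ((-κ : ℂ) • (1 : Adj B E)) (F * G + G * F) := by
  -- The inequality of forms is exact, so the locally compact correction is 0.
  refine ⟨0, fun a => by simpa using zero_mem_compacts, fun z => ?_⟩
  have iF (x y : E) : inner B x (F.1 y) = inner B (F.1 x) y := by rw [inner_star_right, hF]
  have iG (x y : E) : inner B x (G.1 y) = inner B (G.1 x) y := by rw [inner_star_right, hG]
  have e1 : inner B z ((F * G + G * F + 0).1 z) =
      inner B (F.1 z) (G.1 z) + inner B (G.1 z) (F.1 z) := by
    rw [add_zero, Adj.add_apply, Adj.mul_apply, Adj.mul_apply, CStarModule.inner_add_right, iF z (G.1 z),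
      iG z (F.1 z)]
  have e2 : inner B z ((((-κ : ℂ) • (1 : Adj B E))).1 z) = -(κ • inner B z z) := by
    rw [Adj.smul_apply, Adj.one_apply, neg_smul, Complex.coe_smul]
    simp
  rw [e1, e2]
  refine le_of_posFunctional ?_ fun f hf => ?_
  · rw [sub_neg_eq_add]
    refine IsSelfAdjoint.add ?_ ((IsSelfAdjoint.all κ).smul CStarModule.isSelfAdjoint_inner_self)
    rw [IsSelfAdjoint, star_add, CStarModule.star_inner, CStarModule.star_inner, add_comm]
  · have h1 := h f hf z
    have h2 := hf.form_comm (F.1 z) (G.1 z)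
    simp only [form] at h1 h2
    rw [map_neg, map_smul, map_add, smul_eq_mul]
    linarith

end Conclusion

end HilbertMod

theorem proposition7p9
    {A B E : Type*} [NonUnitalCStarAlgebra A]
    [NonUnitalCStarAlgebra B] [PartialOrder B] [StarOrderedRing B]
    [NormedAddCommGroup E] [NormedSpace ℂ E] [CompleteSpace E] [SMul B E] [CStarModule B E]
    (π : A →⋆ₙₐ[ℂ] HilbertMod.Adj B E)
    (S T : E →ₗ.[ℂ] E)
    (hST : HilbertMod.IsWeaklyAnticommuting B S T)
    (hplus : HilbertMod.HasLocallyCompactResolvents π (S + T))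
    (hminus : HilbertMod.HasLocallyCompactResolvents π (S - T))
    (κ : ℝ) (hκ : 0 < κ) :
    ∃ r : ℝ, 0 < r ∧
      HilbertMod.IsWeaklyAnticommuting B ((r : ℂ) • S) ((r : ℂ) • T) ∧
      HilbertMod.IsSelfAdjointRegular B ((r : ℂ) • S + (r : ℂ) • T) ∧
      ∃ F G : HilbertMod.Adj B E,
        HilbertMod.IsFunctionOf HilbertMod.chi ((r : ℂ) • S) F ∧
        HilbertMod.IsFunctionOf HilbertMod.chi ((r : ℂ) • S + (r : ℂ) • T) G ∧
        HilbertMod.OpLEModLocallyCompact π ((-κ : ℂ) • (1 : HilbertMod.Adj B E))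
          (F * G + G * F) := by
  obtain ⟨C, l, hC, hl, h⟩ := hST.exists_stronglyAnticommuting
  obtain ⟨r, hr, hr1, hrl, hrC, hrκ⟩ := HilbertMod.exists_scale C l hκ
  have hr2 : 0 < r ^ 2 * C := by positivity
  have h' := h.smul hC hr hr1
  have hD := h'.isSelfAdjointRegular_add hr2
  refine ⟨r, hr, h'.isWeaklyAnticommuting hr2 (by positivity), hD, ?_⟩
  obtain ⟨Φ, hΦ⟩ := h'.left.exists_calculus
  obtain ⟨Ψ, hΨ⟩ := hD.exists_calculus
  refine ⟨Φ HilbertMod.chi, Ψ HilbertMod.chi, ⟨Φ, hΦ, rfl⟩, ⟨Ψ, hΨ, rfl⟩,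
    HilbertMod.opLEModLocallyCompact_of_form π
      (HilbertMod.star_calc_chi Φ) (HilbertMod.star_calc_chi Ψ) fun f hf z => ?_⟩
  have e : r ^ 2 * C = (r * √C) ^ 2 := by rw [mul_pow, Real.sq_sqrt hC.le]
  rw [e] at h'
  have key := h'.form_chi_mul_chi_ge (K := 2 * (8 * C + 1)) (by positivity) hrC hrl
    (by positivity) (h.norm_le_smul_add hC hr hr1) hD hΦ hΨ hf z
  have h2 := mul_le_mul_of_nonneg_right hrκ (hf.form_self_nonneg z)
  linarith
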